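/- **Theorem 2.1 (interior Pogorelov estimate).** Let $\mathcal U\subset\mathbb R^n\times\mathbb R\times\mathbb R^n$ be a domain, with points denoted $(x,z,p)$, such that $\{p : (x,z,p)\in\mathcal U\}$ is convex for all fixed $(x,z)$, and let $\mathcal U_0\subset\subset\mathcal U$ (that is, $\overline{\mathcal U_0}$ is compact and contained in $\mathcal U$). Let $M, C', \Phi\ge 0$. Then there are positive constants $\beta,\delta_1,\delta_2,C$, depending only on $n,\mathcal U,\mathcal U_0,M,C',\Phi$, with the following property. Let $A=[A_{ij}]$ be a $C^2$ symmetric $n\times n$ matrix function and $B>0$ a $C^2$ scalar function on $\mathcal U$, with $|A,\log B|_{2;\mathcal U_0}\le M$ (the sum of the suprema over $\mathcal U_0$ of $A$, $\log B$ and their derivatives up to second order), and let $A$ be regular (A3w): $$\sum_{i,j,k,l}(D_{p_kp_l}A_{ij})\,\xi_i\xi_j\eta_k\eta_l\ge 0\ \text{ in }\mathcal U\quad\text{for all }\xi,\eta\in\mathbb R^n\text{ with }\xi\cdot\eta=0 .$$ Let $\Omega\subset\mathbb R^n$ be a bounded domain and write $J_1[v](x)=(x,v(x),Dv(x))$. Let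 $u\in C^4(\Omega)\cap C^{0,1}(\overline\Omega)$ be an elliptic solution of $\det[D^2u-A(\cdot,u,Du)]=B(\cdot,u,Du)$ in $\Omega$, i.e. $w:=D^2u-A(\cdot,u,Du)$ is positive definite in $\Omega$. Let $u_0\in C^2(\Omega)\cap C^{0,1}(\overline\Omega)$ be a degenerate elliptic supersolution, i.e. $D^2u_0-A(\cdot,u_0,Du_0)\ge 0$ and $\det[D^2u_0-A(\cdot,u_0,Du_0)]\le B(\cdot,u_0,Du_0)$ in $\Omega$. Suppose that $u=u_0$ on $\partial\Omega$, that $u<u_0$ in $\Omega$, that $J_1[u](\Omega),J_1[u_0](\Omega)\subset\mathcal U_0$, and that for every $x\in\Omega$ the set $\mathcal U_0$ also contains the two segments joining $(x,u_0(x),Du_0(x))$ to $(x,u(x),Du_0(x))$ and $(x,u(x),Du_0(x))$ to $(x,u(x),Du(x))$. Suppose further that there is a function $\phi\in C^2(\overline\Omega)$, $\phi\ge0$, with $|\phi|_{1;\Omega}=\sup_\Omega|\phi|+\sup_\Omega|D\phi|\le\Phi$ and $$\mathcal L\phi:=\sum_{i,j}w^{ij}\Big[D_{ij}\phi-\sum_kD_{p_k}A_{ij}(\cdot,u,Du)\,D_k\phi\Big]\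 \ge\ \sum_i w^{ii}-C'\quad\text{in }\Omega,$$ where $[w^{ij}]=w^{-1}$. If either (i) $D_zA>-\delta_1 I$ in $\mathcal U_0$ (as symmetric matrices), or (ii) $\operatorname{diam}\Omega<\delta_2$ (Euclidean diameter), then $$\sup_\Omega\,(u_0-u)^\beta\,|D^2u|\le C .$$ -/

import Mathlib

open scoped NNReal ENNReal

noncomputable section

namespace MATE

/-- Points `(x, z, p)` of `ℝⁿ × ℝ × ℝⁿ`: position, value, gradient. -/
abbrev Jet (n : ℕ) : Type :=
  EuclideanSpace ℝ (Fin n) × ℝ × EuclideanSpace ℝ (Fin n)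

variable {n : ℕ}

/-- The partial derivative `D_k f`. -/
def partialD (k : Fin n) (f : EuclideanSpace ℝ (Fin n) → ℝ) (x : EuclideanSpace ℝ (Fin n)) : ℝ :=
  fderiv ℝ f x (EuclideanSpace.single k 1)

/-- The Hessian matrix `D²f = [D_i D_j f]`. -/
def hessian (f : EuclideanSpace ℝ (Fin n) → ℝ) (x : EuclideanSpace ℝ (Fin n)) :
    Matrix (Fin n) (Fin n) ℝ :=
  Matrix.of fun i j => partialD i (partialD j f) x

/-- `|D²f|`, the Euclidean (Frobenius) norm of the Hessian matrix. -/
def hessianNorm (f : EuclideanSpace ℝ (Fin n) → ℝ) (x : EuclideanSpace ℝ (Fin n)) : ℝ :=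
  Real.sqrt (∑ i, ∑ j, hessian f x i j ^ 2)

/-- The one-jet `J₁[u](x) = (x, u(x), Du(x))`. -/
def oneJet (u : EuclideanSpace ℝ (Fin n) → ℝ) (x : EuclideanSpace ℝ (Fin n)) : Jet n :=
  (x, u x, gradient u x)

/-- The derivative with respect to the value variable `z` of a function of `(x, z, p)`. -/
def jetDz (f : Jet n → ℝ) (q : Jet n) : ℝ :=
  fderiv ℝ f q (0, 1, 0)

/-- The derivative with respect to `p_k` of a function of `(x, z, p)`. -/
def jetDp (k : Fin n) (f : Jet n → ℝ) (q : Jet n) : ℝ :=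
  fderiv ℝ f q (0, 0, EuclideanSpace.single k 1)

/-- The matrix `D_u A`: the entrywise derivative of `A` in the variable `z`. -/
def matrixDz (A : Jet n → Matrix (Fin n) (Fin n) ℝ) (q : Jet n) : Matrix (Fin n) (Fin n) ℝ :=
  Matrix.of fun i j => jetDz (fun r => A r i j) q

/-- Regularity (A3w) of `A` on `U`:
`(D_{p_k p_l} A_{ij}) ξ_i ξ_j η_k η_l ≥ 0` in `U` whenever `ξ · η = 0`. -/
def IsRegularMatrix (A : Jet n → Matrix (Fin n) (Fin n) ℝ) (U : Set (Jet n)) : Prop :=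
  ∀ q ∈ U, ∀ ξ η : EuclideanSpace ℝ (Fin n), inner ℝ ξ η = 0 →
    0 ≤ ∑ i, ∑ j, ∑ k, ∑ l,
      jetDp k (jetDp l (fun r => A r i j)) q * ξ i * ξ j * η k * η l

/-- The augmented Hessian `w = D²u - A(·, u, Du)`. -/
def augHessian (A : Jet n → Matrix (Fin n) (Fin n) ℝ) (u : EuclideanSpace ℝ (Fin n) → ℝ)
    (x : EuclideanSpace ℝ (Fin n)) : Matrix (Fin n) (Fin n) ℝ :=
  hessian u x - A (oneJet u x)

/-- `u` satisfies `det [D²u - A(·,u,Du)] = B(·,u,Du)` in `Ω` with `D²u - A(·,u,Du) > 0`. -/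
def IsEllipticSolution (A : Jet n → Matrix (Fin n) (Fin n) ℝ) (B : Jet n → ℝ)
    (Ω : Set (EuclideanSpace ℝ (Fin n))) (u : EuclideanSpace ℝ (Fin n) → ℝ) : Prop :=
  ∀ x ∈ Ω, (augHessian A u x).PosDef ∧ (augHessian A u x).det = B (oneJet u x)

/-- `v` satisfies `det [D²v - A(·,v,Dv)] ≤ B(·,v,Dv)` in `Ω` with `D²v - A(·,v,Dv) ≥ 0`. -/
def IsDegenerateEllipticSupersolution (A : Jet n → Matrix (Fin n) (Fin n) ℝ) (B : Jet n → ℝ)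
    (Ω : Set (EuclideanSpace ℝ (Fin n))) (v : EuclideanSpace ℝ (Fin n) → ℝ) : Prop :=
  ∀ x ∈ Ω, (augHessian A v x).PosSemidef ∧ (augHessian A v x).det ≤ B (oneJet v x)

/-- The linearized operator
`𝓛[u] φ = w^{ij} (D_{ij} φ - D_{p_k} A_{ij}(·,u,Du) D_k φ)`, with `[w^{ij}]` the inverse of
the augmented Hessian `w` of `u`. -/
def linearizedOp (A : Jet n → Matrix (Fin n) (Fin n) ℝ) (u φ : EuclideanSpace ℝ (Fin n) → ℝ)
    (x : EuclideanSpace ℝ (Fin n)) : ℝ :=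
  ∑ i, ∑ j, (augHessian A u x)⁻¹ i j *
    (hessian φ x i j - ∑ k, jetDp k (fun r => A r i j) (oneJet u x) * partialD k φ x)

/-- `|f|_{k;S} = ∑_{j ≤ k} sup_S |D^j f|`, with values in `[0, ∞]`. -/
def cNorm {F : Type*} [NormedAddCommGroup F] [NormedSpace ℝ F] (k : ℕ) (f : F → ℝ) (S : Set F) :
    ℝ≥0∞ :=
  ∑ j ∈ Finset.range (k + 1), ⨆ x ∈ S, ‖iteratedFDeriv ℝ j f x‖ₑ

/-- `|A, log B|_{2;S}`: the sum of the `C²` norms on `S` of the entries of `A` and of `log B`. -/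
def dataNorm (A : Jet n → Matrix (Fin n) (Fin n) ℝ) (B : Jet n → ℝ) (S : Set (Jet n)) : ℝ≥0∞ :=
  (∑ i, ∑ j, cNorm 2 (fun q => A q i j) S) + cNorm 2 (fun q => Real.log (B q)) S

/-- `f ∈ C^{0,1}(Ω̄)`. -/
def IsLipschitzUpToBoundary (Ω : Set (EuclideanSpace ℝ (Fin n)))
    (f : EuclideanSpace ℝ (Fin n) → ℝ) : Prop :=
  ∃ K : ℝ≥0, LipschitzOnWith K f (closure Ω)

/-- `f ∈ C²(Ω̄)`: `f` is `C²` in the open set `Ω`, continuous on `Ω̄`, and its derivatives of first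
and second order in `Ω` extend continuously to `Ω̄`. -/
def IsC2UpToBoundary (Ω : Set (EuclideanSpace ℝ (Fin n)))
    (f : EuclideanSpace ℝ (Fin n) → ℝ) : Prop :=
  ContDiffOn ℝ 2 f Ω ∧ ContinuousOn f (closure Ω) ∧
    (∀ i, ∃ g : EuclideanSpace ℝ (Fin n) → ℝ,
      ContinuousOn g (closure Ω) ∧ Set.EqOn g (partialD i f) Ω) ∧
    (∀ i j, ∃ g : EuclideanSpace ℝ (Fin n) → ℝ,
      ContinuousOn g (closure Ω) ∧ Set.EqOn g (fun x => hessian f x i j) Ω)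

end MATE

end

open MATE

/-!
# The interior Pogorelov estimate under the regularity condition A3w

The estimate is obtained from the maximum principle for the test function
`log w_{ξξ} + τ |Du|² / 2 + β log ζ + χ`, as a function of the point and of the unit vector `ξ`.
Here `ζ` is a cutoff close to `u₀ - u`, and `χ` is a barrier. At a maximum point `ξ` may be taken to
be an eigenvector `b o` of the augmented Hessian `w` for the top eigenvalue `λ = lam o`. All
calculations take place at this point, in an orthonormal frame `b` of eigenvectors, for the full
linearization `frameOp` of `log det [D²u - A(·,u,Du)] = log B(·,u,Du)`. Write `T` for the trace of
`w⁻¹`.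

* Differentiating the equation twice in the direction of the top eigenvector bounds the operator on
  `log w_{oo}` from below by `-C (T + λ)`, up to a good quadratic term in the derivatives
  `D_i w_{oo}` with `i ≠ o` (`SolutionAt.frameOp_log_augForm_ge`). Twofold differentiation of `A`
  along `D²u` would give a term of order `λ² T`; regularity of `A` makes it nonnegative, except in
  the direction of the eigenvector itself, where the factor `w^{oo} = 1 / λ` compensates.
* The operator on `|Du|² / 2` is at least `λ / 2 - C (1 + T)`
  (`SolutionAt.frameOp_gradient_sq_ge`), so that a large `τ` absorbs all multiples of `λ`.
* The operator on `η = u₀ - u` is at least `-C - a η T - C ∑ w^{ii} |D_i η|`, where `-a` is a lower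
  bound for `D_z A` (`PogorelovSetting.frameOp_sub_ge`). This uses that `D²u₀ - A(·,u₀,Du₀) ≥ 0`, and
  regularity of `A` along the segment from `Du` to `Du₀`: a quadratic form that is nonnegative on
  the complement of `b i` is bounded below by a multiple of the component along `b i`
  (`quadratic_lower_bound`), and for the gradient of `η` this component is `D_i η`.
* The operator on `χ` is at least `Λ T + K₁ ∑ w^{ii} |D_i χ| - C` with `Λ` as large as desired: for
  `χ = exp (κ φ)` in general (`SolutionAt.frameOp_exp_barrier_ge`), and for a multiple of the squared
  distance to a point on a domain of small diameter (`SolutionAt.frameOp_quadratic_barrier_ge`).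
  It absorbs the multiples of `T`.
* The bad term `β ∑ w^{ii} (D_i ζ / ζ)²` is treated by the vanishing of the gradient of the test
  function. For `i ≠ o` it is `1 / β` times a square that contains `D_i w_{oo} / w_{oo}`, and is
  absorbed by the good quadratic term if `β` is large; for `i = o` it is bounded by a multiple of
  `1 / (λ ζ²)`. What remains is a bound for `λ ζ` (`SolutionAt.lam_le_of_isLocalMax`).

The constants have to be chosen in the right order. The term `β a T` has to be absorbed by the
barrier, while `β` has to dominate the gradient of the barrier. If `D_z A > -δ₁ I`, the barrier and
`β` are chosen first, and `δ₁` is at most `1 / β`. On a domain of small diameter the multiple of the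
squared distance may be as large as desired while its gradient remains bounded by `1`, so that `β`
can be chosen before the barrier.

Since the second derivatives of `u` may be unbounded near the boundary, the existence of a maximum
requires a cutoff that vanishes near the boundary. The function `u₀ - u - ε` would do, but the term
`a ε T` that it produces cannot be divided by the cutoff. The cutoff `u₀ - u - ε (1 + X - χ)`,
`0 ≤ χ ≤ X`, satisfies the same differential inequality as `u₀ - u`, because `Λ ≥ a (1 + X)`
(`SolutionAt.frameOp_cutoff_ge`), and `ε` may be taken as small as desired.
-/

namespace MATE

open Filter Topology

/-! ### Iterated directional derivatives -/

section Directional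

variable {V F G : Type*} [NormedAddCommGroup V] [NormedSpace ℝ V]
  [NormedAddCommGroup F] [NormedSpace ℝ F] [NormedAddCommGroup G] [NormedSpace ℝ G]

/-- The directional derivative `D_v f`, as a function of the base point, so that it can be
iterated. -/
noncomputable def dir (v : V) (f : V → F) (x : V) : F := fderiv ℝ f x v

theorem dir_eventuallyEq {f g : V → F} {x : V} (h : f =ᶠ[𝓝 x] g) (v : V) :
    dir v f =ᶠ[𝓝 x] dir v g := by
  filter_upwards [h.fderiv (𝕜 := ℝ)] with y hy
  simp only [dir, hy]

theorem dir_congr {f g : V → F} {x : V} (h : f =ᶠ[𝓝 x] g) (v : V) : dir v f x = dir v g x :=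
  (dir_eventuallyEq h v).eq_of_nhds

theorem contDiffAt_dir {f : V → F} {x : V} {m k : WithTop ℕ∞} (hf : ContDiffAt ℝ m f x)
    (h : k + 1 ≤ m) (v : V) : ContDiffAt ℝ k (dir v f) x :=
  (hf.fderiv_right h).clm_apply contDiffAt_const

theorem dir_add {f g : V → F} {x : V} (hf : DifferentiableAt ℝ f x) (hg : DifferentiableAt ℝ g x)
    (v : V) : dir v (fun y => f y + g y) x = dir v f x + dir v g x := by
  simp only [dir]; rw [fderiv_fun_add hf hg]; rfl

theorem dir_sub {f g : V → F} {x : V} (hf : DifferentiableAt ℝ f x) (hg : DifferentiableAt ℝ g x)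
    (v : V) : dir v (fun y => f y - g y) x = dir v f x - dir v g x := by
  simp only [dir]; rw [fderiv_fun_sub hf hg]; rfl

theorem dir_const_mul {f : V → ℝ} {x : V} (hf : DifferentiableAt ℝ f x) (c : ℝ)
    (v : V) : dir v (fun y => c * f y) x = c * dir v f x := by
  simp only [dir]; rw [fderiv_const_mul hf]; rfl

theorem dir_const (v : V) (c : F) (x : V) : dir v (fun _ => c) x = 0 := by
  simp [dir]

theorem dir_sum {ι : Type*} (s : Finset ι) {f : ι → V → F} {x : V}
    (hf : ∀ i ∈ s, DifferentiableAt ℝ (f i) x) (v : V) :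
    dir v (fun y => ∑ i ∈ s, f i y) x = ∑ i ∈ s, dir v (f i) x := by
  simp only [dir]; rw [fderiv_fun_sum hf]; simp

theorem dir_clm_comp (L : F →L[ℝ] G) {f : V → F} {x : V} (hf : DifferentiableAt ℝ f x) (v : V) :
    dir v (fun y => L (f y)) x = L (dir v f x) := by
  simp only [dir]
  rw [show (fun y => L (f y)) = L ∘ f from rfl, fderiv_comp x L.differentiableAt hf]
  simp

theorem dir_clm (L : V →L[ℝ] F) (v x : V) : dir v (fun y => L y) x = L v := by
  simp [dir]

theorem eventually_differentiableAt {f : V → F} {x : V} {m : ℕ}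
    (hf : ContDiffAt ℝ m f x) (hm : 1 ≤ m) : ∀ᶠ y in 𝓝 x, DifferentiableAt ℝ f y := by
  filter_upwards [hf.eventually (by simp)] with y hy
  exact hy.differentiableAt (by simp; omega)

theorem eventually_differentiableAt_two {f : V → F} {x : V}
    (hf : ContDiffAt ℝ 2 f x) : ∀ᶠ y in 𝓝 x, DifferentiableAt ℝ f y :=
  eventually_differentiableAt (m := 2) hf (by norm_num)

theorem dir_dir_apply {f : V → F} {x : V} (hf : ContDiffAt ℝ 2 f x) (v w : V) :
    dir v (dir w f) x = fderiv ℝ (fderiv ℝ f) x v w := by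
  have h1 : DifferentiableAt ℝ (fderiv ℝ f) x :=
    (hf.fderiv_right (m := 1) (by norm_num)).differentiableAt (by norm_num)
  exact dir_clm_comp (ContinuousLinearMap.apply ℝ F w) h1 v

theorem dir_comm {f : V → F} {x : V} (hf : ContDiffAt ℝ 2 f x) (v w : V) :
    dir v (dir w f) x = dir w (dir v f) x := by
  rw [dir_dir_apply hf, dir_dir_apply hf]
  exact hf.isSymmSndFDerivAt (by simp) v w

theorem dir_comm_eventually {f : V → F} {x : V} (hf : ContDiffAt ℝ 2 f x) (v w : V) :
    dir v (dir w f) =ᶠ[𝓝 x] dir w (dir v f) := by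
  filter_upwards [hf.eventually (by simp)] with y hy using dir_comm hy v w

theorem dir_dir_dir_comm {f : V → F} {x : V} (hf : ContDiffAt ℝ 3 f x) (v w : V) :
    dir v (dir w (dir w f)) x = dir w (dir w (dir v f)) x := by
  rw [dir_comm (contDiffAt_dir hf (by norm_num) w)]
  exact dir_congr (dir_comm_eventually (hf.of_le (by norm_num)) v w) w

theorem dir_four_comm {f : V → F} {x : V} (hf : ContDiffAt ℝ 4 f x) (v w : V) :
    dir v (dir v (dir w (dir w f))) x = dir w (dir w (dir v (dir v f))) x := by
  have h1 : dir v (dir w (dir w f)) =ᶠ[𝓝 x] dir w (dir w (dir v f)) := by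
    filter_upwards [hf.eventually (by simp)] with y hy
    exact dir_dir_dir_comm (hy.of_le (by norm_num)) v w
  rw [dir_congr h1 v]
  exact dir_dir_dir_comm (contDiffAt_dir hf (by norm_num) v) v w

theorem dir_dir_add {f g : V → F} {x : V} (hf : ContDiffAt ℝ 2 f x) (hg : ContDiffAt ℝ 2 g x)
    (v w : V) : dir v (dir w (fun y => f y + g y)) x = dir v (dir w f) x + dir v (dir w g) x := by
  have h : dir w (fun y => f y + g y) =ᶠ[𝓝 x] fun y => dir w f y + dir w g y := by
    filter_upwards [eventually_differentiableAt_two hf,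
      eventually_differentiableAt_two hg] with y h1 h2 using dir_add h1 h2 w
  rw [dir_congr h, dir_add]
  · exact (contDiffAt_dir hf (k := 1) (by norm_num) w).differentiableAt (by norm_num)
  · exact (contDiffAt_dir hg (k := 1) (by norm_num) w).differentiableAt (by norm_num)

theorem dir_dir_sub {f g : V → F} {x : V} (hf : ContDiffAt ℝ 2 f x) (hg : ContDiffAt ℝ 2 g x)
    (v w : V) : dir v (dir w (fun y => f y - g y)) x = dir v (dir w f) x - dir v (dir w g) x := by
  have h : dir w (fun y => f y - g y) =ᶠ[𝓝 x] fun y => dir w f y - dir w g y := by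
    filter_upwards [eventually_differentiableAt_two hf,
      eventually_differentiableAt_two hg] with y h1 h2 using dir_sub h1 h2 w
  rw [dir_congr h, dir_sub]
  · exact (contDiffAt_dir hf (k := 1) (by norm_num) w).differentiableAt (by norm_num)
  · exact (contDiffAt_dir hg (k := 1) (by norm_num) w).differentiableAt (by norm_num)

theorem dir_dir_const_mul {f : V → ℝ} {x : V} (hf : ContDiffAt ℝ 2 f x) (c : ℝ)
    (v w : V) : dir v (dir w (fun y => c * f y)) x = c * dir v (dir w f) x := by
  have h : dir w (fun y => c * f y) =ᶠ[𝓝 x] fun y => c * dir w f y := by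
    filter_upwards [eventually_differentiableAt_two hf]
      with y h1 using dir_const_mul h1 c w
  rw [dir_congr h, dir_const_mul]
  exact (contDiffAt_dir hf (k := 1) (by norm_num) w).differentiableAt (by norm_num)

theorem dir_comp {f : F → G} {J : V → F} {x : V} (hf : DifferentiableAt ℝ f (J x))
    (hJ : DifferentiableAt ℝ J x) (v : V) :
    dir v (fun y => f (J y)) x = fderiv ℝ f (J x) (dir v J x) := by
  simp only [dir]
  rw [show (fun y => f (J y)) = f ∘ J from rfl, fderiv_comp x hf hJ]; rfl

theorem dir_dir_comp {f : F → G} {J : V → F} {x : V} (hf : ContDiffAt ℝ 2 f (J x))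
    (hJ : ContDiffAt ℝ 2 J x) (v w : V) :
    dir v (dir w (fun y => f (J y))) x =
      fderiv ℝ (fderiv ℝ f) (J x) (dir v J x) (dir w J x)
        + fderiv ℝ f (J x) (dir v (dir w J) x) := by
  have h : dir w (fun y => f (J y)) =ᶠ[𝓝 x] fun y => fderiv ℝ f (J y) (dir w J y) := by
    filter_upwards [eventually_differentiableAt_two hJ,
      hJ.continuousAt.eventually (eventually_differentiableAt_two hf)]
      with y h1 h2 using dir_comp h2 h1 w
  rw [dir_congr h]
  have h1 : DifferentiableAt ℝ (fderiv ℝ f) (J x) :=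
    (hf.fderiv_right (m := 1) (by norm_num)).differentiableAt (by norm_num)
  have h2 : DifferentiableAt ℝ J x := hJ.differentiableAt (by norm_num)
  have h3 : DifferentiableAt ℝ (dir w J) x :=
    (contDiffAt_dir hJ (k := 1) (by norm_num) w).differentiableAt (by norm_num)
  have h4 : DifferentiableAt ℝ (fun y => fderiv ℝ f (J y)) x := h1.comp x h2
  have h5 := dir_comp h1 h2 v
  rw [dir, fderiv_clm_apply h4 h3]
  simp only [dir] at h5 ⊢
  simp only [add_apply, ContinuousLinearMap.comp_apply,
    ContinuousLinearMap.flip_apply]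
  rw [h5, add_comm]

theorem dir_log {f : V → ℝ} {x : V} (hf : DifferentiableAt ℝ f x) (h0 : f x ≠ 0) (v : V) :
    dir v (fun y => Real.log (f y)) x = dir v f x / f x := by
  simp only [dir]
  rw [fderiv.log hf h0]
  simp [div_eq_inv_mul]

theorem dir_dir_log {f : V → ℝ} {x : V} (hf : ContDiffAt ℝ 2 f x) (h0 : f x ≠ 0) (v : V) :
    dir v (dir v (fun y => Real.log (f y))) x =
      dir v (dir v f) x / f x - (dir v f x / f x) ^ 2 := by
  have h : dir v (fun y => Real.log (f y)) =ᶠ[𝓝 x] fun y => dir v f y * (f y)⁻¹ := by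
    filter_upwards [eventually_differentiableAt_two hf,
      hf.continuousAt.eventually_ne h0] with y h1 h2
    rw [dir_log h1 h2 v, div_eq_mul_inv]
  have h1 : DifferentiableAt ℝ (dir v f) x :=
    (contDiffAt_dir hf (k := 1) (by norm_num) v).differentiableAt (by norm_num)
  have h2 : DifferentiableAt ℝ f x := hf.differentiableAt (by norm_num)
  rw [dir_congr h]
  have h3 : HasFDerivAt (fun y => (f y)⁻¹) (-(f x ^ 2)⁻¹ • fderiv ℝ f x) x :=
    (hasDerivAt_inv h0).comp_hasFDerivAt x h2.hasFDerivAt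
  have h4 : fderiv ℝ (fun y => dir v f y * (f y)⁻¹) x = _ := (h1.hasFDerivAt.mul h3).fderiv
  rw [dir, h4]
  simp only [add_apply, smul_apply, smul_eq_mul]
  simp only [dir]
  field_simp
  ring

theorem dir_exp {f : V → ℝ} {x : V} (hf : DifferentiableAt ℝ f x) (v : V) :
    dir v (fun y => Real.exp (f y)) x = Real.exp (f x) * dir v f x := by
  simp only [dir]
  rw [fderiv_exp hf]
  simp

theorem dir_dir_exp {f : V → ℝ} {x : V} (hf : ContDiffAt ℝ 2 f x) (v : V) :
    dir v (dir v (fun y => Real.exp (f y))) x =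
      Real.exp (f x) * (dir v (dir v f) x + dir v f x ^ 2) := by
  have h : dir v (fun y => Real.exp (f y)) =ᶠ[𝓝 x] fun y => Real.exp (f y) * dir v f y := by
    filter_upwards [eventually_differentiableAt_two hf] with y h1
    exact dir_exp h1 v
  have h1 : DifferentiableAt ℝ (dir v f) x :=
    (contDiffAt_dir hf (k := 1) (by norm_num) v).differentiableAt (by norm_num)
  have h2 : DifferentiableAt ℝ f x := hf.differentiableAt (by norm_num)
  rw [dir_congr h]
  have h4 : fderiv ℝ (fun y => Real.exp (f y) * dir v f y) x = _ :=
    (h2.hasFDerivAt.exp.mul h1.hasFDerivAt).fderiv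
  rw [dir, h4]
  simp only [add_apply, smul_apply, smul_eq_mul]
  simp only [dir]
  ring

theorem dir_eq_zero_of_isLocalMax {f : V → ℝ} {x : V} (h : IsLocalMax f x) (v : V) :
    dir v f x = 0 := by
  simp [dir, h.fderiv_eq_zero]

/-- If the second derivative in a direction were positive at a local maximum, the restriction to the
line in this direction would also have a local minimum, and would be locally constant. -/
theorem dir_dir_nonpos_of_isLocalMax {f : V → ℝ} {x : V} (hf : ContDiffAt ℝ 2 f x)
    (h : IsLocalMax f x) (v : V) : dir v (dir v f) x ≤ 0 := by
  by_contra! hpos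
  set γ : ℝ → V := fun t => x + t • v with hγ
  have hγ0 : γ 0 = x := by simp [hγ]
  have hγd : ∀ t, HasDerivAt γ v t := fun t => by
    simpa [hγ] using ((hasDerivAt_id t).smul_const v).const_add x
  have hγc : ContinuousAt γ 0 := (hγd 0).continuousAt
  have hγt : Tendsto γ (𝓝 0) (𝓝 x) := by simpa [hγ0] using hγc.tendsto
  have hder : ∀ {g : V → ℝ} {t : ℝ}, DifferentiableAt ℝ g (γ t) →
      HasDerivAt (fun s => g (γ s)) (dir v g (γ t)) t := fun {g t} hg =>
    hg.hasFDerivAt.comp_hasDerivAt t (hγd t)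
  have hd : deriv (fun s => f (γ s)) =ᶠ[𝓝 0] fun s => dir v f (γ s) := by
    filter_upwards [hγt.eventually (eventually_differentiableAt_two hf)] with t ht
    exact (hder ht).deriv
  have h1 : DifferentiableAt ℝ (dir v f) (γ 0) := by
    rw [hγ0]
    exact (contDiffAt_dir hf (k := 1) (by norm_num) v).differentiableAt (by norm_num)
  have hdd : deriv (deriv (fun s => f (γ s))) 0 = dir v (dir v f) x := by
    rw [hd.deriv_eq, (hder h1).deriv, hγ0]
  have hd0 : deriv (fun s => f (γ s)) 0 = 0 := by
    rw [hd.eq_of_nhds, hγ0, dir_eq_zero_of_isLocalMax h]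
  have hmin : IsLocalMin (fun s => f (γ s)) 0 :=
    isLocalMin_of_deriv_deriv_pos (by rw [hdd]; exact hpos) hd0
      (by
        have : ContinuousAt f (γ 0) := by rw [hγ0]; exact hf.continuousAt
        exact this.comp hγc)
  have hconst : (fun s => f (γ s)) =ᶠ[𝓝 0] fun _ => f x := by
    have hmax : ∀ᶠ s in 𝓝 (0 : ℝ), f (γ s) ≤ f x := hγt.eventually h
    filter_upwards [hmin, hmax] with s h1 h2
    rw [hγ0] at h1
    exact le_antisymm h2 h1
  have : deriv (deriv (fun s => f (γ s))) 0 = 0 := by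
    rw [hconst.deriv.deriv_eq]
    simp
  linarith

end Directional

section JetCalculus

variable {n : ℕ}

theorem inner_gradient (u : EuclideanSpace ℝ (Fin n) → ℝ) (x v : EuclideanSpace ℝ (Fin n)) :
    inner ℝ (gradient u x) v = dir v u x := by
  simp [gradient, dir]

theorem contDiffAt_gradient {u : EuclideanSpace ℝ (Fin n) → ℝ} {x : EuclideanSpace ℝ (Fin n)}
    {m k : WithTop ℕ∞} (hu : ContDiffAt ℝ m u x) (h : k + 1 ≤ m) :
    ContDiffAt ℝ k (gradient u) x := by
  have h1 := hu.fderiv_right h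
  exact ((InnerProductSpace.toDual ℝ (EuclideanSpace ℝ (Fin n))).symm.contDiff.contDiffAt).comp x h1

theorem contDiffAt_oneJet {u : EuclideanSpace ℝ (Fin n) → ℝ} {x : EuclideanSpace ℝ (Fin n)}
    {m k : WithTop ℕ∞} (hu : ContDiffAt ℝ m u x) (h : k + 1 ≤ m) :
    ContDiffAt ℝ k (oneJet u) x :=
  contDiffAt_id.prodMk ((hu.of_le (le_trans le_self_add h)).prodMk
    (contDiffAt_gradient hu h))

theorem dir_oneJet {u : EuclideanSpace ℝ (Fin n) → ℝ} {x : EuclideanSpace ℝ (Fin n)}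
    (hu : ContDiffAt ℝ 2 u x) (v : EuclideanSpace ℝ (Fin n)) :
    dir v (oneJet u) x = (v, dir v u x, dir v (gradient u) x) := by
  have h1 : DifferentiableAt ℝ u x := hu.differentiableAt (by norm_num)
  have h2 : DifferentiableAt ℝ (gradient u) x :=
    (contDiffAt_gradient hu (k := 1) (by norm_num)).differentiableAt (by norm_num)
  have := (hasFDerivAt_id (𝕜 := ℝ) x).prodMk (h1.hasFDerivAt.prodMk h2.hasFDerivAt)
  rw [dir, show fderiv ℝ (oneJet u) x = _ from this.fderiv]
  rfl

theorem dir_dir_oneJet {u : EuclideanSpace ℝ (Fin n) → ℝ} {x : EuclideanSpace ℝ (Fin n)}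
    (hu : ContDiffAt ℝ 3 u x) (v : EuclideanSpace ℝ (Fin n)) :
    dir v (dir v (oneJet u)) x = (0, dir v (dir v u) x, dir v (dir v (gradient u)) x) := by
  have h : dir v (oneJet u) =ᶠ[𝓝 x] fun y => (v, dir v u y, dir v (gradient u) y) := by
    filter_upwards [hu.eventually (by simp)] with y hy
    exact dir_oneJet (hy.of_le (by norm_num)) v
  rw [dir_congr h]
  have h1 : DifferentiableAt ℝ (dir v u) x :=
    (contDiffAt_dir hu (k := 1) (by norm_num) v).differentiableAt (by norm_num)
  have h2 : DifferentiableAt ℝ (dir v (gradient u)) x :=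
    (contDiffAt_dir (contDiffAt_gradient hu (k := 2) (by norm_num)) (k := 1)
      (by norm_num) v).differentiableAt (by norm_num)
  have := (hasFDerivAt_const (𝕜 := ℝ) v x).prodMk (h1.hasFDerivAt.prodMk h2.hasFDerivAt)
  rw [dir, this.fderiv]
  rfl

theorem inner_dir_gradient {u : EuclideanSpace ℝ (Fin n) → ℝ} {x : EuclideanSpace ℝ (Fin n)}
    (hu : ContDiffAt ℝ 2 u x) (v w : EuclideanSpace ℝ (Fin n)) :
    inner ℝ (dir v (gradient u) x) w = dir v (dir w u) x := by
  have h2 : DifferentiableAt ℝ (gradient u) x :=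
    (contDiffAt_gradient hu (k := 1) (by norm_num)).differentiableAt (by norm_num)
  have h := dir_clm_comp ((innerSL ℝ).flip w) h2 v
  simp only [ContinuousLinearMap.flip_apply, innerSL_apply_apply] at h
  rw [← h]
  congr 1
  funext y
  exact inner_gradient u y w

theorem inner_dir_dir_gradient {u : EuclideanSpace ℝ (Fin n) → ℝ}
    {x : EuclideanSpace ℝ (Fin n)} (hu : ContDiffAt ℝ 3 u x) (v w : EuclideanSpace ℝ (Fin n)) :
    inner ℝ (dir v (dir v (gradient u)) x) w = dir w (dir v (dir v u)) x := by
  have h2 : DifferentiableAt ℝ (dir v (gradient u)) x :=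
    (contDiffAt_dir (contDiffAt_gradient hu (k := 2) (by norm_num)) (k := 1)
      (by norm_num) v).differentiableAt (by norm_num)
  have h := dir_clm_comp ((innerSL ℝ).flip w) h2 v
  simp only [ContinuousLinearMap.flip_apply, innerSL_apply_apply] at h
  rw [← h, dir_dir_dir_comm hu]
  apply dir_congr
  filter_upwards [hu.eventually (by simp)] with y hy
  exact inner_dir_gradient (hy.of_le (by norm_num)) v w

theorem dir_gradient_sq {u : EuclideanSpace ℝ (Fin n) → ℝ} {x : EuclideanSpace ℝ (Fin n)}
    (hu : ContDiffAt ℝ 2 u x) (v : EuclideanSpace ℝ (Fin n)) :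
    dir v (fun y => ‖gradient u y‖ ^ 2 / 2) x = inner ℝ (gradient u x) (dir v (gradient u) x) := by
  have h2 : DifferentiableAt ℝ (gradient u) x :=
    (contDiffAt_gradient hu (k := 1) (by norm_num)).differentiableAt (by norm_num)
  have h := h2.hasFDerivAt.norm_sq.const_mul (1 / 2 : ℝ)
  have h' : (fun y => ‖gradient u y‖ ^ 2 / 2) = fun y => 1 / 2 * ‖gradient u y‖ ^ 2 := by
    funext y; ring
  rw [h', dir, h.fderiv]
  simp [dir]

theorem dir_dir_gradient_sq {u : EuclideanSpace ℝ (Fin n) → ℝ} {x : EuclideanSpace ℝ (Fin n)}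
    (hu : ContDiffAt ℝ 3 u x) (v : EuclideanSpace ℝ (Fin n)) :
    dir v (dir v (fun y => ‖gradient u y‖ ^ 2 / 2)) x =
      ‖dir v (gradient u) x‖ ^ 2 + dir (gradient u x) (dir v (dir v u)) x := by
  have h : dir v (fun y => ‖gradient u y‖ ^ 2 / 2) =ᶠ[𝓝 x]
      fun y => inner ℝ (gradient u y) (dir v (gradient u) y) := by
    filter_upwards [hu.eventually (by simp)] with y hy
    exact dir_gradient_sq (hy.of_le (by norm_num)) v
  have hg := contDiffAt_gradient hu (k := 2) (by norm_num)
  have h1 : DifferentiableAt ℝ (gradient u) x := hg.differentiableAt (by norm_num)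
  have h2 : DifferentiableAt ℝ (dir v (gradient u)) x :=
    (contDiffAt_dir hg (k := 1) (by norm_num) v).differentiableAt (by norm_num)
  rw [dir_congr h, dir, fderiv_inner_apply ℝ h1 h2, ← inner_dir_dir_gradient hu,
    real_inner_comm, add_comm]
  congr 1
  rw [← real_inner_self_eq_norm_sq]
  rfl

end JetCalculus

/-! ### Derivatives of the logarithm of the determinant -/

section LogDet

variable {V : Type*} [NormedAddCommGroup V] [NormedSpace ℝ V] {ι : Type*} [Fintype ι]
  [DecidableEq ι]

theorem differentiableAt_det {W : ι → ι → V → ℝ} {x : V}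
    (hW : ∀ i j, DifferentiableAt ℝ (W i j) x) :
    DifferentiableAt ℝ (fun y => (Matrix.of fun i j => W i j y).det) x := by
  have hprod : ∀ σ : Equiv.Perm ι, DifferentiableAt ℝ (fun y => ∏ i, W (σ i) i y) x := fun σ =>
    (HasFDerivAt.finsetProd (u := Finset.univ)
      (fun i (_ : i ∈ Finset.univ) => (hW (σ i) i).hasFDerivAt)).differentiableAt
  simp only [Matrix.det_apply', Matrix.of_apply]
  exact DifferentiableAt.fun_sum fun σ _ => (hprod σ).const_mul _

/-- Jacobi's formula. -/
theorem dir_det {W : ι → ι → V → ℝ} {x : V} (hW : ∀ i j, DifferentiableAt ℝ (W i j) x) (v : V) :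
    dir v (fun y => (Matrix.of fun i j => W i j y).det) x =
      ∑ i, ∑ j, (Matrix.of fun i j => W i j x).adjugate i j * dir v (W j i) x := by
  have hprod : ∀ σ : Equiv.Perm ι, DifferentiableAt ℝ (fun y => ∏ i, W (σ i) i y) x := fun σ =>
    (HasFDerivAt.finsetProd (u := Finset.univ)
      (fun i (_ : i ∈ Finset.univ) => (hW (σ i) i).hasFDerivAt)).differentiableAt
  have hcol : ∀ i, ∑ j, (Matrix.of fun i j => W i j x).adjugate i j * dir v (W j i) x =
      ((Matrix.of fun i j => W i j x).updateCol i fun j => dir v (W j i) x).det := by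
    intro i
    rw [← Matrix.cramer_apply, Matrix.cramer_eq_adjugate_mulVec]
    rfl
  simp only [hcol, Matrix.det_apply', Matrix.of_apply]
  rw [dir_sum _ (fun σ _ => (hprod σ).const_mul _),
    Finset.sum_comm]
  refine Finset.sum_congr rfl fun σ _ => ?_
  rw [dir_const_mul (hprod σ), ← Finset.mul_sum]
  congr 1
  have h := HasFDerivAt.finsetProd (u := Finset.univ)
    (fun i (_ : i ∈ Finset.univ) => (hW (σ i) i).hasFDerivAt)
  rw [dir, h.fderiv]
  simp only [FunLike.coe_sum, Finset.sum_apply, smul_apply, smul_eq_mul]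
  refine Finset.sum_congr rfl fun i _ => ?_
  rw [← Finset.mul_prod_erase _ _ (Finset.mem_univ i), mul_comm]
  congr 1
  · simp [dir]
  · refine Finset.prod_congr rfl fun j hj => ?_
    rw [Matrix.updateCol_ne (Finset.ne_of_mem_erase hj)]
    rfl

theorem dir_log_det {W : ι → ι → V → ℝ} {x : V} (hW : ∀ i j, DifferentiableAt ℝ (W i j) x)
    (h0 : (Matrix.of fun i j => W i j x).det ≠ 0) (v : V) :
    dir v (fun y => Real.log (Matrix.of fun i j => W i j y).det) x =
      ∑ i, ∑ j, (Matrix.of fun i j => W i j x)⁻¹ i j * dir v (W j i) x := by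
  rw [dir_log (differentiableAt_det hW) h0, dir_det hW, Finset.sum_div]
  refine Finset.sum_congr rfl fun i _ => ?_
  rw [Finset.sum_div]
  refine Finset.sum_congr rfl fun j _ => ?_
  rw [Matrix.inv_def]
  simp only [Ring.inverse_eq_inv', Matrix.smul_apply, smul_eq_mul]
  field_simp

theorem differentiableAt_inv_entry {W : ι → ι → V → ℝ} {x : V}
    (hW : ∀ i j, DifferentiableAt ℝ (W i j) x)
    (h0 : (Matrix.of fun i j => W i j x).det ≠ 0) (i j : ι) :
    DifferentiableAt ℝ (fun y => (Matrix.of fun i j => W i j y)⁻¹ i j) x := by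
  simp only [Matrix.inv_def, Ring.inverse_eq_inv', Matrix.smul_apply, smul_eq_mul,
    Matrix.adjugate_apply]
  refine ((differentiableAt_det hW).inv h0).mul ?_
  have h := differentiableAt_det (x := x)
    (W := fun k l y => if k = j then (Pi.single i (1 : ℝ) : ι → ℝ) l else W k l y) (by
      intro k l
      by_cases hk : k = j
      · simp [hk]
      · simpa [hk] using hW k l)
  refine h.congr_of_eventuallyEq (Eventually.of_forall fun y => ?_)
  refine congrArg Matrix.det ?_
  ext k l
  by_cases hk : k = j
  · subst hk; simp
  · simp [hk]

/-- First and second derivatives of `log det W` at a point at which `W` is diagonal. -/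
theorem dir_log_det_diagonal {W : ι → ι → V → ℝ} {x : V} {lam : ι → ℝ}
    (hW : ∀ i j, ContDiffAt ℝ 2 (W i j) x) (hlam : ∀ i, lam i ≠ 0)
    (hdiag : ∀ i j, W i j x = if i = j then lam i else 0) (v : V) :
    dir v (fun y => Real.log (Matrix.of fun i j => W i j y).det) x =
        ∑ i, (lam i)⁻¹ * dir v (W i i) x ∧
      dir v (dir v (fun y => Real.log (Matrix.of fun i j => W i j y).det)) x =
        ∑ i, (lam i)⁻¹ * dir v (dir v (W i i)) x -
          ∑ i, ∑ j, (lam i)⁻¹ * (lam j)⁻¹ * (dir v (W i j) x * dir v (W j i) x) := by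
  have hmat : (Matrix.of fun i j => W i j x) = Matrix.diagonal lam := by
    ext i j
    simp only [Matrix.of_apply, hdiag, Matrix.diagonal_apply]
  have hdet : (Matrix.of fun i j => W i j x).det ≠ 0 := by
    rw [hmat, Matrix.det_diagonal]
    exact Finset.prod_ne_zero_iff.2 fun i _ => hlam i
  have hinv : ∀ i j, (Matrix.of fun i j => W i j x)⁻¹ i j = if i = j then (lam i)⁻¹ else 0 := by
    have : (Matrix.diagonal lam)⁻¹ = Matrix.diagonal fun i => (lam i)⁻¹ := by
      apply Matrix.inv_eq_left_inv
      rw [Matrix.diagonal_mul_diagonal, ← Matrix.diagonal_one]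
      congr 1
      funext i
      exact inv_mul_cancel₀ (hlam i)
    intro i j
    rw [hmat, this, Matrix.diagonal_apply]
  have hWd : ∀ i j, DifferentiableAt ℝ (W i j) x := fun i j =>
    (hW i j).differentiableAt (by norm_num)
  have hWd' : ∀ i j, DifferentiableAt ℝ (dir v (W i j)) x := fun i j =>
    (contDiffAt_dir (hW i j) (k := 1) (by norm_num) v).differentiableAt (by norm_num)
  have hev : ∀ᶠ y in 𝓝 x, (∀ i j, DifferentiableAt ℝ (W i j) y) ∧
      (Matrix.of fun i j => W i j y).det ≠ 0 := by
    refine (eventually_all.2 fun i => eventually_all.2 fun j =>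
      eventually_differentiableAt_two (hW i j)).and ?_
    exact (differentiableAt_det hWd).continuousAt.eventually_ne hdet
  -- differentiate `W⁻¹ W = 1`
  have hdinv : ∀ i j, dir v (fun y => (Matrix.of fun i j => W i j y)⁻¹ i j) x =
      -((lam i)⁻¹ * (lam j)⁻¹ * dir v (W i j) x) := by
    intro i j
    have h1 : (fun y => ∑ k, (Matrix.of fun i j => W i j y)⁻¹ i k * W k j y) =ᶠ[𝓝 x]
        fun _ => (1 : Matrix ι ι ℝ) i j := by
      filter_upwards [hev] with y hy
      rw [← Matrix.nonsing_inv_mul (Matrix.of fun i j => W i j y)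
        (isUnit_iff_ne_zero.2 hy.2), Matrix.mul_apply]
      rfl
    have h2 := dir_congr h1 v
    rw [dir_const, dir_sum _ (fun k _ => (differentiableAt_inv_entry hWd hdet i k).fun_mul (hWd k j))]
      at h2
    have h3 : ∀ k, dir v (fun y => (Matrix.of fun i j => W i j y)⁻¹ i k * W k j y) x =
        (if k = j then lam j * dir v (fun y => (Matrix.of fun i j => W i j y)⁻¹ i j) x else 0) +
          if k = i then (lam i)⁻¹ * dir v (W i j) x else 0 := by
      intro k
      have h4 : fderiv ℝ (fun y => (Matrix.of fun i j => W i j y)⁻¹ i k * W k j y) x = _ :=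
        ((differentiableAt_inv_entry hWd hdet i k).hasFDerivAt.mul (hWd k j).hasFDerivAt).fderiv
      rw [dir, h4]
      simp only [add_apply, smul_apply, smul_eq_mul]
      rw [hinv, hdiag]
      by_cases hkj : k = j <;> by_cases hki : k = i
      · subst hkj; subst hki; simp [dir]; ring
      · subst hkj; simp [hki, Ne.symm hki, dir]
      · subst hki; simp [hkj, dir]
      · simp [hkj, hki, Ne.symm hki]
    simp only [h3, Finset.sum_add_distrib, Finset.sum_ite_eq', Finset.mem_univ, if_true] at h2
    have := hlam j
    have := hlam i
    field_simp
    field_simp at h2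
    linarith
  constructor
  · rw [dir_log_det hWd hdet]
    refine Finset.sum_congr rfl fun i _ => ?_
    simp [hinv]
  · have h1 : dir v (fun y => Real.log (Matrix.of fun i j => W i j y).det) =ᶠ[𝓝 x]
        fun y => ∑ i, ∑ j, (Matrix.of fun i j => W i j y)⁻¹ i j * dir v (W j i) y := by
      filter_upwards [hev] with y hy
      exact dir_log_det hy.1 hy.2 v
    have hd : ∀ i j, DifferentiableAt ℝ
        (fun y => (Matrix.of fun i j => W i j y)⁻¹ i j * dir v (W j i) y) x := fun i j =>
      (differentiableAt_inv_entry hWd hdet i j).mul (hWd' j i)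
    rw [dir_congr h1, dir_sum _ (fun i _ => DifferentiableAt.fun_sum fun j _ => hd i j),
      ← Finset.sum_sub_distrib]
    refine Finset.sum_congr rfl fun i _ => ?_
    rw [dir_sum _ (fun j _ => hd i j)]
    have h3 : ∀ j, dir v (fun y => (Matrix.of fun i j => W i j y)⁻¹ i j * dir v (W j i) y) x =
        (if i = j then (lam i)⁻¹ * dir v (dir v (W i i)) x else 0) -
          (lam i)⁻¹ * (lam j)⁻¹ * (dir v (W i j) x * dir v (W j i) x) := by
      intro j
      have h4 : fderiv ℝ
          (fun y => (Matrix.of fun i j => W i j y)⁻¹ i j * dir v (W j i) y) x = _ :=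
        ((differentiableAt_inv_entry hWd hdet i j).hasFDerivAt.mul (hWd' j i).hasFDerivAt).fderiv
      have h5 := hdinv i j
      rw [dir] at h5
      rw [dir, h4]
      simp only [add_apply, smul_apply, smul_eq_mul, hinv, h5]
      by_cases hij : i = j
      · subst hij; simp [dir]; ring
      · simp [hij]; ring
    simp only [h3, Finset.sum_sub_distrib, Finset.sum_ite_eq, Finset.mem_univ, if_true]

end LogDet

/-! ### The augmented Hessian and the linearized operator in an orthonormal frame -/

section Forms

variable {n : ℕ}

/-- The value `A_{ij} ξ_i ζ_j` of the matrix `A`, viewed as a bilinear form. -/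
def form (A : Jet n → Matrix (Fin n) (Fin n) ℝ) (ξ ζ : EuclideanSpace ℝ (Fin n)) (q : Jet n) : ℝ :=
  ∑ i, ∑ j, A q i j * (ξ i * ζ j)

/-- The value `w_{ij} ξ_i ζ_j = D_ξ D_ζ u - A_{ij} ξ_i ζ_j` of the augmented Hessian, viewed as a
bilinear form. -/
noncomputable def augForm (A : Jet n → Matrix (Fin n) (Fin n) ℝ) (u : EuclideanSpace ℝ (Fin n) → ℝ)
    (ξ ζ x : EuclideanSpace ℝ (Fin n)) : ℝ :=
  dir ξ (dir ζ u) x - form A ξ ζ (oneJet u x)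

theorem contDiffAt_form {A : Jet n → Matrix (Fin n) (Fin n) ℝ} {q : Jet n} {k : WithTop ℕ∞}
    (hA : ∀ i j, ContDiffAt ℝ k (fun q => A q i j) q) (ξ ζ : EuclideanSpace ℝ (Fin n)) :
    ContDiffAt ℝ k (form A ξ ζ) q :=
  ContDiffAt.sum fun i _ => ContDiffAt.sum fun j _ => (hA i j).mul contDiffAt_const

theorem form_comm {A : Jet n → Matrix (Fin n) (Fin n) ℝ} {q : Jet n}
    (hA : (A q).IsSymm) (ξ ζ : EuclideanSpace ℝ (Fin n)) : form A ξ ζ q = form A ζ ξ q := by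
  unfold form
  rw [Finset.sum_comm]
  refine Finset.sum_congr rfl fun i _ => Finset.sum_congr rfl fun j _ => ?_
  rw [hA.apply i j, mul_comm (ξ j)]

theorem eq_sum_single (ξ : EuclideanSpace ℝ (Fin n)) :
    ξ = ∑ i, ξ i • EuclideanSpace.single i (1 : ℝ) := by
  ext j
  simp [Pi.single_apply]

theorem dir_dir_eq_sum_hessian {u : EuclideanSpace ℝ (Fin n) → ℝ} {x : EuclideanSpace ℝ (Fin n)}
    (hu : ContDiffAt ℝ 2 u x) (ξ ζ : EuclideanSpace ℝ (Fin n)) :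
    dir ξ (dir ζ u) x = ∑ i, ∑ j, hessian u x i j * (ξ i * ζ j) := by
  have h : ∀ i j, hessian u x i j = fderiv ℝ (fderiv ℝ u) x (EuclideanSpace.single i 1)
      (EuclideanSpace.single j 1) := fun i j => dir_dir_apply hu _ _
  rw [dir_dir_apply hu]
  conv_lhs => rw [eq_sum_single ξ, eq_sum_single ζ]
  simp only [map_sum, map_smul, FunLike.coe_sum, Finset.sum_apply, smul_apply, smul_eq_mul, h,
    Finset.mul_sum]
  rw [Finset.sum_comm]
  refine Finset.sum_congr rfl fun i _ => Finset.sum_congr rfl fun j _ => ?_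
  ring

theorem augForm_eq_sum {A : Jet n → Matrix (Fin n) (Fin n) ℝ} {u : EuclideanSpace ℝ (Fin n) → ℝ}
    {x : EuclideanSpace ℝ (Fin n)} (hu : ContDiffAt ℝ 2 u x) (ξ ζ : EuclideanSpace ℝ (Fin n)) :
    augForm A u ξ ζ x = ∑ i, ∑ j, augHessian A u x i j * (ξ i * ζ j) := by
  rw [augForm, dir_dir_eq_sum_hessian hu, form, ← Finset.sum_sub_distrib]
  refine Finset.sum_congr rfl fun i _ => ?_
  rw [← Finset.sum_sub_distrib]
  refine Finset.sum_congr rfl fun j _ => ?_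
  simp only [augHessian, Matrix.sub_apply]
  ring

/-- The orthogonal matrix whose columns are the vectors of an orthonormal basis. -/
noncomputable def frameMatrix (b : OrthonormalBasis (Fin n) ℝ (EuclideanSpace ℝ (Fin n))) :
    Matrix (Fin n) (Fin n) ℝ :=
  Matrix.of fun i j => b j i

theorem frameMatrix_transpose_mul (b : OrthonormalBasis (Fin n) ℝ (EuclideanSpace ℝ (Fin n))) :
    (frameMatrix b).transpose * frameMatrix b = 1 := by
  ext i j
  have h := orthonormal_iff_ite.1 b.orthonormal i j
  rw [PiLp.inner_apply] at h
  simp only [Matrix.mul_apply, Matrix.transpose_apply, frameMatrix, Matrix.of_apply,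
    Matrix.one_apply, ← h]
  refine Finset.sum_congr rfl fun k _ => ?_
  simp [mul_comm]

theorem frameMatrix_mul_transpose (b : OrthonormalBasis (Fin n) ℝ (EuclideanSpace ℝ (Fin n))) :
    frameMatrix b * (frameMatrix b).transpose = 1 :=
  mul_eq_one_comm.1 (frameMatrix_transpose_mul b)

theorem frameMatrix_conj_apply (b : OrthonormalBasis (Fin n) ℝ (EuclideanSpace ℝ (Fin n)))
    (W : Matrix (Fin n) (Fin n) ℝ) (i j : Fin n) :
    ((frameMatrix b).transpose * W * frameMatrix b) i j = ∑ k, ∑ l, W k l * (b i k * b j l) := by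
  simp only [Matrix.mul_apply, Matrix.transpose_apply, frameMatrix, Matrix.of_apply,
    Finset.sum_mul]
  rw [Finset.sum_comm]
  refine Finset.sum_congr rfl fun k _ => Finset.sum_congr rfl fun l _ => ?_
  ring

theorem det_frame (b : OrthonormalBasis (Fin n) ℝ (EuclideanSpace ℝ (Fin n)))
    (W : Matrix (Fin n) (Fin n) ℝ) :
    (Matrix.of fun i j => ∑ k, ∑ l, W k l * (b i k * b j l)).det = W.det := by
  have : (Matrix.of fun i j => ∑ k, ∑ l, W k l * (b i k * b j l)) =
      (frameMatrix b).transpose * W * frameMatrix b := by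
    ext i j
    rw [frameMatrix_conj_apply]; rfl
  rw [this, Matrix.det_mul_comm, ← mul_assoc, frameMatrix_mul_transpose, one_mul]

/-- The contraction of `W⁻¹` with a matrix `F`, in an orthonormal frame that diagonalizes `W`. -/
theorem sum_inv_mul_eq (b : OrthonormalBasis (Fin n) ℝ (EuclideanSpace ℝ (Fin n)))
    {W : Matrix (Fin n) (Fin n) ℝ} {lam : Fin n → ℝ} (hlam : ∀ i, lam i ≠ 0)
    (hW : ∀ i j, ∑ k, ∑ l, W k l * (b i k * b j l) = if i = j then lam i else 0)
    (F : Matrix (Fin n) (Fin n) ℝ) :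
    ∑ i, ∑ j, W⁻¹ i j * F i j = ∑ i, (lam i)⁻¹ * ∑ k, ∑ l, F k l * (b i k * b i l) := by
  set P := frameMatrix b with hP
  have h1 : P.transpose * W * P = Matrix.diagonal lam := by
    ext i j
    rw [frameMatrix_conj_apply, hW, Matrix.diagonal_apply]
  have hW' : W = P * Matrix.diagonal lam * P.transpose := by
    rw [← h1]
    have h2 := frameMatrix_mul_transpose b
    rw [← hP] at h2
    calc W = (P * P.transpose) * W * (P * P.transpose) := by rw [h2]; simp
      _ = _ := by simp only [mul_assoc]
  have hinv : W⁻¹ = P * Matrix.diagonal (fun i => (lam i)⁻¹) * P.transpose := by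
    apply Matrix.inv_eq_left_inv
    rw [hW']
    have h2 := frameMatrix_transpose_mul b
    rw [← hP] at h2
    calc P * Matrix.diagonal (fun i => (lam i)⁻¹) * P.transpose *
          (P * Matrix.diagonal lam * P.transpose)
        = P * (Matrix.diagonal (fun i => (lam i)⁻¹) * (P.transpose * P) * Matrix.diagonal lam) *
          P.transpose := by simp only [mul_assoc]
      _ = 1 := by
        rw [h2, mul_one, Matrix.diagonal_mul_diagonal]
        have : (fun i => (lam i)⁻¹ * lam i) = fun _ => (1 : ℝ) := by
          funext i; exact inv_mul_cancel₀ (hlam i)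
        rw [this, Matrix.diagonal_one, mul_one]
        exact frameMatrix_mul_transpose b
  have hentry : ∀ k l, W⁻¹ k l = ∑ i, (lam i)⁻¹ * (b i k * b i l) := by
    intro k l
    rw [hinv, Matrix.mul_apply]
    simp only [Matrix.mul_diagonal, Matrix.transpose_apply, hP, frameMatrix, Matrix.of_apply]
    refine Finset.sum_congr rfl fun i _ => ?_
    ring
  simp only [hentry, Finset.sum_mul, Finset.mul_sum]
  refine (Finset.sum_congr rfl fun k _ => Finset.sum_comm).trans (Finset.sum_comm.trans ?_)
  refine Finset.sum_congr rfl fun i _ => Finset.sum_congr rfl fun k _ =>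
    Finset.sum_congr rfl fun l _ => ?_
  ring

theorem norm_le_sum_abs_inner (b : OrthonormalBasis (Fin n) ℝ (EuclideanSpace ℝ (Fin n)))
    (v : EuclideanSpace ℝ (Fin n)) : ‖v‖ ≤ ∑ k, |inner ℝ v (b k)| := by
  conv_lhs => rw [← b.sum_repr' v]
  refine (norm_sum_le _ _).trans (Finset.sum_le_sum fun k _ => ?_)
  rw [norm_smul, b.orthonormal.1 k, mul_one, Real.norm_eq_abs, real_inner_comm]

theorem norm_jet_le (v : EuclideanSpace ℝ (Fin n)) (s : ℝ) (p : EuclideanSpace ℝ (Fin n)) {c : ℝ}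
    (hv : ‖v‖ ≤ c) (hs : |s| ≤ c) (hp : ‖p‖ ≤ c) : ‖((v, s, p) : Jet n)‖ ≤ c :=
  norm_prod_le_iff.2 ⟨hv, norm_prod_le_iff.2 ⟨hs, hp⟩⟩

end Forms

section Operator

variable {n : ℕ}

/-- The full linearization `w^{ij}(D_{ij} f - D_{p_k} A_{ij} D_k f) - D_{p_k}(log B) D_k f` of
`log det [D²u - A] = log B` at the point `x₀`, written in an orthonormal frame `b` of eigenvectors
of `w(x₀)` with eigenvalues `lam`; here `G` stands for `log B`. -/
noncomputable def frameOp (A : Jet n → Matrix (Fin n) (Fin n) ℝ) (G : Jet n → ℝ)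
    (u : EuclideanSpace ℝ (Fin n) → ℝ)
    (x₀ : EuclideanSpace ℝ (Fin n)) (b : OrthonormalBasis (Fin n) ℝ (EuclideanSpace ℝ (Fin n)))
    (lam : Fin n → ℝ) (f : EuclideanSpace ℝ (Fin n) → ℝ) : ℝ :=
  ∑ i, (lam i)⁻¹ * (dir (b i) (dir (b i) f) x₀ -
      fderiv ℝ (form A (b i) (b i)) (oneJet u x₀) (0, 0, gradient f x₀)) -
    fderiv ℝ G (oneJet u x₀) (0, 0, gradient f x₀)

variable {A : Jet n → Matrix (Fin n) (Fin n) ℝ} {G : Jet n → ℝ}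
    {u : EuclideanSpace ℝ (Fin n) → ℝ}
    {x₀ : EuclideanSpace ℝ (Fin n)} {b : OrthonormalBasis (Fin n) ℝ (EuclideanSpace ℝ (Fin n))}
    {lam : Fin n → ℝ} {f g : EuclideanSpace ℝ (Fin n) → ℝ}

theorem gradient_eq_of_dir {x v : EuclideanSpace ℝ (Fin n)}
    (h : ∀ w, dir w f x = inner ℝ v w) : gradient f x = v :=
  ext_inner_right ℝ fun w => by rw [inner_gradient, h]

theorem jet_add_right (p p' : EuclideanSpace ℝ (Fin n)) :
    ((0, 0, p + p') : Jet n) = (0, 0, p) + (0, 0, p') := by simp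

theorem jet_smul_right (c : ℝ) (p : EuclideanSpace ℝ (Fin n)) :
    ((0, 0, c • p) : Jet n) = c • (0, 0, p) := by simp

/-- If the differentials of `f`, `g`, `h` at `x₀` and their pure second derivatives are related by
the same linear relation `h = c f + d g`, up to the correction `s i` of the second
derivatives, then so are the values of the operator. -/
theorem frameOp_linear {h : EuclideanSpace ℝ (Fin n) → ℝ} (c d : ℝ) (s : Fin n → ℝ)
    (h1 : ∀ v, dir v h x₀ = c * dir v f x₀ + d * dir v g x₀)
    (h2 : ∀ i, dir (b i) (dir (b i) h) x₀ =
      c * dir (b i) (dir (b i) f) x₀ + d * dir (b i) (dir (b i) g) x₀ + s i) :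
    frameOp A G u x₀ b lam h =
      c * frameOp A G u x₀ b lam f + d * frameOp A G u x₀ b lam g + ∑ i, (lam i)⁻¹ * s i := by
  have hg : gradient h x₀ = c • gradient f x₀ + d • gradient g x₀ := by
    apply gradient_eq_of_dir
    intro w
    rw [h1, inner_add_left, inner_smul_left, inner_smul_left, inner_gradient, inner_gradient]
    simp
  unfold frameOp
  simp only [hg, h2, jet_add_right, jet_smul_right, map_add, map_smul, smul_eq_mul, mul_sub,
    mul_add, Finset.sum_sub_distrib, Finset.sum_add_distrib, Finset.mul_sum]
  simp only [mul_left_comm c, mul_left_comm d]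
  ring

theorem frameOp_add (hf : ContDiffAt ℝ 2 f x₀) (hg : ContDiffAt ℝ 2 g x₀) :
    frameOp A G u x₀ b lam (fun y => f y + g y) =
      frameOp A G u x₀ b lam f + frameOp A G u x₀ b lam g := by
  rw [frameOp_linear 1 1 0 (f := f) (g := g)]
  · simp
  · intro v
    rw [dir_add (hf.differentiableAt (by norm_num)) (hg.differentiableAt (by norm_num))]; ring
  · intro i
    rw [dir_dir_add hf hg]; simp

theorem frameOp_const_mul (hf : ContDiffAt ℝ 2 f x₀) (c : ℝ) :
    frameOp A G u x₀ b lam (fun y => c * f y) = c * frameOp A G u x₀ b lam f := by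
  rw [frameOp_linear c 0 0 (f := f) (g := f)]
  · simp
  · intro v
    rw [dir_const_mul (hf.differentiableAt (by norm_num))]; ring
  · intro i
    rw [dir_dir_const_mul hf]; simp

theorem frameOp_log (hf : ContDiffAt ℝ 2 f x₀) (h0 : f x₀ ≠ 0) :
    frameOp A G u x₀ b lam (fun y => Real.log (f y)) =
      frameOp A G u x₀ b lam f / f x₀ - ∑ i, (lam i)⁻¹ * (dir (b i) f x₀ / f x₀) ^ 2 := by
  rw [frameOp_linear (f x₀)⁻¹ 0 (fun i => -(dir (b i) f x₀ / f x₀) ^ 2) (f := f) (g := f)]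
  · simp only [mul_neg, Finset.sum_neg_distrib]; ring
  · intro v
    rw [dir_log (hf.differentiableAt (by norm_num)) h0]; ring
  · intro i
    rw [dir_dir_log hf h0]; ring

theorem frameOp_exp (hf : ContDiffAt ℝ 2 f x₀) :
    frameOp A G u x₀ b lam (fun y => Real.exp (f y)) =
      Real.exp (f x₀) * (frameOp A G u x₀ b lam f + ∑ i, (lam i)⁻¹ * (dir (b i) f x₀) ^ 2) := by
  rw [frameOp_linear (Real.exp (f x₀)) 0 (fun i => Real.exp (f x₀) * (dir (b i) f x₀) ^ 2)
    (f := f) (g := f)]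
  · simp only [mul_left_comm _ (Real.exp (f x₀)), ← Finset.mul_sum]; ring
  · intro v
    rw [dir_exp (hf.differentiableAt (by norm_num))]; ring
  · intro i
    rw [dir_dir_exp hf]; ring

theorem frameOp_nonpos_of_isLocalMax (hf : ContDiffAt ℝ 2 f x₀) (h : IsLocalMax f x₀)
    (hlam : ∀ i, 0 < lam i) : frameOp A G u x₀ b lam f ≤ 0 := by
  have hg : gradient f x₀ = 0 := gradient_eq_of_dir fun w => by
    rw [dir_eq_zero_of_isLocalMax h]; simp
  have h0 : ((0, 0, 0) : Jet n) = 0 := rfl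
  unfold frameOp
  simp only [hg, h0, map_zero, sub_zero]
  exact Finset.sum_nonpos fun i _ => mul_nonpos_of_nonneg_of_nonpos (inv_pos.2 (hlam i)).le
    (dir_dir_nonpos_of_isLocalMax hf h _)

end Operator

/-! ### Differentiating the equation at a point -/

section Solution

variable {n : ℕ}

/-- Near `x₀`, `u` is a smooth solution of `log det [D²u - A(·,u,Du)] = G(·,u,Du)`; the orthonormal
frame `b` diagonalizes the augmented Hessian at `x₀`, with positive eigenvalues `lam`; the number
`m` bounds the data at the one-jet of `u` over `x₀`; and `A` is regular there in the directions of
the frame. -/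
structure SolutionAt (A : Jet n → Matrix (Fin n) (Fin n) ℝ) (G : Jet n → ℝ)
    (u : EuclideanSpace ℝ (Fin n) → ℝ) (x₀ : EuclideanSpace ℝ (Fin n))
    (b : OrthonormalBasis (Fin n) ℝ (EuclideanSpace ℝ (Fin n))) (lam : Fin n → ℝ) (m : ℝ) :
    Prop where
  smooth : ContDiffAt ℝ 4 u x₀
  smooth_A : ∀ i j, ContDiffAt ℝ 2 (fun q => A q i j) (oneJet u x₀)
  smooth_G : ContDiffAt ℝ 2 G (oneJet u x₀)
  symm : ∀ᶠ x in 𝓝 x₀, (A (oneJet u x)).IsSymm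
  eqn : ∀ᶠ x in 𝓝 x₀, Real.log (augHessian A u x).det = G (oneJet u x)
  frame : ∀ i j, augForm A u (b i) (b j) x₀ = if i = j then lam i else 0
  lam_pos : ∀ i, 0 < lam i
  one_le : 1 ≤ m
  gradient_le : ‖gradient u x₀‖ ≤ m
  form_le : ∀ i j, |form A (b i) (b j) (oneJet u x₀)| ≤ m
  dform_le : ∀ i j, ‖fderiv ℝ (form A (b i) (b j)) (oneJet u x₀)‖ ≤ m
  ddform_le : ∀ i j, ‖fderiv ℝ (fderiv ℝ (form A (b i) (b j))) (oneJet u x₀)‖ ≤ m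
  dG_le : ‖fderiv ℝ G (oneJet u x₀)‖ ≤ m
  ddG_le : ‖fderiv ℝ (fderiv ℝ G) (oneJet u x₀)‖ ≤ m
  regular : ∀ i j, i ≠ j →
    0 ≤ fderiv ℝ (fderiv ℝ (form A (b i) (b i))) (oneJet u x₀) (0, 0, b j) (0, 0, b j)

namespace SolutionAt

variable {A : Jet n → Matrix (Fin n) (Fin n) ℝ} {G : Jet n → ℝ}
    {u : EuclideanSpace ℝ (Fin n) → ℝ}
    {x₀ : EuclideanSpace ℝ (Fin n)} {b : OrthonormalBasis (Fin n) ℝ (EuclideanSpace ℝ (Fin n))}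
    {lam : Fin n → ℝ} {m : ℝ} (h : SolutionAt A G u x₀ b lam m)

include h

theorem smooth_jet : ContDiffAt ℝ 3 (oneJet u) x₀ := contDiffAt_oneJet h.smooth (by norm_num)

theorem smooth_form_jet (v w : EuclideanSpace ℝ (Fin n)) :
    ContDiffAt ℝ 2 (fun x => form A v w (oneJet u x)) x₀ :=
  (contDiffAt_form h.smooth_A v w).comp x₀ (h.smooth_jet.of_le (by norm_num))

theorem smooth_dir_dir (v w : EuclideanSpace ℝ (Fin n)) : ContDiffAt ℝ 2 (dir v (dir w u)) x₀ :=
  contDiffAt_dir (contDiffAt_dir h.smooth (k := 3) (by norm_num) w) (by norm_num) v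

theorem smooth_augForm (v w : EuclideanSpace ℝ (Fin n)) : ContDiffAt ℝ 2 (augForm A u v w) x₀ :=
  (h.smooth_dir_dir v w).sub (h.smooth_form_jet v w)

theorem eventually_smooth : ∀ᶠ x in 𝓝 x₀, ContDiffAt ℝ 4 u x := h.smooth.eventually (by simp)

theorem log_det_eventuallyEq :
    (fun y => Real.log (Matrix.of fun i j => augForm A u (b i) (b j) y).det) =ᶠ[𝓝 x₀]
      fun x => G (oneJet u x) := by
  filter_upwards [h.eqn, h.eventually_smooth] with x h1 h2
  rw [← h1, ← det_frame b (augHessian A u x)]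
  congr 2
  ext i j
  exact augForm_eq_sum (h2.of_le (by norm_num)) _ _

/-- The equation, differentiated once. -/
theorem sum_dir_augForm (v : EuclideanSpace ℝ (Fin n)) :
    ∑ i, (lam i)⁻¹ * dir v (augForm A u (b i) (b i)) x₀ = dir v (fun x => G (oneJet u x)) x₀ := by
  rw [← (dir_log_det_diagonal (fun i j => h.smooth_augForm (b i) (b j))
    (fun i => (h.lam_pos i).ne') h.frame v).1]
  exact dir_congr h.log_det_eventuallyEq v

theorem augForm_comm_eventually (v w : EuclideanSpace ℝ (Fin n)) :
    augForm A u v w =ᶠ[𝓝 x₀] augForm A u w v := by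
  filter_upwards [h.symm, h.eventually_smooth] with x h1 h2
  simp only [augForm]
  rw [form_comm h1, dir_comm (h2.of_le (by norm_num))]

/-- The equation, differentiated twice. -/
theorem sum_dir_dir_augForm (v : EuclideanSpace ℝ (Fin n)) :
    ∑ i, (lam i)⁻¹ * dir v (dir v (augForm A u (b i) (b i))) x₀ =
      dir v (dir v (fun x => G (oneJet u x))) x₀ +
        ∑ i, ∑ j, (lam i)⁻¹ * (lam j)⁻¹ * dir v (augForm A u (b i) (b j)) x₀ ^ 2 := by
  have h1 := (dir_log_det_diagonal (fun i j => h.smooth_augForm (b i) (b j))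
    (fun i => (h.lam_pos i).ne') h.frame v).2
  rw [dir_congr (dir_eventuallyEq h.log_det_eventuallyEq v) v] at h1
  have h2 : ∀ i j, dir v (augForm A u (b j) (b i)) x₀ = dir v (augForm A u (b i) (b j)) x₀ :=
    fun i j => dir_congr (h.augForm_comm_eventually _ _) v
  simp only [h2, ← sq] at h1
  rw [h1]; ring

omit h in
theorem dir_dir_eq_augForm_add (v w : EuclideanSpace ℝ (Fin n)) :
    dir v (dir w u) = fun x => augForm A u v w x + form A v w (oneJet u x) := by
  funext x; simp [augForm]

theorem dir_dir_augForm_eq (v w : EuclideanSpace ℝ (Fin n)) :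
    dir w (dir w (augForm A u v v)) x₀ = dir v (dir v (augForm A u w w)) x₀ +
      dir v (dir v (fun x => form A w w (oneJet u x))) x₀ -
      dir w (dir w (fun x => form A v v (oneJet u x))) x₀ := by
  have h1 := dir_four_comm h.smooth w v
  rw [dir_dir_eq_augForm_add (A := A) (u := u) v v, dir_dir_eq_augForm_add (A := A) (u := u) w w,
    dir_dir_add (h.smooth_augForm v v) (h.smooth_form_jet v v),
    dir_dir_add (h.smooth_augForm w w) (h.smooth_form_jet w w)] at h1
  linarith

/-- The compatibility of the first derivatives of the augmented Hessian: `D_v w_{vz} - D_z w_{vv}`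
involves only derivatives of `A`. -/
theorem dir_augForm_eq (v z : EuclideanSpace ℝ (Fin n)) :
    dir v (augForm A u v z) x₀ = dir z (augForm A u v v) x₀ +
      dir z (fun x => form A v v (oneJet u x)) x₀ - dir v (fun x => form A v z (oneJet u x)) x₀ := by
  have h3 : dir v (dir v (dir z u)) x₀ = dir z (dir v (dir v u)) x₀ :=
    (dir_dir_dir_comm (h.smooth.of_le (by norm_num)) z v).symm
  rw [dir_dir_eq_augForm_add (A := A) (u := u) v z, dir_dir_eq_augForm_add (A := A) (u := u) v v,
    dir_add ((h.smooth_augForm v z).differentiableAt (by norm_num))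
      ((h.smooth_form_jet v z).differentiableAt (by norm_num)),
    dir_add ((h.smooth_augForm v v).differentiableAt (by norm_num))
      ((h.smooth_form_jet v v).differentiableAt (by norm_num))] at h3
  linarith

omit h in
/-- The part of the derivative of the one-jet of `u` in a frame direction that is bounded in terms
of the data. -/
noncomputable def jetRest (A : Jet n → Matrix (Fin n) (Fin n) ℝ)
    (u : EuclideanSpace ℝ (Fin n) → ℝ) (x₀ : EuclideanSpace ℝ (Fin n))
    (b : OrthonormalBasis (Fin n) ℝ (EuclideanSpace ℝ (Fin n))) (i : Fin n) : Jet n :=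
  (b i, dir (b i) u x₀, ∑ k, form A (b i) (b k) (oneJet u x₀) • b k)

theorem dir_gradient_eq (i : Fin n) :
    dir (b i) (gradient u) x₀ =
      (∑ k, form A (b i) (b k) (oneJet u x₀) • b k) + lam i • b i := by
  have h2 : ContDiffAt ℝ 2 u x₀ := h.smooth.of_le (by norm_num)
  rw [← b.sum_repr' (dir (b i) (gradient u) x₀)]
  have : ∀ k, inner ℝ (b k) (dir (b i) (gradient u) x₀) • b k =
      form A (b i) (b k) (oneJet u x₀) • b k + if i = k then lam i • b i else 0 := by
    intro k
    rw [real_inner_comm, inner_dir_gradient h2, dir_dir_eq_augForm_add (A := A) (u := u)]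
    simp only [h.frame]
    by_cases hik : i = k
    · subst hik; simp [add_smul, add_comm]
    · simp [hik]
  simp only [this, Finset.sum_add_distrib, Finset.sum_ite_eq, Finset.mem_univ, if_true]

/-- Only the component `lam i • b i` of the derivative of the gradient is not bounded by the data. -/
theorem dir_jet_eq (i : Fin n) :
    dir (b i) (oneJet u) x₀ = jetRest A u x₀ b i + lam i • ((0, 0, b i) : Jet n) := by
  rw [dir_oneJet (h.smooth.of_le (by norm_num)), h.dir_gradient_eq]
  simp [jetRest]

omit h in
theorem one_le_card (o : Fin n) : (1 : ℝ) ≤ n := by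
  have : 1 ≤ n := Nat.one_le_iff_ne_zero.2 fun h0 => by subst h0; exact o.elim0
  exact_mod_cast this

theorem norm_sum_form_le (i : Fin n) :
    ‖∑ k, form A (b i) (b k) (oneJet u x₀) • b k‖ ≤ n * m := by
  refine (norm_sum_le _ _).trans ?_
  calc ∑ k, ‖form A (b i) (b k) (oneJet u x₀) • b k‖ ≤ ∑ _k : Fin n, m := by
        refine Finset.sum_le_sum fun k _ => ?_
        rw [norm_smul, b.orthonormal.1 k, mul_one]
        exact h.form_le i k
    _ = n * m := by simp

theorem abs_dir_le (v : EuclideanSpace ℝ (Fin n)) : |dir v u x₀| ≤ m * ‖v‖ := by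
  rw [← inner_gradient]
  exact (abs_real_inner_le_norm _ _).trans
    (mul_le_mul_of_nonneg_right h.gradient_le (norm_nonneg _))

theorem norm_jetRest_le (i : Fin n) : ‖jetRest A u x₀ b i‖ ≤ n * m := by
  have hn := one_le_card i
  have hm := h.one_le
  apply norm_jet_le
  · rw [b.orthonormal.1 i]; nlinarith
  · have := h.abs_dir_le (b i)
    rw [b.orthonormal.1 i] at this
    nlinarith
  · exact h.norm_sum_form_le i

omit h in
theorem norm_jet_frame (i : Fin n) : ‖((0, 0, b i) : Jet n)‖ ≤ 1 :=
  norm_jet_le _ _ _ (by simp) (by simp) (by rw [b.orthonormal.1 i])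

theorem norm_dir_jet_le (i : Fin n) : ‖dir (b i) (oneJet u) x₀‖ ≤ lam i + n * m := by
  rw [h.dir_jet_eq i]
  refine (norm_add_le _ _).trans ?_
  rw [norm_smul, Real.norm_of_nonneg (h.lam_pos i).le]
  have h1 := h.norm_jetRest_le i
  have h2 := mul_le_mul_of_nonneg_left (norm_jet_frame (b := b) i) (h.lam_pos i).le
  linarith

omit h in
theorem abs_clm_le {L : Jet n →L[ℝ] ℝ} {c d : ℝ} {v : Jet n} (hL : ‖L‖ ≤ c) (hv : ‖v‖ ≤ d) :
    |L v| ≤ c * d :=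
  (L.le_opNorm v).trans (mul_le_mul hL hv (norm_nonneg _) ((norm_nonneg _).trans hL))

omit h in
theorem abs_clm_clm_le {L : Jet n →L[ℝ] Jet n →L[ℝ] ℝ} {c d d' : ℝ} {v w : Jet n} (hL : ‖L‖ ≤ c)
    (hv : ‖v‖ ≤ d) (hw : ‖w‖ ≤ d') : |L v w| ≤ c * d * d' :=
  abs_clm_le ((L.le_opNorm v).trans
    (mul_le_mul hL hv (norm_nonneg _) ((norm_nonneg L).trans hL))) hw

theorem abs_dir_form_le (i j k : Fin n) :
    |dir (b k) (fun x => form A (b i) (b j) (oneJet u x)) x₀| ≤ m * (lam k + n * m) := by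
  rw [dir_comp ((contDiffAt_form h.smooth_A _ _).differentiableAt (by norm_num))
    (h.smooth_jet.differentiableAt (by norm_num))]
  exact abs_clm_le (h.dform_le i j) (h.norm_dir_jet_le k)

theorem abs_dir_G_le (k : Fin n) :
    |dir (b k) (fun x => G (oneJet u x)) x₀| ≤ m * (lam k + n * m) := by
  rw [dir_comp (h.smooth_G.differentiableAt (by norm_num))
    (h.smooth_jet.differentiableAt (by norm_num))]
  exact abs_clm_le h.dG_le (h.norm_dir_jet_le k)

/-- Second derivatives of a function of the one-jet: the third derivatives of `u` enter only
through the gradient of `D_v D_v u`. -/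
theorem dir_dir_jet_eq {F : Jet n → ℝ} (hF : ContDiffAt ℝ 2 F (oneJet u x₀))
    (v : EuclideanSpace ℝ (Fin n)) :
    dir v (dir v (fun x => F (oneJet u x))) x₀ =
      fderiv ℝ (fderiv ℝ F) (oneJet u x₀) (dir v (oneJet u) x₀) (dir v (oneJet u) x₀) +
        (fderiv ℝ F (oneJet u x₀) (0, dir v (dir v u) x₀, 0) +
          fderiv ℝ F (oneJet u x₀) (0, 0, dir v (dir v (gradient u)) x₀)) := by
  rw [dir_dir_comp hF (h.smooth_jet.of_le (by norm_num)),
    dir_dir_oneJet (h.smooth.of_le (by norm_num)), ← map_add]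
  simp

/-- The gradient of `D_v D_v u` splits along `D²u = w + A`. -/
theorem dir_dir_gradient_eq (v : EuclideanSpace ℝ (Fin n)) :
    dir v (dir v (gradient u)) x₀ =
      gradient (augForm A u v v) x₀ + gradient (fun x => form A v v (oneJet u x)) x₀ := by
  refine ext_inner_right ℝ fun w => ?_
  rw [inner_add_left, inner_gradient, inner_gradient,
    inner_dir_dir_gradient (h.smooth.of_le (by norm_num)), dir_dir_eq_augForm_add (A := A) (u := u) v v,
    dir_add ((h.smooth_augForm v v).differentiableAt (by norm_num))
      ((h.smooth_form_jet v v).differentiableAt (by norm_num))]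

end SolutionAt

end Solution

/-! ### The linearized operator on the squared gradient -/

section Solution

variable {n : ℕ}

namespace SolutionAt

variable {A : Jet n → Matrix (Fin n) (Fin n) ℝ} {G : Jet n → ℝ}
    {u : EuclideanSpace ℝ (Fin n) → ℝ}
    {x₀ : EuclideanSpace ℝ (Fin n)} {b : OrthonormalBasis (Fin n) ℝ (EuclideanSpace ℝ (Fin n))}
    {lam : Fin n → ℝ} {m : ℝ} (h : SolutionAt A G u x₀ b lam m)

include h

theorem trace_nonneg : 0 ≤ ∑ i, (lam i)⁻¹ :=
  Finset.sum_nonneg fun i _ => (inv_pos.2 (h.lam_pos i)).le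

/-- By symmetry of `D²u` the gradient of `|Du|²/2` is the derivative of `Du` in the direction `Du`. -/
theorem gradient_gradient_sq :
    gradient (fun y => ‖gradient u y‖ ^ 2 / 2) x₀ = dir (gradient u x₀) (gradient u) x₀ := by
  have h2 : ContDiffAt ℝ 2 u x₀ := h.smooth.of_le (by norm_num)
  refine gradient_eq_of_dir fun w => ?_
  rw [dir_gradient_sq h2, inner_dir_gradient h2, real_inner_comm, inner_dir_gradient h2,
    dir_comm h2]

theorem abs_dir_gradient_sq_le (i : Fin n) :
    |dir (b i) (fun y => ‖gradient u y‖ ^ 2 / 2) x₀| ≤ m * (lam i + n * m) := by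
  rw [dir_gradient_sq (h.smooth.of_le (by norm_num))]
  refine (abs_real_inner_le_norm _ _).trans (mul_le_mul h.gradient_le ?_ (norm_nonneg _)
    (zero_le_one.trans h.one_le))
  rw [h.dir_gradient_eq]
  refine (norm_add_le _ _).trans ?_
  rw [norm_smul, b.orthonormal.1 i, mul_one, Real.norm_of_nonneg (h.lam_pos i).le]
  linarith [h.norm_sum_form_le i]

theorem dir_jet_sub (F : Jet n → ℝ) (hF : ContDiffAt ℝ 2 F (oneJet u x₀))
    (v : EuclideanSpace ℝ (Fin n)) :
    dir v (fun x => F (oneJet u x)) x₀ =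
      fderiv ℝ F (oneJet u x₀) (v, dir v u x₀, 0) +
        fderiv ℝ F (oneJet u x₀) (0, 0, dir v (gradient u) x₀) := by
  rw [dir_comp (hF.differentiableAt (by norm_num)) (h.smooth_jet.differentiableAt (by norm_num)),
    dir_oneJet (h.smooth.of_le (by norm_num)), ← map_add]
  simp

theorem norm_jet_gradient_le :
    ‖((gradient u x₀, dir (gradient u x₀) u x₀, 0) : Jet n)‖ ≤ m * m := by
  have hm := h.one_le
  have hg := h.gradient_le
  have := h.abs_dir_le (gradient u x₀)
  apply norm_jet_le
  · nlinarith
  · nlinarith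
  · simp; positivity

/-- The linearized operator on `|Du|²/2`: the term `w^{ij} D_{ik}u D_{jk}u` controls the top
eigenvalue from below, and the third derivatives of `u` are eliminated by differentiating the
equation in the direction `Du(x₀)`. -/
theorem frameOp_gradient_sq_ge (o : Fin n) :
    lam o / 2 - 2 * (n * m + 1) ^ 3 * (1 + ∑ i, (lam i)⁻¹) ≤
      frameOp A G u x₀ b lam (fun y => ‖gradient u y‖ ^ 2 / 2) := by
  have h2 : ContDiffAt ℝ 2 u x₀ := h.smooth.of_le (by norm_num)
  have hn := one_le_card o
  have hm := h.one_le
  have hT := h.trace_nonneg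
  set T := ∑ i, (lam i)⁻¹ with hTdef
  set g₀ := gradient u x₀ with hg₀
  set Z := dir g₀ (gradient u) x₀ with hZ
  have hsm : ∀ i, ContDiffAt ℝ 2 (form A (b i) (b i)) (oneJet u x₀) := fun i =>
    contDiffAt_form h.smooth_A _ _
  have hterm : ∀ i, dir (b i) (dir (b i) (fun y => ‖gradient u y‖ ^ 2 / 2)) x₀ -
      fderiv ℝ (form A (b i) (b i)) (oneJet u x₀) (0, 0, Z) =
      ‖dir (b i) (gradient u) x₀‖ ^ 2 + dir g₀ (augForm A u (b i) (b i)) x₀ +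
        fderiv ℝ (form A (b i) (b i)) (oneJet u x₀) (g₀, dir g₀ u x₀, 0) := by
    intro i
    rw [dir_dir_gradient_sq (h.smooth.of_le (by norm_num)), dir_dir_eq_augForm_add (A := A) (u := u),
      dir_add ((h.smooth_augForm _ _).differentiableAt (by norm_num))
        ((h.smooth_form_jet _ _).differentiableAt (by norm_num)), h.dir_jet_sub _ (hsm i)]
    ring
  have hsq : ∀ i, lam i ^ 2 / 2 - (n * m) ^ 2 ≤ ‖dir (b i) (gradient u) x₀‖ ^ 2 := by
    intro i
    have h3 := h.norm_sum_form_le i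
    rw [h.dir_gradient_eq]
    set X := ∑ k, form A (b i) (b k) (oneJet u x₀) • b k
    have h4 : lam i ≤ ‖X + lam i • b i‖ + ‖X‖ := by
      have h5 : ‖lam i • b i‖ = lam i := by
        rw [norm_smul, b.orthonormal.1 i, mul_one, Real.norm_of_nonneg (h.lam_pos i).le]
      have h6 := norm_sub_le (X + lam i • b i) X
      rw [add_sub_cancel_left, h5] at h6
      exact h6
    have h7 := norm_nonneg (X + lam i • b i)
    have h8 := norm_nonneg X
    have h9 := h.lam_pos i
    nlinarith [sq_nonneg (‖X + lam i • b i‖ - ‖X‖)]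
  have hA : ∀ i, -(m * (m * m)) ≤
      fderiv ℝ (form A (b i) (b i)) (oneJet u x₀) (g₀, dir g₀ u x₀, 0) := fun i =>
    (abs_le.1 (abs_clm_le (h.dform_le i i) h.norm_jet_gradient_le)).1
  have hG : -(m * (m * m)) ≤ fderiv ℝ G (oneJet u x₀) (g₀, dir g₀ u x₀, 0) :=
    (abs_le.1 (abs_clm_le h.dG_le h.norm_jet_gradient_le)).1
  have hsum := h.sum_dir_augForm g₀
  rw [h.dir_jet_sub G h.smooth_G] at hsum
  have hlow : ∀ i, (lam i)⁻¹ * (‖dir (b i) (gradient u) x₀‖ ^ 2 +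
      dir g₀ (augForm A u (b i) (b i)) x₀ +
        fderiv ℝ (form A (b i) (b i)) (oneJet u x₀) (g₀, dir g₀ u x₀, 0)) ≥
      lam i / 2 + (lam i)⁻¹ * dir g₀ (augForm A u (b i) (b i)) x₀ -
        ((n * m) ^ 2 + m * (m * m)) * (lam i)⁻¹ := by
    intro i
    have hp := h.lam_pos i
    have h1 : (lam i)⁻¹ * (lam i ^ 2 / 2) = lam i / 2 := by field_simp
    have h3 := mul_le_mul_of_nonneg_left (hsq i) (inv_pos.2 hp).le
    have h4 := mul_le_mul_of_nonneg_left (hA i) (inv_pos.2 hp).le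
    nlinarith
  have hlam : lam o / 2 ≤ ∑ i, lam i / 2 :=
    Finset.single_le_sum (f := fun i => lam i / 2) (fun i _ => (half_pos (h.lam_pos i)).le)
      (Finset.mem_univ o)
  have htot := Finset.sum_le_sum fun i (_ : i ∈ Finset.univ) => hlow i
  rw [Finset.sum_sub_distrib, Finset.sum_add_distrib, ← Finset.mul_sum, ← hTdef, hsum] at htot
  unfold frameOp
  rw [h.gradient_gradient_sq]
  simp only [← hZ, ← hg₀, hterm]
  have hK : (n * m) ^ 2 + m * (m * m) ≤ 2 * (n * m + 1) ^ 3 := by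
    have h1 : m ≤ n * m := by nlinarith
    have h3 : m * (m * m) ≤ (n * m) * ((n * m) * (n * m)) := by gcongr
    nlinarith [sq_nonneg ((n:ℝ) * m), mul_pos (zero_lt_one.trans_le hn) (zero_lt_one.trans_le hm)]
  have hK' := mul_le_mul_of_nonneg_right hK hT
  have hK2 : m * (m * m) ≤ 2 * (n * m + 1) ^ 3 := by nlinarith [sq_nonneg ((n:ℝ) * m)]
  nlinarith

end SolutionAt

end Solution

/-! ### The linearized operator on the top eigenvalue -/

section Solution

variable {n : ℕ}

namespace SolutionAt

variable {A : Jet n → Matrix (Fin n) (Fin n) ℝ} {G : Jet n → ℝ}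
    {u : EuclideanSpace ℝ (Fin n) → ℝ}
    {x₀ : EuclideanSpace ℝ (Fin n)} {b : OrthonormalBasis (Fin n) ℝ (EuclideanSpace ℝ (Fin n))}
    {lam : Fin n → ℝ} {m : ℝ} (h : SolutionAt A G u x₀ b lam m)

include h

theorem dir_dir_diag (i : Fin n) :
    dir (b i) (dir (b i) u) x₀ = lam i + form A (b i) (b i) (oneJet u x₀) := by
  have := h.frame i i
  rw [if_pos rfl] at this
  rw [dir_dir_eq_augForm_add (A := A) (u := u)]
  simp [this]

theorem abs_dir_dir_diag_le (i : Fin n) : |dir (b i) (dir (b i) u) x₀| ≤ lam i + m := by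
  rw [h.dir_dir_diag i]
  have h1 := h.lam_pos i
  have h2 := abs_le.1 (h.form_le i i)
  exact abs_le.2 ⟨by linarith [h2.1], by linarith [h2.2]⟩

omit h in
theorem norm_jet_snd_le {s c : ℝ} (hs : |s| ≤ c) :
    ‖((0, s, 0) : Jet n)‖ ≤ c := by
  have := (abs_nonneg s).trans hs
  exact norm_jet_le _ _ _ (by simpa using this) hs (by simpa using this)

omit h in
theorem norm_jet_trd_le {p : EuclideanSpace ℝ (Fin n)} {c : ℝ} (hs : ‖p‖ ≤ c) :
    ‖((0, 0, p) : Jet n)‖ ≤ c := by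
  have := (norm_nonneg p).trans hs
  exact norm_jet_le _ _ _ (by simpa using this) (by simpa using this) hs

variable {o : Fin n}

theorem lam_add_le (hmax : ∀ i, lam i ≤ lam o) (hone : 1 ≤ lam o) (i : Fin n) :
    lam i + n * m ≤ (n * m + 1) * lam o := by
  have hn := one_le_card o
  have hm := h.one_le
  have := hmax i
  nlinarith [mul_nonneg (zero_le_one.trans hn) (zero_le_one.trans hm)]

theorem le_card_mul_add_one (o : Fin n) :
    m ≤ n * m + 1 ∧ (n : ℝ) ≤ n * m + 1 ∧ m ≤ n * m := by
  have hn := one_le_card o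
  have hm := h.one_le
  refine ⟨by nlinarith, by nlinarith, by nlinarith⟩

theorem norm_gradient_form_le (hmax : ∀ i, lam i ≤ lam o) (hone : 1 ≤ lam o) (i j : Fin n) :
    ‖gradient (fun x => form A (b i) (b j) (oneJet u x)) x₀‖ ≤ (n * m + 1) ^ 3 * lam o := by
  obtain ⟨hmK, hnK, -⟩ := h.le_card_mul_add_one o
  have hm := h.one_le
  refine (norm_le_sum_abs_inner b _).trans ?_
  calc ∑ k, |inner ℝ (gradient (fun x => form A (b i) (b j) (oneJet u x)) x₀) (b k)|
      ≤ ∑ _k : Fin n, (n * m + 1) * ((n * m + 1) * lam o) := by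
        refine Finset.sum_le_sum fun k _ => ?_
        rw [inner_gradient]
        refine (h.abs_dir_form_le i j k).trans ?_
        have := h.lam_add_le hmax hone k
        have := h.lam_pos k
        gcongr
    _ = n * ((n * m + 1) * ((n * m + 1) * lam o)) := by simp
    _ ≤ (n * m + 1) * ((n * m + 1) * ((n * m + 1) * lam o)) := by gcongr
    _ = _ := by ring

/-- The second-order error terms produced by `A_{ii}` when the equation is differentiated twice in
the direction of the top eigenvector `b o`. Regularity removes the quadratic term in `lam o`,
except for `i = o`, where it is compensated by the factor `(lam o)⁻¹`. -/
theorem second_order_form_ge (hmax : ∀ i, lam i ≤ lam o) (hone : 1 ≤ lam o) (i : Fin n) :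
    -(7 * (n * m + 1) ^ 4 * lam o) - (if i = o then (n * m + 1) * lam o ^ 2 else 0) ≤
      fderiv ℝ (fderiv ℝ (form A (b i) (b i))) (oneJet u x₀) (dir (b o) (oneJet u) x₀)
          (dir (b o) (oneJet u) x₀) +
        (fderiv ℝ (form A (b i) (b i)) (oneJet u x₀) (0, dir (b o) (dir (b o) u) x₀, 0) +
          fderiv ℝ (form A (b i) (b i)) (oneJet u x₀)
            (0, 0, gradient (fun x => form A (b o) (b o) (oneJet u x)) x₀)) := by
  obtain ⟨hmK, hnK, hmN⟩ := h.le_card_mul_add_one o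
  have hm := h.one_le
  set K := n * m + 1 with hK
  set Q := fderiv ℝ (fderiv ℝ (form A (b i) (b i))) (oneJet u x₀) with hQ
  have hQn : ‖Q‖ ≤ K := (h.ddform_le i i).trans hmK
  have hLn : ‖fderiv ℝ (form A (b i) (b i)) (oneJet u x₀)‖ ≤ K := (h.dform_le i i).trans hmK
  have hR : ‖jetRest A u x₀ b o‖ ≤ K := (h.norm_jetRest_le o).trans (by linarith)
  have hP := norm_jet_frame (b := b) o
  have e1 := (abs_le.1 (abs_clm_clm_le hQn hR hR)).1
  have e2 := (abs_le.1 (abs_clm_clm_le hQn hR hP)).1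
  have e3 := (abs_le.1 (abs_clm_clm_le hQn hP hR)).1
  have e4 : -(if i = o then K else 0) ≤ Q (0, 0, b o) (0, 0, b o) := by
    by_cases hio : i = o
    · have := (abs_le.1 (abs_clm_clm_le hQn hP hP)).1
      rw [if_pos hio]; linarith
    · rw [if_neg hio, neg_zero]
      exact h.regular i o hio
  have e5 := (abs_le.1 (abs_clm_le hLn (norm_jet_snd_le (h.abs_dir_dir_diag_le o)))).1
  have e6 := (abs_le.1 (abs_clm_le hLn (norm_jet_trd_le
    (h.norm_gradient_form_le hmax hone o o)))).1
  rw [h.dir_jet_eq o]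
  simp only [map_add, map_smul, add_apply, smul_apply, smul_eq_mul]
  have hK1 : 1 ≤ K := by nlinarith
  have hl := h.lam_pos o
  have e4' := mul_le_mul_of_nonneg_left e4 (sq_nonneg (lam o))
  have e2' := mul_le_mul_of_nonneg_left e2 hl.le
  have e3' := mul_le_mul_of_nonneg_left e3 hl.le
  have hite : lam o ^ 2 * -(if i = o then K else 0) = -(if i = o then K * lam o ^ 2 else 0) := by
    split_ifs <;> ring
  rw [hite] at e4'
  have k2 : K ^ 2 ≤ K ^ 4 := pow_le_pow_right₀ hK1 (by norm_num)
  have k3 : K ^ 3 ≤ K ^ 4 := pow_le_pow_right₀ hK1 (by norm_num)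
  have k2' := mul_le_mul_of_nonneg_right k2 hl.le
  have k3' := mul_le_mul_of_nonneg_right k3 hl.le
  have hml : lam o + m ≤ K * lam o := by nlinarith [h.lam_add_le hmax hone o]
  have hml' := mul_le_mul_of_nonneg_left hml (zero_le_one.trans hK1)
  have k33 : K * K * K ≤ K ^ 3 * lam o := by nlinarith [pow_pos (zero_lt_one.trans_le hK1) 3]
  have k6 : K * (K ^ 3 * lam o) = K ^ 4 * lam o := by ring
  nlinarith

/-- The analogue of `second_order_form_ge` for the right-hand side of the equation, where no
regularity is available. -/
theorem second_order_G_ge (hmax : ∀ i, lam i ≤ lam o) (hone : 1 ≤ lam o) :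
    -(3 * (n * m + 1) ^ 4 * lam o ^ 2) ≤
      fderiv ℝ (fderiv ℝ G) (oneJet u x₀) (dir (b o) (oneJet u) x₀)
          (dir (b o) (oneJet u) x₀) +
        (fderiv ℝ G (oneJet u x₀) (0, dir (b o) (dir (b o) u) x₀, 0) +
          fderiv ℝ G (oneJet u x₀)
            (0, 0, gradient (fun x => form A (b o) (b o) (oneJet u x)) x₀)) := by
  obtain ⟨hmK, hnK, hmN⟩ := h.le_card_mul_add_one o
  have hm := h.one_le
  set K := n * m + 1 with hK
  have hK1 : 1 ≤ K := by nlinarith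
  have hl := h.lam_pos o
  have hJ : ‖dir (b o) (oneJet u) x₀‖ ≤ K * lam o :=
    (h.norm_dir_jet_le o).trans (h.lam_add_le hmax hone o)
  have hml : lam o + m ≤ K * lam o := by nlinarith [h.lam_add_le hmax hone o]
  have e1 := (abs_le.1 (abs_clm_clm_le (h.ddG_le.trans hmK) hJ hJ)).1
  have e5 := (abs_le.1 (abs_clm_le (h.dG_le.trans hmK)
    (norm_jet_snd_le ((h.abs_dir_dir_diag_le o).trans hml)))).1
  have e6 := (abs_le.1 (abs_clm_le (h.dG_le.trans hmK) (norm_jet_trd_le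
    (h.norm_gradient_form_le hmax hone o o)))).1
  have k2 : K ^ 2 ≤ K ^ 4 := pow_le_pow_right₀ hK1 (by norm_num)
  have k3 : K ^ 3 ≤ K ^ 4 := pow_le_pow_right₀ hK1 (by norm_num)
  have k2' := mul_le_mul_of_nonneg_right k2 (sq_nonneg (lam o))
  have k3' := mul_le_mul_of_nonneg_right k3 (sq_nonneg (lam o))
  have hl2 : lam o ≤ lam o ^ 2 := by nlinarith
  have k4' := mul_le_mul_of_nonneg_left hl2 (pow_pos (zero_lt_one.trans_le hK1) 4).le
  have k5' := mul_le_mul_of_nonneg_left hl2 (pow_pos (zero_lt_one.trans_le hK1) 2).le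
  nlinarith

/-- The trace `w^{ii} D_{ii}(A_{oo}(·,u,Du))` is controlled because the third derivatives of `u`
occur in it only through the equation differentiated once. -/
theorem sum_dir_dir_form_le (hmax : ∀ i, lam i ≤ lam o) (hone : 1 ≤ lam o) :
    ∑ i, (lam i)⁻¹ * dir (b i) (dir (b i) (fun x => form A (b o) (b o) (oneJet u x))) x₀ ≤
      7 * (n * m + 1) ^ 4 * (lam o + lam o * ∑ i, (lam i)⁻¹) := by
  obtain ⟨hmK, hnK, hmN⟩ := h.le_card_mul_add_one o
  have hm := h.one_le
  have hT := h.trace_nonneg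
  set K := n * m + 1 with hK
  set T := ∑ i, (lam i)⁻¹ with hTdef
  have hK1 : 1 ≤ K := by nlinarith
  have hK0 : 0 ≤ K := zero_le_one.trans hK1
  have hl := h.lam_pos o
  set F := form A (b o) (b o) with hF
  have hFs : ContDiffAt ℝ 2 F (oneJet u x₀) := contDiffAt_form h.smooth_A _ _
  set Z := ∑ i, (lam i)⁻¹ • dir (b i) (dir (b i) (gradient u)) x₀ with hZ
  have hZk : ∀ k, |inner ℝ Z (b k)| ≤ K * (K * lam o) * (1 + T) := by
    intro k
    have h1 : inner ℝ Z (b k) = dir (b k) (fun x => G (oneJet u x)) x₀ +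
        ∑ i, (lam i)⁻¹ * dir (b k) (fun x => form A (b i) (b i) (oneJet u x)) x₀ := by
      rw [hZ, sum_inner, ← h.sum_dir_augForm (b k), ← Finset.sum_add_distrib]
      refine Finset.sum_congr rfl fun i _ => ?_
      rw [real_inner_smul_left, h.dir_dir_gradient_eq, inner_add_left, inner_gradient,
        inner_gradient, mul_add]
    have h2 : m * (lam k + n * m) ≤ K * (K * lam o) := by
      have := h.lam_add_le hmax hone k
      have := h.lam_pos k
      gcongr
    rw [h1]
    refine (abs_add_le _ _).trans ?_
    have h3 : |∑ i, (lam i)⁻¹ * dir (b k) (fun x => form A (b i) (b i) (oneJet u x)) x₀| ≤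
        K * (K * lam o) * T := by
      rw [hTdef, Finset.mul_sum]
      refine (Finset.abs_sum_le_sum_abs _ _).trans (Finset.sum_le_sum fun i _ => ?_)
      rw [abs_mul, abs_of_pos (inv_pos.2 (h.lam_pos i)), mul_comm]
      exact mul_le_mul_of_nonneg_right ((h.abs_dir_form_le i i k).trans h2)
        (inv_pos.2 (h.lam_pos i)).le
    have h4 := (h.abs_dir_G_le k).trans h2
    linarith
  have hZn : ‖Z‖ ≤ K ^ 3 * lam o * (1 + T) := by
    refine (norm_le_sum_abs_inner b Z).trans ?_
    calc ∑ k, |inner ℝ Z (b k)| ≤ ∑ _k : Fin n, K * (K * lam o) * (1 + T) :=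
          Finset.sum_le_sum fun k _ => hZk k
      _ = n * (K * (K * lam o) * (1 + T)) := by simp
      _ ≤ K * (K * (K * lam o) * (1 + T)) := by gcongr
      _ = _ := by ring
  have hpZ : ∑ i, (lam i)⁻¹ * fderiv ℝ F (oneJet u x₀)
      (0, 0, dir (b i) (dir (b i) (gradient u)) x₀) = fderiv ℝ F (oneJet u x₀) (0, 0, Z) := by
    have : ((0, 0, Z) : Jet n) =
        ∑ i, (lam i)⁻¹ • ((0, 0, dir (b i) (dir (b i) (gradient u)) x₀) : Jet n) := by
      have hL : ∀ p, ((0, 0, p) : Jet n) = (LinearMap.inr ℝ (EuclideanSpace ℝ (Fin n)) _)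
        ((LinearMap.inr ℝ ℝ _) p) := fun p => rfl
      simp only [hL, hZ, map_sum, map_smul]
    rw [this, map_sum]
    refine Finset.sum_congr rfl fun i _ => ?_
    rw [map_smul, smul_eq_mul]
  have hterm : ∀ i, (lam i)⁻¹ * dir (b i) (dir (b i) (fun x => F (oneJet u x))) x₀ ≤
      3 * K ^ 3 * (lam i)⁻¹ + 3 * K * lam o + (lam i)⁻¹ * fderiv ℝ F (oneJet u x₀)
        (0, 0, dir (b i) (dir (b i) (gradient u)) x₀) := by
    intro i
    have hp := h.lam_pos i
    rw [h.dir_dir_jet_eq hFs]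
    have hJ : ‖dir (b i) (oneJet u) x₀‖ ≤ lam i + K := (h.norm_dir_jet_le i).trans (by linarith)
    have e1 := (abs_le.1 (abs_clm_clm_le ((h.ddform_le o o).trans hmK) hJ hJ)).2
    have e5 := (abs_le.1 (abs_clm_le ((h.dform_le o o).trans hmK)
      (norm_jet_snd_le (h.abs_dir_dir_diag_le i)))).2
    have hip := inv_pos.2 hp
    have hcancel : (lam i)⁻¹ * lam i = 1 := inv_mul_cancel₀ hp.ne'
    have e7 : K * (lam i + K) * (lam i + K) + K * (lam i + m) ≤
        3 * K ^ 3 + lam i * (3 * K * lam o) := by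
      have k1 : K ^ 2 ≤ K ^ 3 := pow_le_pow_right₀ hK1 (by norm_num)
      have : lam i * lam i ≤ lam i * lam o := mul_le_mul_of_nonneg_left (hmax i) hp.le
      have : lam i ≤ lam i * lam o := by nlinarith
      have k4 : K * m ≤ K ^ 2 := by nlinarith
      have k5 : 2 * K * (lam i * K) ≤ K * lam i ^ 2 + K * K ^ 2 := by
        nlinarith [mul_nonneg hK0 (sq_nonneg (lam i - K))]
      have k6 : K * lam i ≤ K * (lam i * lam o) := by gcongr
      have k7 : K * (lam i * lam i) ≤ K * (lam i * lam o) := by gcongr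
      nlinarith
    have e8 := mul_le_mul_of_nonneg_left (add_le_add e1 e5) hip.le
    have e9 := mul_le_mul_of_nonneg_left e7 hip.le
    have e10 : (lam i)⁻¹ * (3 * K ^ 3 + lam i * (3 * K * lam o)) =
        3 * K ^ 3 * (lam i)⁻¹ + 3 * K * lam o := by field_simp
    rw [e10] at e9
    rw [← add_assoc, mul_add]
    linarith
  have htot := Finset.sum_le_sum fun i (_ : i ∈ Finset.univ) => hterm i
  rw [Finset.sum_add_distrib, Finset.sum_add_distrib, ← Finset.mul_sum, ← hTdef, hpZ] at htot
  simp only [Finset.sum_const, Finset.card_univ, Fintype.card_fin, nsmul_eq_mul] at htot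
  have e6 := (abs_le.1 (abs_clm_le ((h.dform_le o o).trans hmK) (norm_jet_trd_le hZn))).2
  refine htot.trans ?_
  have k1 : K ^ 3 ≤ K ^ 4 := pow_le_pow_right₀ hK1 (by norm_num)
  have k2 : K ^ 2 ≤ K ^ 4 := pow_le_pow_right₀ hK1 (by norm_num)
  have k3 : n * (3 * K * lam o) ≤ 3 * K ^ 4 * lam o := by
    calc n * (3 * K * lam o) ≤ K * (3 * K * lam o) := by gcongr
      _ = 3 * K ^ 2 * lam o := by ring
      _ ≤ _ := by gcongr
  have k4 : 3 * K ^ 3 * T ≤ 3 * K ^ 4 * (lam o * T) := by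
    have : T ≤ lam o * T := by nlinarith
    gcongr
  have k6 : K * (K ^ 3 * lam o * (1 + T)) = K ^ 4 * lam o + K ^ 4 * (lam o * T) := by ring
  have k7 : 0 ≤ K ^ 4 * lam o := by positivity
  have k8 : 0 ≤ K ^ 4 * (lam o * T) := by positivity
  rw [k6] at e6
  nlinarith

/-- The linearized operator on the top diagonal entry of the augmented Hessian; the good term is
the quadratic expression in the third derivatives. -/
theorem frameOp_augForm_ge (hmax : ∀ i, lam i ≤ lam o) (hone : 1 ≤ lam o) :
    ∑ i, ∑ j, (lam i)⁻¹ * (lam j)⁻¹ * dir (b o) (augForm A u (b i) (b j)) x₀ ^ 2 -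
        14 * (n * m + 1) ^ 4 * (lam o * (∑ i, (lam i)⁻¹) + lam o ^ 2) ≤
      frameOp A G u x₀ b lam (augForm A u (b o) (b o)) := by
  obtain ⟨hmK, hnK, hmN⟩ := h.le_card_mul_add_one o
  have hm := h.one_le
  have hT := h.trace_nonneg
  have htr := h.sum_dir_dir_form_le hmax hone
  have hS := h.sum_dir_dir_augForm (b o)
  have hGe := h.second_order_G_ge hmax hone
  have hFe := h.second_order_form_ge hmax hone
  set K := n * m + 1 with hK
  set T := ∑ i, (lam i)⁻¹ with hTdef
  set S := ∑ i, ∑ j, (lam i)⁻¹ * (lam j)⁻¹ * dir (b o) (augForm A u (b i) (b j)) x₀ ^ 2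
  have hK1 : 1 ≤ K := by nlinarith
  have hl := h.lam_pos o
  rw [h.dir_dir_jet_eq h.smooth_G, h.dir_dir_gradient_eq, jet_add_right, map_add] at hS
  have hterm : ∀ i, (lam i)⁻¹ * dir (b o) (dir (b o) (augForm A u (b i) (b i))) x₀ -
      (lam i)⁻¹ * dir (b i) (dir (b i) (fun x => form A (b o) (b o) (oneJet u x))) x₀ -
      (7 * K ^ 4 * lam o) * (lam i)⁻¹ - (if i = o then K * lam o else 0) ≤
      (lam i)⁻¹ * (dir (b i) (dir (b i) (augForm A u (b o) (b o))) x₀ -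
        fderiv ℝ (form A (b i) (b i)) (oneJet u x₀)
          (0, 0, gradient (augForm A u (b o) (b o)) x₀)) := by
    intro i
    have hip := inv_pos.2 (h.lam_pos i)
    rw [h.dir_dir_augForm_eq (b o) (b i), h.dir_dir_jet_eq (contDiffAt_form h.smooth_A (b i) (b i)),
      h.dir_dir_gradient_eq, jet_add_right, map_add]
    have e1 := mul_le_mul_of_nonneg_left (hFe i) hip.le
    have e2 : (lam i)⁻¹ * (-(7 * K ^ 4 * lam o) - (if i = o then K * lam o ^ 2 else 0)) =
        -((7 * K ^ 4 * lam o) * (lam i)⁻¹) - (if i = o then K * lam o else 0) := by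
      by_cases hio : i = o
      · subst hio
        simp only [if_true]
        have := (h.lam_pos i).ne'
        field_simp
      · simp only [hio, if_false]; ring
    rw [e2] at e1
    nlinarith
  have htot := Finset.sum_le_sum fun i (_ : i ∈ Finset.univ) => hterm i
  rw [Finset.sum_sub_distrib, Finset.sum_sub_distrib, Finset.sum_sub_distrib, ← Finset.mul_sum,
    ← hTdef, hS] at htot
  simp only [Finset.sum_ite_eq', Finset.mem_univ, if_true] at htot
  unfold frameOp
  have hl2 : lam o ≤ lam o ^ 2 := by nlinarith
  have hK4 : 0 ≤ K ^ 4 := by positivity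
  have k1 : K * lam o ≤ K ^ 4 * lam o ^ 2 := by
    have : K ≤ K ^ 4 := le_self_pow₀ hK1 (by norm_num)
    gcongr
  have k2 : K ^ 4 * lam o ≤ K ^ 4 * lam o ^ 2 := by gcongr
  nlinarith

/-- The logarithm of the top eigenvalue is almost a subsolution of the linearized equation: half of
the squared gradient is retained in all directions but that of the top eigenvector. -/
theorem frameOp_log_augForm_ge (hmax : ∀ i, lam i ≤ lam o) (hone : 1 ≤ lam o) :
    1 / 2 * ∑ i, (if i = o then 0 else
        (lam i)⁻¹ * (dir (b i) (augForm A u (b o) (b o)) x₀ / lam o) ^ 2) -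
        38 * (n * m + 1) ^ 4 * ((∑ i, (lam i)⁻¹) + lam o) ≤
      frameOp A G u x₀ b lam (fun y => Real.log (augForm A u (b o) (b o) y)) := by
  obtain ⟨hmK, hnK, hmN⟩ := h.le_card_mul_add_one o
  have hm := h.one_le
  have hT := h.trace_nonneg
  have hmain := h.frameOp_augForm_ge hmax hone
  have hlamadd := h.lam_add_le hmax hone
  set K := n * m + 1 with hK
  set T := ∑ i, (lam i)⁻¹ with hTdef
  set S := ∑ i, ∑ j, (lam i)⁻¹ * (lam j)⁻¹ * dir (b o) (augForm A u (b i) (b j)) x₀ ^ 2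
    with hSdef
  have hK1 : 1 ≤ K := by nlinarith
  have hl := h.lam_pos o
  have hval : augForm A u (b o) (b o) x₀ = lam o := by rw [h.frame, if_pos rfl]
  set a : Fin n → ℝ := fun i => dir (b i) (augForm A u (b o) (b o)) x₀ / lam o with ha
  -- keep the entries of the quadratic third-order term in the row and the column of `o`
  have hcross : ∀ i, dir (b o) (augForm A u (b i) (b o)) x₀ =
      dir (b o) (augForm A u (b o) (b i)) x₀ := fun i =>
    dir_congr (h.augForm_comm_eventually _ _) _
  set c : Fin n → ℝ := fun i => dir (b o) (augForm A u (b o) (b i)) x₀ / lam o with hc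
  have hSge : ∑ i, (if i = o then (lam i)⁻¹ * c i ^ 2 else 2 * ((lam i)⁻¹ * c i ^ 2)) ≤
      S / lam o := by
    rw [le_div_iff₀ hl, Finset.sum_mul]
    have hrow : ∀ i, (if i = o then ∑ j, (lam j)⁻¹ * c j ^ 2 * lam o else
        (lam i)⁻¹ * c i ^ 2 * lam o) ≤
        ∑ j, (lam i)⁻¹ * (lam j)⁻¹ * dir (b o) (augForm A u (b i) (b j)) x₀ ^ 2 := by
      intro i
      have hnn : ∀ j, 0 ≤ (lam i)⁻¹ * (lam j)⁻¹ * dir (b o) (augForm A u (b i) (b j)) x₀ ^ 2 :=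
        fun j => mul_nonneg (mul_nonneg (inv_pos.2 (h.lam_pos i)).le
          (inv_pos.2 (h.lam_pos j)).le) (sq_nonneg _)
      by_cases hio : i = o
      · rw [if_pos hio]
        subst hio
        refine le_of_eq (Finset.sum_congr rfl fun j _ => ?_)
        simp only [hc]
        field_simp
      · rw [if_neg hio]
        refine le_trans (le_of_eq ?_) (Finset.single_le_sum (fun j _ => hnn j) (Finset.mem_univ o))
        simp only [hc, hcross]
        field_simp
    refine le_trans (le_of_eq ?_) (Finset.sum_le_sum fun i _ => hrow i)
    rw [← Finset.add_sum_erase _ _ (Finset.mem_univ o), ← Finset.add_sum_erase (a := o)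
      (f := fun i => if i = o then ∑ j, (lam j)⁻¹ * c j ^ 2 * lam o else
        (lam i)⁻¹ * c i ^ 2 * lam o) _ (Finset.mem_univ o)]
    simp only [if_true]
    rw [← Finset.add_sum_erase (f := fun j => (lam j)⁻¹ * c j ^ 2 * lam o) _ (Finset.mem_univ o),
      add_assoc, ← Finset.sum_add_distrib]
    congr 1
    refine Finset.sum_congr rfl fun i hi => ?_
    rw [if_neg (Finset.ne_of_mem_erase hi), if_neg (Finset.ne_of_mem_erase hi)]
    ring
  have hdiff : ∀ i, |c i - a i| ≤ 2 * K ^ 2 := by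
    intro i
    have h1 := h.dir_augForm_eq (b o) (b i)
    have h2 : c i - a i = (dir (b i) (fun x => form A (b o) (b o) (oneJet u x)) x₀ -
        dir (b o) (fun x => form A (b o) (b i) (oneJet u x)) x₀) / lam o := by
      simp only [hc, ha, h1]; ring
    have hb : ∀ k, m * (lam k + n * m) ≤ K * (K * lam o) := by
      intro k
      have := hlamadd k
      have := h.lam_pos k
      gcongr
    rw [h2, abs_div, abs_of_pos hl, div_le_iff₀ hl]
    refine (abs_sub _ _).trans ?_
    have h3 := (h.abs_dir_form_le o o i).trans (hb i)
    have h4 := (h.abs_dir_form_le o i o).trans (hb o)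
    nlinarith
  have hterm : ∀ i, 1 / 2 * (if i = o then 0 else (lam i)⁻¹ * a i ^ 2) - 24 * K ^ 4 * (lam i)⁻¹ ≤
      (if i = o then (lam i)⁻¹ * c i ^ 2 else 2 * ((lam i)⁻¹ * c i ^ 2)) -
        (lam i)⁻¹ * a i ^ 2 := by
    intro i
    have hip := inv_pos.2 (h.lam_pos i)
    have hK4 : 0 ≤ K ^ 4 := by positivity
    by_cases hio : i = o
    · have : c i = a i := by subst hio; rfl
      simp only [hio, if_true] at *
      rw [this]
      nlinarith
    · simp only [hio, if_false]
      have h1 : (c i - a i) ^ 2 ≤ 4 * K ^ 4 := by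
        have := sq_le_sq' (abs_le.1 (hdiff i)).1 (abs_le.1 (hdiff i)).2
        nlinarith
      -- `2c² - a² ≥ a²/2 - 6(c - a)²`
      have h2 : 1 / 2 * a i ^ 2 - 24 * K ^ 4 ≤ 2 * c i ^ 2 - a i ^ 2 := by
        nlinarith [sq_nonneg (4 * c i - 3 * a i)]
      have h3 := mul_le_mul_of_nonneg_left h2 hip.le
      nlinarith
  have htot := Finset.sum_le_sum fun i (_ : i ∈ Finset.univ) => hterm i
  rw [Finset.sum_sub_distrib, Finset.sum_sub_distrib, ← Finset.mul_sum, ← Finset.mul_sum,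
    ← hTdef] at htot
  rw [frameOp_log (h.smooth_augForm _ _) (by rw [hval]; exact hl.ne'), hval]
  have hdiv := div_le_div_of_nonneg_right hmain hl.le
  have e1 : (S - 14 * K ^ 4 * (lam o * T + lam o ^ 2)) / lam o =
      S / lam o - 14 * K ^ 4 * (T + lam o) := by field_simp
  rw [e1] at hdiv
  have : 0 ≤ K ^ 4 * lam o := by positivity
  simp only [ha] at htot hSge
  nlinarith

end SolutionAt

end Solution

/-! ### Bounds from the norms of the data and expansions along segments -/

section Data

variable {n : ℕ}

/-- The gradient of a function is determined by its partial derivatives. -/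
theorem gradient_eq_sum_partialD (f : EuclideanSpace ℝ (Fin n) → ℝ)
    (x : EuclideanSpace ℝ (Fin n)) :
    gradient f x = ∑ k, partialD k f x • EuclideanSpace.single k (1 : ℝ) := by
  rw [eq_sum_single (gradient f x)]
  refine Finset.sum_congr rfl fun k _ => ?_
  congr 1
  have := inner_gradient f x (EuclideanSpace.single k 1)
  rw [EuclideanSpace.inner_single_right] at this
  simpa [dir, partialD] using this

theorem fderiv_form {A : Jet n → Matrix (Fin n) (Fin n) ℝ} {q : Jet n}
    (hA : ∀ i j, DifferentiableAt ℝ (fun q => A q i j) q) (ξ ζ : EuclideanSpace ℝ (Fin n)) :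
    fderiv ℝ (form A ξ ζ) q = ∑ i, ∑ j, (ξ i * ζ j) • fderiv ℝ (fun q => A q i j) q := by
  unfold form
  rw [fderiv_fun_sum fun i _ => DifferentiableAt.fun_sum fun j _ => (hA i j).mul_const _]
  refine Finset.sum_congr rfl fun i _ => ?_
  rw [fderiv_fun_sum fun j _ => (hA i j).mul_const _]
  refine Finset.sum_congr rfl fun j _ => ?_
  rw [fderiv_mul_const (hA i j)]

theorem fderiv_fderiv_form {A : Jet n → Matrix (Fin n) (Fin n) ℝ} {q : Jet n}
    (hA : ∀ i j, ContDiffAt ℝ 2 (fun q => A q i j) q) (ξ ζ : EuclideanSpace ℝ (Fin n)) :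
    fderiv ℝ (fderiv ℝ (form A ξ ζ)) q =
      ∑ i, ∑ j, (ξ i * ζ j) • fderiv ℝ (fderiv ℝ (fun q => A q i j)) q := by
  have h1 : fderiv ℝ (form A ξ ζ) =ᶠ[𝓝 q]
      fun r => ∑ i, ∑ j, (ξ i * ζ j) • fderiv ℝ (fun q => A q i j) r := by
    filter_upwards [eventually_all.2 fun i => eventually_all.2 fun j =>
      eventually_differentiableAt_two (hA i j)] with r hr
    exact fderiv_form hr ξ ζ
  have hd : ∀ i j, DifferentiableAt ℝ (fderiv ℝ (fun q => A q i j)) q := fun i j =>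
    ((hA i j).fderiv_right (m := 1) (by norm_num)).differentiableAt (by norm_num)
  rw [h1.fderiv_eq, fderiv_fun_sum fun i _ => DifferentiableAt.fun_sum fun j _ =>
    (hd i j).fun_const_smul _]
  refine Finset.sum_congr rfl fun i _ => ?_
  rw [fderiv_fun_sum fun j _ => (hd i j).fun_const_smul _]
  refine Finset.sum_congr rfl fun j _ => ?_
  rw [fderiv_fun_const_smul (hd i j)]

/-- Regularity in terms of the second differential of the quadratic form of `A`. -/
theorem IsRegularMatrix.fderiv_fderiv_nonneg {A : Jet n → Matrix (Fin n) (Fin n) ℝ}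
    {U : Set (Jet n)} (hreg : IsRegularMatrix A U) {q : Jet n} (hq : q ∈ U)
    (hA : ∀ i j, ContDiffAt ℝ 2 (fun q => A q i j) q) {ξ η : EuclideanSpace ℝ (Fin n)}
    (hξη : inner ℝ ξ η = 0) :
    0 ≤ fderiv ℝ (fderiv ℝ (form A ξ ξ)) q (0, 0, η) (0, 0, η) := by
  have h1 := hreg q hq ξ η hξη
  have hη : ((0, 0, η) : Jet n) = ∑ k, η k • ((0, 0, EuclideanSpace.single k (1 : ℝ)) : Jet n) := by
    have hL : ∀ p, ((0, 0, p) : Jet n) = (LinearMap.inr ℝ (EuclideanSpace ℝ (Fin n)) _)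
        ((LinearMap.inr ℝ ℝ _) p) := fun p => rfl
    simp only [hL]
    conv_lhs => rw [eq_sum_single η]
    simp only [map_sum, map_smul]
  have hterm : ∀ i j k l, jetDp k (jetDp l (fun r => A r i j)) q =
      fderiv ℝ (fderiv ℝ (fun r => A r i j)) q (0, 0, EuclideanSpace.single k 1)
        (0, 0, EuclideanSpace.single l 1) := fun i j k l => dir_dir_apply (hA i j) _ _
  refine h1.trans (le_of_eq ?_)
  rw [fderiv_fderiv_form hA]
  simp only [hterm, FunLike.coe_sum, Finset.sum_apply, smul_apply, smul_eq_mul]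
  refine Finset.sum_congr rfl fun i _ => Finset.sum_congr rfl fun j _ => ?_
  rw [hη]
  simp only [map_sum, map_smul, FunLike.coe_sum, Finset.sum_apply, smul_apply, smul_eq_mul,
    Finset.mul_sum]
  rw [Finset.sum_comm]
  refine Finset.sum_congr rfl fun k _ => Finset.sum_congr rfl fun l _ => ?_
  ring

theorem abs_coord_le_one {ξ : EuclideanSpace ℝ (Fin n)} (hξ : ‖ξ‖ = 1) (i : Fin n) : |ξ i| ≤ 1 := by
  have := PiLp.norm_apply_le ξ i
  rwa [hξ] at this

theorem abs_coord_mul_le_one {ξ ζ : EuclideanSpace ℝ (Fin n)} (hξ : ‖ξ‖ = 1) (hζ : ‖ζ‖ = 1)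
    (i j : Fin n) : |ξ i * ζ j| ≤ 1 := by
  rw [abs_mul]
  exact mul_le_one₀ (abs_coord_le_one hξ i) (abs_nonneg _) (abs_coord_le_one hζ j)

/-- A pointwise bound extracted from the `C^k` norm. -/
theorem norm_iteratedFDeriv_le_of_cNorm {F : Type*} [NormedAddCommGroup F] [NormedSpace ℝ F]
    {k : ℕ} {f : F → ℝ} {S : Set F} (hf : cNorm k f S ≠ ⊤) {j : ℕ} (hj : j ≤ k) {x : F}
    (hx : x ∈ S) : ‖iteratedFDeriv ℝ j f x‖ ≤ (cNorm k f S).toReal := by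
  have h1 : ‖iteratedFDeriv ℝ j f x‖ₑ ≤ cNorm k f S := by
    refine le_trans ?_ (Finset.single_le_sum
      (f := fun j => ⨆ x ∈ S, ‖iteratedFDeriv ℝ j f x‖ₑ) (fun _ _ => zero_le)
      (Finset.mem_range.2 (Nat.lt_succ_of_le hj)))
    exact le_iSup₂_of_le x hx le_rfl
  rw [← toReal_enorm]
  exact ENNReal.toReal_mono hf h1

theorem norm_fderiv_fderiv_eq {F : Type*} [NormedAddCommGroup F] [NormedSpace ℝ F] (f : F → ℝ)
    (x : F) : ‖fderiv ℝ (fderiv ℝ f) x‖ = ‖iteratedFDeriv ℝ 2 f x‖ := by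
  rw [← norm_iteratedFDeriv_fderiv (n := 1), ← norm_iteratedFDeriv_fderiv (n := 0),
    norm_iteratedFDeriv_zero]

/-- The bounds on the values and the first two differentials of a function given by its `C²`
norm. -/
theorem bounds_of_cNorm_two {F : Type*} [NormedAddCommGroup F] [NormedSpace ℝ F]
    {f : F → ℝ} {S : Set F} (hf : cNorm 2 f S ≠ ⊤) {x : F} (hx : x ∈ S) :
    |f x| ≤ (cNorm 2 f S).toReal ∧ ‖fderiv ℝ f x‖ ≤ (cNorm 2 f S).toReal ∧
      ‖fderiv ℝ (fderiv ℝ f) x‖ ≤ (cNorm 2 f S).toReal := by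
  refine ⟨?_, ?_, ?_⟩
  · have := norm_iteratedFDeriv_le_of_cNorm hf (j := 0) (by norm_num) hx
    rwa [norm_iteratedFDeriv_zero] at this
  · have := norm_iteratedFDeriv_le_of_cNorm hf (j := 1) (by norm_num) hx
    rwa [← norm_iteratedFDeriv_fderiv (n := 0), norm_iteratedFDeriv_zero] at this
  · rw [norm_fderiv_fderiv_eq]
    exact norm_iteratedFDeriv_le_of_cNorm hf le_rfl hx

theorem cNorm_entry_ne_top {A : Jet n → Matrix (Fin n) (Fin n) ℝ} {B : Jet n → ℝ}
    {S : Set (Jet n)} {M : ℝ≥0} (hM : dataNorm A B S ≤ M) :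
    (∀ i j, cNorm 2 (fun q => A q i j) S ≠ ⊤) ∧ cNorm 2 (fun q => Real.log (B q)) S ≠ ⊤ ∧
      (∑ i, ∑ j, (cNorm 2 (fun q => A q i j) S).toReal) ≤ M ∧
      (cNorm 2 (fun q => Real.log (B q)) S).toReal ≤ M := by
  have h1 : (∑ i, ∑ j, cNorm 2 (fun q => A q i j) S) ≤ M := le_trans le_self_add hM
  have h2 : cNorm 2 (fun q => Real.log (B q)) S ≤ M := le_trans le_add_self hM
  have h3 : ∀ i j, cNorm 2 (fun q => A q i j) S ≠ ⊤ := by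
    intro i j
    refine ne_top_of_le_ne_top ENNReal.coe_ne_top (le_trans ?_ h1)
    refine le_trans ?_ (Finset.single_le_sum (f := fun i => ∑ j, cNorm 2 (fun q => A q i j) S)
      (fun _ _ => zero_le) (Finset.mem_univ i))
    exact Finset.single_le_sum (f := fun j => cNorm 2 (fun q => A q i j) S)
      (fun _ _ => zero_le) (Finset.mem_univ j)
  refine ⟨h3, ne_top_of_le_ne_top ENNReal.coe_ne_top h2, ?_, ?_⟩
  · have h4 := ENNReal.toReal_mono ENNReal.coe_ne_top h1
    rw [ENNReal.toReal_sum fun i _ => ENNReal.sum_ne_top.2 fun j _ => h3 i j] at h4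
    simp only [ENNReal.toReal_sum fun j _ => h3 _ j] at h4
    simpa using h4
  · simpa using ENNReal.toReal_mono ENNReal.coe_ne_top h2

theorem norm_sum_sum_smul_le {E : Type*} [NormedAddCommGroup E] [NormedSpace ℝ E]
    {ξ ζ : EuclideanSpace ℝ (Fin n)} (hξ : ‖ξ‖ = 1) (hζ : ‖ζ‖ = 1) {v : Fin n → Fin n → E}
    {c : Fin n → Fin n → ℝ} (hv : ∀ i j, ‖v i j‖ ≤ c i j) :
    ‖∑ i, ∑ j, (ξ i * ζ j) • v i j‖ ≤ ∑ i, ∑ j, c i j := by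
  refine (norm_sum_le _ _).trans (Finset.sum_le_sum fun i _ => ?_)
  refine (norm_sum_le _ _).trans (Finset.sum_le_sum fun j _ => ?_)
  rw [norm_smul]
  have := abs_coord_mul_le_one hξ hζ i j
  calc ‖ξ i * ζ j‖ * ‖v i j‖ ≤ 1 * ‖v i j‖ := mul_le_mul_of_nonneg_right this (norm_nonneg _)
    _ ≤ c i j := by rw [one_mul]; exact hv i j

theorem form_bounds {A : Jet n → Matrix (Fin n) (Fin n) ℝ} {B : Jet n → ℝ}
    {S : Set (Jet n)} {M : ℝ≥0} (hM : dataNorm A B S ≤ M) {q : Jet n} (hq : q ∈ S)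
    (hA : ∀ i j, ContDiffAt ℝ 2 (fun q => A q i j) q) {ξ ζ : EuclideanSpace ℝ (Fin n)}
    (hξ : ‖ξ‖ = 1) (hζ : ‖ζ‖ = 1) :
    |form A ξ ζ q| ≤ M ∧ ‖fderiv ℝ (form A ξ ζ) q‖ ≤ M ∧
      ‖fderiv ℝ (fderiv ℝ (form A ξ ζ)) q‖ ≤ M := by
  obtain ⟨h1, -, h2, -⟩ := cNorm_entry_ne_top hM
  have h3 := fun i j => bounds_of_cNorm_two (h1 i j) hq
  refine ⟨?_, ?_, ?_⟩
  · have := norm_sum_sum_smul_le hξ hζ (v := fun i j => A q i j) fun i j => (h3 i j).1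
    simp only [smul_eq_mul, mul_comm (_ * _)] at this
    exact this.trans h2
  · rw [fderiv_form fun i j => (hA i j).differentiableAt (by norm_num)]
    exact (norm_sum_sum_smul_le hξ hζ (v := fun i j => fderiv ℝ (fun q => A q i j) q)
      fun i j => (h3 i j).2.1).trans h2
  · rw [fderiv_fderiv_form hA]
    exact (norm_sum_sum_smul_le hξ hζ (v := fun i j => fderiv ℝ (fderiv ℝ (fun q => A q i j)) q)
      fun i j => (h3 i j).2.2).trans h2

/-- The contribution of `A` to the linearized operator, as a quadratic form. -/
theorem linearizedOp_eq_sum {A : Jet n → Matrix (Fin n) (Fin n) ℝ}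
    {u φ : EuclideanSpace ℝ (Fin n) → ℝ} {x₀ : EuclideanSpace ℝ (Fin n)}
    {b : OrthonormalBasis (Fin n) ℝ (EuclideanSpace ℝ (Fin n))} {lam : Fin n → ℝ}
    (hu : ContDiffAt ℝ 2 u x₀) (hφ : ContDiffAt ℝ 2 φ x₀)
    (hA : ∀ i j, DifferentiableAt ℝ (fun q => A q i j) (oneJet u x₀))
    (hlam : ∀ i, lam i ≠ 0)
    (hframe : ∀ i j, augForm A u (b i) (b j) x₀ = if i = j then lam i else 0) :
    linearizedOp A u φ x₀ = ∑ i, (lam i)⁻¹ * (dir (b i) (dir (b i) φ) x₀ -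
      fderiv ℝ (form A (b i) (b i)) (oneJet u x₀) (0, 0, gradient φ x₀)) := by
  have hW : ∀ i j, ∑ k, ∑ l, augHessian A u x₀ k l * (b i k * b j l) =
      if i = j then lam i else 0 := fun i j => by rw [← augForm_eq_sum hu, hframe]
  have h1 := sum_inv_mul_eq b hlam hW (Matrix.of fun i j =>
    hessian φ x₀ i j - ∑ k, jetDp k (fun r => A r i j) (oneJet u x₀) * partialD k φ x₀)
  simp only [Matrix.of_apply] at h1
  rw [linearizedOp, h1]
  refine Finset.sum_congr rfl fun i _ => ?_
  congr 1
  have hg : ((0, 0, gradient φ x₀) : Jet n) =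
      ∑ k, partialD k φ x₀ • ((0, 0, EuclideanSpace.single k (1 : ℝ)) : Jet n) := by
    have hL : ∀ p, ((0, 0, p) : Jet n) = (LinearMap.inr ℝ (EuclideanSpace ℝ (Fin n)) _)
        ((LinearMap.inr ℝ ℝ _) p) := fun p => rfl
    simp only [hL]
    rw [gradient_eq_sum_partialD φ x₀]
    simp only [map_sum, map_smul]
  rw [dir_dir_eq_sum_hessian hφ, fderiv_form hA]
  simp only [sub_mul, Finset.sum_sub_distrib]
  congr 1
  rw [FunLike.coe_sum, Finset.sum_apply]
  refine Finset.sum_congr rfl fun k _ => ?_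
  rw [FunLike.coe_sum, Finset.sum_apply]
  refine Finset.sum_congr rfl fun l _ => ?_
  rw [hg, smul_apply, map_sum, smul_eq_mul, mul_comm]
  congr 1
  refine Finset.sum_congr rfl fun j _ => ?_
  rw [map_smul, smul_eq_mul, mul_comm]
  rfl

theorem trace_inv_eq_sum {A : Jet n → Matrix (Fin n) (Fin n) ℝ}
    {u : EuclideanSpace ℝ (Fin n) → ℝ} {x₀ : EuclideanSpace ℝ (Fin n)}
    {b : OrthonormalBasis (Fin n) ℝ (EuclideanSpace ℝ (Fin n))} {lam : Fin n → ℝ}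
    (hu : ContDiffAt ℝ 2 u x₀) (hlam : ∀ i, lam i ≠ 0)
    (hframe : ∀ i j, augForm A u (b i) (b j) x₀ = if i = j then lam i else 0) :
    (augHessian A u x₀)⁻¹.trace = ∑ i, (lam i)⁻¹ := by
  have hW : ∀ i j, ∑ k, ∑ l, augHessian A u x₀ k l * (b i k * b j l) =
      if i = j then lam i else 0 := fun i j => by rw [← augForm_eq_sum hu, hframe]
  have h1 := sum_inv_mul_eq b hlam hW 1
  simp only [Matrix.one_apply, mul_ite, mul_one, mul_zero, ite_mul, one_mul, zero_mul,
    Finset.sum_ite_eq, Finset.mem_univ, if_true] at h1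
  rw [Matrix.trace, show (∑ i, (augHessian A u x₀)⁻¹.diag i) =
    ∑ i, (augHessian A u x₀)⁻¹ i i from rfl, h1]
  refine Finset.sum_congr rfl fun i _ => ?_
  have h2 := b.orthonormal.1 i
  rw [EuclideanSpace.norm_eq, Real.sqrt_eq_one] at h2
  simp only [Real.norm_eq_abs, sq_abs] at h2
  simp only [← sq, h2, mul_one]

end Data

section Segments

variable {n : ℕ}

theorem jet_line_hasDerivAt {F : Jet n → ℝ} {q d : Jet n} {t : ℝ}
    (hF : DifferentiableAt ℝ F (q + t • d)) :
    HasDerivAt (fun s : ℝ => F (q + s • d)) (fderiv ℝ F (q + t • d) d) t := by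
  have h1 : HasDerivAt (fun s : ℝ => q + s • d) d t := by
    simpa using ((hasDerivAt_id t).smul_const d).const_add q
  exact hF.hasFDerivAt.comp_hasDerivAt t h1

/-- First-order expansion with a lower bound for the second derivative along a segment. -/
theorem taylor_lower_bound {F : Jet n → ℝ} {q d : Jet n} {μ : ℝ}
    (hF : ∀ t ∈ Set.Icc (0 : ℝ) 1, ContDiffAt ℝ 2 F (q + t • d))
    (hd : ∀ t ∈ Set.Icc (0 : ℝ) 1, -(2 * μ) ≤ fderiv ℝ (fderiv ℝ F) (q + t • d) d d) :
    F q + fderiv ℝ F q d - μ ≤ F (q + d) := by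
  set g : ℝ → ℝ := fun s => F (q + s • d) with hg
  set g' : ℝ → ℝ := fun s => fderiv ℝ F (q + s • d) d with hg'
  have h1 : ∀ t ∈ Set.Icc (0 : ℝ) 1, HasDerivAt g (g' t) t := fun t ht =>
    jet_line_hasDerivAt ((hF t ht).differentiableAt (by norm_num))
  have h2 : ∀ t ∈ Set.Icc (0 : ℝ) 1,
      HasDerivAt g' (fderiv ℝ (fderiv ℝ F) (q + t • d) d d) t := by
    intro t ht
    have h3 : DifferentiableAt ℝ (dir d F) (q + t • d) :=
      (contDiffAt_dir (hF t ht) (k := 1) (by norm_num) d).differentiableAt (by norm_num)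
    have h4 := jet_line_hasDerivAt h3
    have h5 := dir_dir_apply (hF t ht) d d
    rw [← h5]
    exact h4
  have hmono1 : MonotoneOn (fun t => g' t + 2 * μ * t) (Set.Icc 0 1) := by
    have hder : ∀ t ∈ Set.Icc (0 : ℝ) 1, HasDerivAt (fun t => g' t + 2 * μ * t)
        (fderiv ℝ (fderiv ℝ F) (q + t • d) d d + 2 * μ) t := fun t ht => by
      simpa using (h2 t ht).fun_add ((hasDerivAt_id t).const_mul (2 * μ))
    refine monotoneOn_of_deriv_nonneg (convex_Icc 0 1)
      (fun t ht => (hder t ht).continuousAt.continuousWithinAt)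
      (fun t ht => (hder t (interior_subset ht)).differentiableAt.differentiableWithinAt) ?_
    intro t ht
    rw [(hder t (interior_subset ht)).deriv]
    linarith [hd t (interior_subset ht)]
  have hmono2 : MonotoneOn (fun t => g t - g' 0 * t + μ * t ^ 2) (Set.Icc 0 1) := by
    have hder : ∀ t ∈ Set.Icc (0 : ℝ) 1, HasDerivAt (fun t => g t - g' 0 * t + μ * t ^ 2)
        (g' t - g' 0 + μ * (2 * t)) t := fun t ht => by
      simpa using ((h1 t ht).fun_sub ((hasDerivAt_id t).const_mul (g' 0))).fun_add
        ((hasDerivAt_pow 2 t).const_mul μ)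
    refine monotoneOn_of_deriv_nonneg (convex_Icc 0 1)
      (fun t ht => (hder t ht).continuousAt.continuousWithinAt)
      (fun t ht => (hder t (interior_subset ht)).differentiableAt.differentiableWithinAt) ?_
    intro t ht
    have ht' := interior_subset ht
    rw [(hder t ht').deriv]
    have := hmono1 (Set.left_mem_Icc.2 zero_le_one) ht' ht'.1
    simp only [mul_zero, add_zero] at this
    linarith
  have h3 := hmono2 (Set.left_mem_Icc.2 zero_le_one) (Set.right_mem_Icc.2 zero_le_one) zero_le_one
  simp only [hg, hg', zero_smul, one_smul, add_zero] at h3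
  norm_num at h3
  linarith

/-- A lower bound for the increment of a function along a segment of the jet space. -/
theorem mean_value_lower_bound {F : Jet n → ℝ} {q d : Jet n} {μ : ℝ}
    (hF : ∀ t ∈ Set.Icc (0 : ℝ) 1, DifferentiableAt ℝ F (q + t • d))
    (hd : ∀ t ∈ Set.Icc (0 : ℝ) 1, -μ ≤ fderiv ℝ F (q + t • d) d) :
    F q - μ ≤ F (q + d) := by
  have hmono : MonotoneOn (fun t : ℝ => F (q + t • d) + μ * t) (Set.Icc 0 1) := by
    have hder : ∀ t ∈ Set.Icc (0 : ℝ) 1, HasDerivAt (fun t : ℝ => F (q + t • d) + μ * t)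
        (fderiv ℝ F (q + t • d) d + μ) t := fun t ht => by
      simpa using (jet_line_hasDerivAt (hF t ht)).fun_add ((hasDerivAt_id t).const_mul μ)
    refine monotoneOn_of_deriv_nonneg (convex_Icc 0 1)
      (fun t ht => (hder t ht).continuousAt.continuousWithinAt)
      (fun t ht => (hder t (interior_subset ht)).differentiableAt.differentiableWithinAt) ?_
    intro t ht
    rw [(hder t (interior_subset ht)).deriv]
    linarith [hd t (interior_subset ht)]
  have h3 := hmono (Set.left_mem_Icc.2 zero_le_one) (Set.right_mem_Icc.2 zero_le_one) zero_le_one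
  simp only [zero_smul, one_smul, add_zero] at h3
  linarith

/-- A bilinear form that is nonnegative on the orthogonal complement of a unit vector `ξ` is
bounded below in all directions by a term that is linear in the component along `ξ`. -/
theorem quadratic_lower_bound {Q : Jet n →L[ℝ] Jet n →L[ℝ] ℝ} {m : ℝ} (hQ : ‖Q‖ ≤ m)
    {ξ : EuclideanSpace ℝ (Fin n)} (hξ : ‖ξ‖ = 1)
    (hpos : ∀ η, inner ℝ ξ η = 0 → 0 ≤ Q (0, 0, η) (0, 0, η)) (ζ : EuclideanSpace ℝ (Fin n)) :
    -(3 * m * |inner ℝ ξ ζ| * ‖ζ‖) ≤ Q (0, 0, ζ) (0, 0, ζ) := by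
  set s := inner ℝ ξ ζ with hs
  have hm : 0 ≤ m := (norm_nonneg Q).trans hQ
  have hsle : |s| ≤ ‖ζ‖ := by
    have := abs_real_inner_le_norm ξ ζ
    rwa [hξ, one_mul] at this
  have h0 := hpos (ζ - s • ξ) (by
    rw [inner_sub_right, inner_smul_right, real_inner_self_eq_norm_sq, hξ, hs]; ring)
  have hsplit : ((0, 0, ζ - s • ξ) : Jet n) = (0, 0, ζ) - s • (0, 0, ξ) := by simp
  rw [hsplit] at h0
  simp only [map_sub, map_smul, sub_apply, smul_apply, smul_eq_mul] at h0
  have hξn : ‖((0, 0, ξ) : Jet n)‖ ≤ 1 := norm_jet_le _ _ _ (by simp) (by simp) hξ.le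
  have hζn : ‖((0, 0, ζ) : Jet n)‖ ≤ ‖ζ‖ := norm_jet_le _ _ _ (by simp) (by simp) le_rfl
  have e1 := SolutionAt.abs_clm_clm_le hQ hξn hζn
  have e2 := SolutionAt.abs_clm_clm_le hQ hζn hξn
  have e3 := SolutionAt.abs_clm_clm_le hQ hξn hξn
  have f1 : |s * Q (0, 0, ξ) (0, 0, ζ)| ≤ |s| * (m * 1 * ‖ζ‖) := by
    rw [abs_mul]; gcongr
  have f2 : |s * Q (0, 0, ζ) (0, 0, ξ)| ≤ |s| * (m * ‖ζ‖ * 1) := by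
    rw [abs_mul]; gcongr
  have f3 : |s * (s * Q (0, 0, ξ) (0, 0, ξ))| ≤ |s| * (‖ζ‖ * (m * 1 * 1)) := by
    rw [abs_mul, abs_mul]; gcongr
  have g1 := (abs_le.1 f1).1
  have g2 := (abs_le.1 f2).1
  have g3 := (abs_le.1 f3).2
  nlinarith

end Segments

/-! ### The cutoff and the barriers -/

section Cutoff

variable {n : ℕ}

theorem dir_norm_sub_sq (p v x : EuclideanSpace ℝ (Fin n)) :
    dir v (fun y => ‖y - p‖ ^ 2 / 2) x = inner ℝ (x - p) v := by
  have h1 := ((hasFDerivAt_id (𝕜 := ℝ) x).sub_const p).norm_sq.const_mul (1 / 2 : ℝ)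
  have h' : (fun y => ‖y - p‖ ^ 2 / 2) = fun y => 1 / 2 * ‖y - p‖ ^ 2 := by
    funext y; ring
  rw [h', dir, show fderiv ℝ (fun y => 1 / 2 * ‖y - p‖ ^ 2) x = _ from h1.fderiv]
  simp [inner_sub_left]

theorem dir_dir_norm_sub_sq (p v x : EuclideanSpace ℝ (Fin n)) :
    dir v (dir v (fun y => ‖y - p‖ ^ 2 / 2)) x = ‖v‖ ^ 2 := by
  have h0 : dir v (fun y => ‖y - p‖ ^ 2 / 2) =
      fun y => inner ℝ v y - inner ℝ v p := by
    funext y; rw [dir_norm_sub_sq, real_inner_comm, inner_sub_right]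
  have h1 := dir_clm (innerSL ℝ v) v x
  simp only [innerSL_apply_apply] at h1
  have h2 : DifferentiableAt ℝ (fun y : EuclideanSpace ℝ (Fin n) => inner ℝ v y) x :=
    (innerSL ℝ v).differentiableAt
  rw [h0, dir_sub h2 (differentiableAt_const _), dir_const, h1,
    real_inner_self_eq_norm_sq, sub_zero]

theorem contDiff_norm_sub_sq (p : EuclideanSpace ℝ (Fin n)) (k : WithTop ℕ∞) :
    ContDiff ℝ k (fun y => ‖y - p‖ ^ 2 / 2) :=
  ((contDiff_id.sub contDiff_const).norm_sq ℝ).div_const _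

namespace SolutionAt

variable {A : Jet n → Matrix (Fin n) (Fin n) ℝ} {G : Jet n → ℝ}
    {u : EuclideanSpace ℝ (Fin n) → ℝ}
    {x₀ : EuclideanSpace ℝ (Fin n)} {b : OrthonormalBasis (Fin n) ℝ (EuclideanSpace ℝ (Fin n))}
    {lam : Fin n → ℝ} {m : ℝ} (h : SolutionAt A G u x₀ b lam m)

include h

/-- The linearized operator on the difference `u₀ - u`. Degenerate ellipticity of `u₀` makes
`w^{ij} D_{ij}(u₀ - u)` bounded below up to the increment of `A` between the one-jets of `u` and
`u₀`, which is estimated by `hz` in the variable `z` and by `hp` in the variable `p`. -/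
theorem frameOp_sub_ge {u₀ : EuclideanSpace ℝ (Fin n) → ℝ} {a : ℝ}
    (hu₀ : ContDiffAt ℝ 2 u₀ x₀) (hpsd : ∀ i, 0 ≤ augForm A u₀ (b i) (b i) x₀)
    (hg₀ : ‖gradient u₀ x₀‖ ≤ m)
    (hz : ∀ i, form A (b i) (b i) (x₀, u x₀, gradient u₀ x₀) - a * (u₀ x₀ - u x₀) ≤
      form A (b i) (b i) (oneJet u₀ x₀))
    (hp : ∀ i, form A (b i) (b i) (oneJet u x₀) + fderiv ℝ (form A (b i) (b i)) (oneJet u x₀)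
        (0, 0, gradient u₀ x₀ - gradient u x₀) -
        4 * m ^ 2 * |inner ℝ (b i) (gradient u₀ x₀ - gradient u x₀)| ≤
      form A (b i) (b i) (x₀, u x₀, gradient u₀ x₀)) :
    -(n + 2 * m ^ 2) - a * (u₀ x₀ - u x₀) * (∑ i, (lam i)⁻¹) -
        4 * m ^ 2 * ∑ i, (lam i)⁻¹ * |dir (b i) (fun x => u₀ x - u x) x₀| ≤
      frameOp A G u x₀ b lam (fun x => u₀ x - u x) := by
  have h2 : ContDiffAt ℝ 2 u x₀ := h.smooth.of_le (by norm_num)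
  have hdir : ∀ v, dir v (fun x => u₀ x - u x) x₀ =
      inner ℝ (gradient u₀ x₀ - gradient u x₀) v := by
    intro v
    rw [dir_sub (hu₀.differentiableAt (by norm_num)) (h2.differentiableAt (by norm_num)),
      inner_sub_left, inner_gradient, inner_gradient]
  have hgrad : gradient (fun x => u₀ x - u x) x₀ = gradient u₀ x₀ - gradient u x₀ :=
    gradient_eq_of_dir hdir
  set ζ := gradient u₀ x₀ - gradient u x₀ with hζ
  have hζn : ‖ζ‖ ≤ 2 * m := (norm_sub_le _ _).trans (by linarith [h.gradient_le])
  have hGb := (abs_le.1 (abs_clm_le h.dG_le (norm_jet_trd_le hζn))).2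
  have hterm : ∀ i, -1 - a * (u₀ x₀ - u x₀) * (lam i)⁻¹ -
      4 * m ^ 2 * ((lam i)⁻¹ * |dir (b i) (fun x => u₀ x - u x) x₀|) ≤
      (lam i)⁻¹ * (dir (b i) (dir (b i) (fun x => u₀ x - u x)) x₀ -
        fderiv ℝ (form A (b i) (b i)) (oneJet u x₀) (0, 0, ζ)) := by
    intro i
    have hip := inv_pos.2 (h.lam_pos i)
    have hcancel : (lam i)⁻¹ * lam i = 1 := inv_mul_cancel₀ (h.lam_pos i).ne'
    rw [dir_dir_sub hu₀ h2, h.dir_dir_diag i, hdir, real_inner_comm]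
    have e1 : dir (b i) (dir (b i) u₀) x₀ =
        augForm A u₀ (b i) (b i) x₀ + form A (b i) (b i) (oneJet u₀ x₀) := by simp [augForm]
    have e2 : -lam i - a * (u₀ x₀ - u x₀) - 4 * m ^ 2 * |inner ℝ (b i) ζ| ≤
        dir (b i) (dir (b i) u₀) x₀ - (lam i + form A (b i) (b i) (oneJet u x₀)) -
          fderiv ℝ (form A (b i) (b i)) (oneJet u x₀) (0, 0, ζ) := by
      linarith [hpsd i, hz i, hp i]
    have e3 := mul_le_mul_of_nonneg_left e2 hip.le
    nlinarith
  have htot := Finset.sum_le_sum fun i (_ : i ∈ Finset.univ) => hterm i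
  rw [Finset.sum_sub_distrib, Finset.sum_sub_distrib, ← Finset.mul_sum, ← Finset.mul_sum] at htot
  simp only [Finset.sum_const, Finset.card_univ, Fintype.card_fin, nsmul_eq_mul] at htot
  unfold frameOp
  rw [hgrad]
  nlinarith

/-- The cutoff `u₀ - u - ε (1 + X - χ)`: the correction by the barrier `χ` makes the cutoff
negative near the boundary of the domain, and preserves the estimate for `u₀ - u`, uniformly in
`ε ≤ 1`. -/
theorem frameOp_cutoff_ge {η χ : EuclideanSpace ℝ (Fin n) → ℝ} {a c Λ K₁ K₂ X ε : ℝ}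
    (hη : ContDiffAt ℝ 2 η x₀) (hχ : ContDiffAt ℝ 2 χ x₀)
    (hηop : -c - a * η x₀ * (∑ i, (lam i)⁻¹) - K₁ * ∑ i, (lam i)⁻¹ * |dir (b i) η x₀| ≤
      frameOp A G u x₀ b lam η)
    (hχop : Λ * (∑ i, (lam i)⁻¹) + K₁ * ∑ i, (lam i)⁻¹ * |dir (b i) χ x₀| - K₂ ≤
      frameOp A G u x₀ b lam χ)
    (hχ0 : 0 ≤ χ x₀) (ha : 0 ≤ a) (hK₁ : 0 ≤ K₁) (hK₂ : 0 ≤ K₂) (hΛ : a * (1 + X) ≤ Λ)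
    (hε : 0 ≤ ε) (hε1 : ε ≤ 1) :
    -(c + K₂) - a * (η x₀ - ε * (1 + X - χ x₀)) * (∑ i, (lam i)⁻¹) -
        K₁ * ∑ i, (lam i)⁻¹ * |dir (b i) (fun y => η y - ε * (1 + X - χ y)) x₀| ≤
      frameOp A G u x₀ b lam (fun y => η y - ε * (1 + X - χ y)) := by
  have hform : (fun y => η y - ε * (1 + X - χ y)) =
      fun y => (η y + ε * χ y) - ε * (1 + X) := by funext y; ring
  have hd1 : DifferentiableAt ℝ η x₀ := hη.differentiableAt (by norm_num)
  have hd2 : DifferentiableAt ℝ (fun y => ε * χ y) x₀ :=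
    (hχ.differentiableAt (by norm_num)).const_mul ε
  have hdir : ∀ v, dir v (fun y => η y - ε * (1 + X - χ y)) x₀ =
      1 * dir v η x₀ + ε * dir v χ x₀ := by
    intro v
    rw [hform, dir_sub (hd1.fun_add hd2) (differentiableAt_const _), dir_add hd1 hd2, dir_const,
      dir_const_mul (hχ.differentiableAt (by norm_num))]
    ring
  have hop : frameOp A G u x₀ b lam (fun y => η y - ε * (1 + X - χ y)) =
      frameOp A G u x₀ b lam η + ε * frameOp A G u x₀ b lam χ := by
    rw [frameOp_linear 1 ε 0 hdir]
    · simp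
    · intro i
      have hχ' : ContDiffAt ℝ 2 (fun y => ε * χ y) x₀ := contDiffAt_const.mul hχ
      rw [hform, dir_dir_sub (hη.add hχ') contDiffAt_const, dir_dir_add hη hχ',
        dir_dir_const_mul hχ]
      have : dir (b i) (dir (b i) fun _ : EuclideanSpace ℝ (Fin n) => ε * (1 + X)) x₀ = 0 := by
        have h0 : (dir (b i) fun _ : EuclideanSpace ℝ (Fin n) => ε * (1 + X)) = fun _ => 0 := by
          funext y; exact dir_const _ _ _
        rw [h0, dir_const]
      rw [this]; simp
  have hT := h.trace_nonneg
  rw [hop]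
  simp only [hdir]
  have hsum : ∑ i, (lam i)⁻¹ * |dir (b i) η x₀| ≤
      ∑ i, (lam i)⁻¹ * |1 * dir (b i) η x₀ + ε * dir (b i) χ x₀| +
        ε * ∑ i, (lam i)⁻¹ * |dir (b i) χ x₀| := by
    rw [Finset.mul_sum, ← Finset.sum_add_distrib]
    refine Finset.sum_le_sum fun i _ => ?_
    have hip := inv_pos.2 (h.lam_pos i)
    have h3 : |dir (b i) η x₀| ≤ |1 * dir (b i) η x₀ + ε * dir (b i) χ x₀| +
        ε * |dir (b i) χ x₀| := by
      have h4 := abs_sub (1 * dir (b i) η x₀ + ε * dir (b i) χ x₀) (ε * dir (b i) χ x₀)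
      rw [abs_mul ε, abs_of_nonneg hε] at h4
      rw [add_sub_cancel_right] at h4
      simpa only [one_mul] using h4
    have h5 := mul_le_mul_of_nonneg_left h3 hip.le
    linarith
  have e1 := mul_le_mul_of_nonneg_left hsum hK₁
  have e2 := mul_le_mul_of_nonneg_left hχop hε
  have e3 : ε * K₂ ≤ K₂ := mul_le_of_le_one_left hK₂ hε1
  have e4 : ε * (a * (1 + X - χ x₀)) * (∑ i, (lam i)⁻¹) ≤ ε * Λ * (∑ i, (lam i)⁻¹) := by
    have : a * (1 + X - χ x₀) ≤ Λ := by nlinarith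
    gcongr
  nlinarith

/-- The exponential of a multiple of a function whose linearized operator dominates the trace of
`w⁻¹` up to a constant: the second derivative of the exponential absorbs terms that are linear in
the gradient. -/
theorem frameOp_exp_barrier_ge {φ : EuclideanSpace ℝ (Fin n) → ℝ} {C Φ κ Λ K₁ : ℝ}
    (hφ : ContDiffAt ℝ 2 φ x₀) (hφ0 : 0 ≤ φ x₀) (hφΦ : φ x₀ ≤ Φ)
    (hgrad : ‖gradient φ x₀‖ ≤ Φ) (hC : 0 ≤ C)
    (hop : (augHessian A u x₀)⁻¹.trace - C ≤ linearizedOp A u φ x₀)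
    (hΛ : 0 ≤ Λ) (hκ : K₁ ^ 2 + Λ ≤ κ) :
    Λ * (∑ i, (lam i)⁻¹) +
        K₁ * ∑ i, (lam i)⁻¹ * |dir (b i) (fun y => Real.exp (κ * φ y)) x₀| -
        κ * Real.exp (κ * Φ) * (C + m * Φ) ≤
      frameOp A G u x₀ b lam (fun y => Real.exp (κ * φ y)) := by
  have h2 : ContDiffAt ℝ 2 u x₀ := h.smooth.of_le (by norm_num)
  have hA1 : ∀ i j, DifferentiableAt ℝ (fun q => A q i j) (oneJet u x₀) := fun i j =>
    (h.smooth_A i j).differentiableAt (by norm_num)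
  have hlam : ∀ i, lam i ≠ 0 := fun i => (h.lam_pos i).ne'
  rw [trace_inv_eq_sum h2 hlam h.frame, linearizedOp_eq_sum h2 hφ hA1 hlam h.frame] at hop
  have hκ0 : 0 ≤ κ := le_trans (by positivity) hκ
  have hΦ : 0 ≤ Φ := hφ0.trans hφΦ
  have hGb := (abs_le.1 (abs_clm_le h.dG_le (norm_jet_trd_le hgrad))).2
  have hopφ : (∑ i, (lam i)⁻¹) - (C + m * Φ) ≤ frameOp A G u x₀ b lam φ := by
    unfold frameOp; linarith
  have hκφ : ContDiffAt ℝ 2 (fun y => κ * φ y) x₀ := contDiffAt_const.mul hφ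
  rw [frameOp_exp hκφ, frameOp_const_mul hφ]
  have hdκ : ∀ v, dir v (fun y => κ * φ y) x₀ = κ * dir v φ x₀ := fun v =>
    dir_const_mul (hφ.differentiableAt (by norm_num)) κ v
  simp only [dir_exp (hκφ.differentiableAt (by norm_num)), hdκ]
  set e := Real.exp (κ * φ x₀) with he
  have he1 : 1 ≤ e := Real.one_le_exp (mul_nonneg hκ0 hφ0)
  have heΦ : e ≤ Real.exp (κ * Φ) := Real.exp_le_exp.2 (by gcongr)
  have hm : 0 ≤ m := zero_le_one.trans h.one_le
  have hterm : ∀ i, Λ * (lam i)⁻¹ + K₁ * ((lam i)⁻¹ * |e * (κ * dir (b i) φ x₀)|) ≤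
      e * κ * (lam i)⁻¹ + e * ((lam i)⁻¹ * (κ * dir (b i) φ x₀) ^ 2) := by
    intro i
    have hip := inv_pos.2 (h.lam_pos i)
    rw [abs_mul, abs_of_pos (zero_lt_one.trans_le he1)]
    set y := κ * dir (b i) φ x₀
    have h1 : K₁ * |y| ≤ y ^ 2 + K₁ ^ 2 := by
      rw [← sq_abs y]; nlinarith [sq_nonneg (|y| - K₁), sq_nonneg (|y| + K₁), abs_nonneg y]
    have h3 : Λ + e * (K₁ * |y|) ≤ e * κ + e * y ^ 2 := by
      have h4 : Λ ≤ e * Λ := le_mul_of_one_le_left hΛ he1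
      have h5 := mul_le_mul_of_nonneg_left h1 (zero_le_one.trans he1)
      have h6 := mul_le_mul_of_nonneg_left hκ (zero_le_one.trans he1)
      nlinarith
    have h7 := mul_le_mul_of_nonneg_left h3 hip.le
    nlinarith
  have htot := Finset.sum_le_sum fun i (_ : i ∈ Finset.univ) => hterm i
  rw [Finset.sum_add_distrib, Finset.sum_add_distrib, ← Finset.mul_sum, ← Finset.mul_sum,
    ← Finset.mul_sum, ← Finset.mul_sum] at htot
  have e1 := mul_le_mul_of_nonneg_left hopφ (mul_nonneg (zero_le_one.trans he1) hκ0)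
  have e2 : e * κ * (C + m * Φ) ≤ κ * Real.exp (κ * Φ) * (C + m * Φ) := by
    have : e * κ ≤ κ * Real.exp (κ * Φ) := by rw [mul_comm]; gcongr
    gcongr
  nlinarith

/-- On a set of small diameter a large multiple of the squared distance to a point is a barrier
with bounded gradient. -/
theorem frameOp_quadratic_barrier_ge {p : EuclideanSpace ℝ (Fin n)} {d N Λ K₁ : ℝ}
    (hd : ‖x₀ - p‖ ≤ d) (hdm : 2 * (m + K₁) * d ≤ 1) (hNd : N * d ≤ 1) (hN : 2 * Λ ≤ N)
    (hK₁ : 0 ≤ K₁) (hN0 : 0 ≤ N) :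
    Λ * (∑ i, (lam i)⁻¹) +
        K₁ * ∑ i, (lam i)⁻¹ * |dir (b i) (fun y => N * (‖y - p‖ ^ 2 / 2)) x₀| - m ≤
      frameOp A G u x₀ b lam (fun y => N * (‖y - p‖ ^ 2 / 2)) := by
  have hq : ContDiffAt ℝ 2 (fun y => ‖y - p‖ ^ 2 / 2) x₀ :=
    (contDiff_norm_sub_sq p 2).contDiffAt
  have hg : gradient (fun y => ‖y - p‖ ^ 2 / 2) x₀ = x₀ - p :=
    gradient_eq_of_dir fun w => dir_norm_sub_sq p w x₀
  have hm : 0 ≤ m := zero_le_one.trans h.one_le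
  rw [frameOp_const_mul hq]
  simp only [dir_const_mul (hq.differentiableAt (by norm_num)), dir_norm_sub_sq]
  unfold frameOp
  simp only [hg, dir_dir_norm_sub_sq, b.orthonormal.1]
  have hGb := (abs_le.1 (abs_clm_le h.dG_le (norm_jet_trd_le hd))).2
  have hterm : ∀ i, Λ * (lam i)⁻¹ + K₁ * ((lam i)⁻¹ * |N * inner ℝ (x₀ - p) (b i)|) ≤
      N * ((lam i)⁻¹ * (1 ^ 2 - fderiv ℝ (form A (b i) (b i)) (oneJet u x₀) (0, 0, x₀ - p))) := by
    intro i
    have hip := inv_pos.2 (h.lam_pos i)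
    have h1 := (abs_le.1 (abs_clm_le (h.dform_le i i) (norm_jet_trd_le hd))).2
    have h3 : |inner ℝ (x₀ - p) (b i)| ≤ d := by
      have := abs_real_inner_le_norm (x₀ - p) (b i)
      rw [b.orthonormal.1 i, mul_one] at this
      exact this.trans hd
    rw [abs_mul, abs_of_nonneg hN0]
    have h4 : Λ + K₁ * (N * |inner ℝ (x₀ - p) (b i)|) ≤
        N * (1 ^ 2 - fderiv ℝ (form A (b i) (b i)) (oneJet u x₀) (0, 0, x₀ - p)) := by
      have h5 : K₁ * (N * |inner ℝ (x₀ - p) (b i)|) ≤ K₁ * (N * d) := by gcongr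
      have h6 := mul_le_mul_of_nonneg_left h1 hN0
      have h7 := mul_le_mul_of_nonneg_left hdm hN0
      nlinarith
    have h8 := mul_le_mul_of_nonneg_left h4 hip.le
    nlinarith
  have htot := Finset.sum_le_sum fun i (_ : i ∈ Finset.univ) => hterm i
  rw [Finset.sum_add_distrib, ← Finset.mul_sum, ← Finset.mul_sum, ← Finset.mul_sum] at htot
  have h9 := mul_le_mul_of_nonneg_left hGb hN0
  have h10 : N * (m * d) ≤ m := by nlinarith
  rw [mul_sub]
  linarith

end SolutionAt

end Cutoff

/-! ### The inequality at a maximum point -/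

section MaximumPoint

variable {n : ℕ}

/-- The terms of the maximum principle in one direction of the frame other than that of the top
eigenvector. With `e = β D_iζ/ζ`, the vanishing of the gradient of the test function turns the bad
terms in `e` into terms in `p = D_iw_{oo}/w_{oo}`, which are absorbed, and into terms in the
gradients of `χ` and `|Du|²`. -/
theorem direction_term_ge {p e x γ K K₁ β τ L l : ℝ} (hsum : p + τ * γ + e + x = 0)
    (hγ : |γ| ≤ K * (l + K)) (hx : |x| ≤ L) (hK : 1 ≤ K) (hK₁ : 0 ≤ K₁) (hτ : 0 ≤ τ) (hl : 0 < l)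
    (hβ12 : 12 ≤ β) (hβL : 3 * L ^ 2 ≤ β) (hβτ : 6 * τ ^ 2 * K ^ 3 ≤ β) :
    -(K₁ ^ 2 + K₁ * τ * K ^ 2 + K + 1) * l⁻¹ - K₁ * τ * K - l / K ≤
      l⁻¹ * (1 / 2 * p ^ 2 - K₁ * |e| - e ^ 2 / β + K₁ * |x|) := by
  have hβ : 0 < β := by linarith
  have hK0 : 0 < K := by linarith
  have he : e = -(p + τ * γ + x) := by linarith
  have he1 : |e| ≤ |p| + τ * (K * (l + K)) + |x| := by
    rw [he, abs_neg]
    refine (abs_add_le _ _).trans ?_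
    have h1 := abs_add_le p (τ * γ)
    rw [abs_mul, abs_of_nonneg hτ] at h1
    have h2 := mul_le_mul_of_nonneg_left hγ hτ
    linarith
  have hγ2 : γ ^ 2 ≤ 2 * K ^ 2 * (l ^ 2 + K ^ 2) := by
    have h1 : γ ^ 2 ≤ (K * (l + K)) ^ 2 := sq_le_sq' (abs_le.1 hγ).1 (abs_le.1 hγ).2
    have h2 : (l + K) ^ 2 ≤ 2 * (l ^ 2 + K ^ 2) := by nlinarith [sq_nonneg (l - K)]
    have h3 := mul_le_mul_of_nonneg_left h2 (sq_nonneg K)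
    nlinarith
  have hx2 : x ^ 2 ≤ L ^ 2 := sq_le_sq' (abs_le.1 hx).1 (abs_le.1 hx).2
  have he2 : e ^ 2 ≤ 3 * (p ^ 2 + τ ^ 2 * γ ^ 2 + x ^ 2) := by
    rw [he]
    nlinarith [sq_nonneg (p - τ * γ), sq_nonneg (p - x), sq_nonneg (τ * γ - x)]
  have he3 : e ^ 2 / β ≤ 1 / 4 * p ^ 2 + (l ^ 2 + K ^ 2) / K + 1 := by
    rw [div_le_iff₀ hβ]
    have h1 : 3 * p ^ 2 ≤ 1 / 4 * p ^ 2 * β := by nlinarith [sq_nonneg p]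
    have h2 : 3 * (τ ^ 2 * γ ^ 2) ≤ (l ^ 2 + K ^ 2) / K * β := by
      have h3 := mul_le_mul_of_nonneg_left hγ2 (sq_nonneg τ)
      have h4 := mul_le_mul_of_nonneg_left hβτ (by positivity : 0 ≤ (l ^ 2 + K ^ 2) / K)
      have h5 : (l ^ 2 + K ^ 2) / K * (6 * τ ^ 2 * K ^ 3) =
          3 * (τ ^ 2 * (2 * K ^ 2 * (l ^ 2 + K ^ 2))) := by field_simp; ring
      linarith
    nlinarith
  have hp1 : K₁ * |p| ≤ 1 / 4 * p ^ 2 + K₁ ^ 2 := by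
    rw [← sq_abs p]; nlinarith [sq_nonneg (|p| - 2 * K₁)]
  have h1 := mul_le_mul_of_nonneg_left he1 hK₁
  have h2 : -(K₁ ^ 2 + K₁ * τ * K ^ 2 + K + 1) - l * (K₁ * τ * K) - l * (l / K) ≤
      1 / 2 * p ^ 2 - K₁ * |e| - e ^ 2 / β + K₁ * |x| := by
    have h3 : (l ^ 2 + K ^ 2) / K = l * (l / K) + K := by field_simp
    nlinarith
  have h4 := mul_le_mul_of_nonneg_left h2 (inv_pos.2 hl).le
  have h5 : l⁻¹ * (-(K₁ ^ 2 + K₁ * τ * K ^ 2 + K + 1) - l * (K₁ * τ * K) - l * (l / K)) =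
      -(K₁ ^ 2 + K₁ * τ * K ^ 2 + K + 1) * l⁻¹ - K₁ * τ * K - l / K := by
    field_simp
  linarith

namespace SolutionAt

variable {A : Jet n → Matrix (Fin n) (Fin n) ℝ} {G : Jet n → ℝ}
    {u : EuclideanSpace ℝ (Fin n) → ℝ}
    {x₀ : EuclideanSpace ℝ (Fin n)} {b : OrthonormalBasis (Fin n) ℝ (EuclideanSpace ℝ (Fin n))}
    {lam : Fin n → ℝ} {m : ℝ} (h : SolutionAt A G u x₀ b lam m)

include h

/-- The maximum principle for the test function
`log w_{oo} + τ|Du|²/2 + β log ζ + χ`, where `ζ` is a cutoff and `χ` a barrier. -/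
theorem lam_le_of_isLocalMax {ζ χ : EuclideanSpace ℝ (Fin n) → ℝ} {o : Fin n}
    {a τ β Λ K₁ K₂ K₃ K₄ L : ℝ}
    (hmax : ∀ i, lam i ≤ lam o) (hone : 1 ≤ lam o)
    (hζ : ContDiffAt ℝ 2 ζ x₀) (hχ : ContDiffAt ℝ 2 χ x₀) (hζ0 : 0 < ζ x₀)
    (hζop : -K₃ - a * ζ x₀ * (∑ i, (lam i)⁻¹) - K₁ * ∑ i, (lam i)⁻¹ * |dir (b i) ζ x₀| ≤
      frameOp A G u x₀ b lam ζ)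
    (hχop : Λ * (∑ i, (lam i)⁻¹) + K₁ * ∑ i, (lam i)⁻¹ * |dir (b i) χ x₀| - K₂ ≤
      frameOp A G u x₀ b lam χ)
    (hζgrad : ∀ i, |dir (b i) ζ x₀| ≤ K₄) (hχgrad : ∀ i, |dir (b i) χ x₀| ≤ L)
    (hK₁ : 0 ≤ K₁) (hτ : τ = 2 * (38 * (n * m + 1) ^ 4 + 2))
    (hΛ : 38 * (n * m + 1) ^ 4 + 2 * τ * (n * m + 1) ^ 3 + β * a +
      (K₁ ^ 2 + K₁ * τ * (n * m + 1) ^ 2 + (n * m + 1) + 1) ≤ Λ)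
    (hβ12 : 12 ≤ β) (hβL : 3 * L ^ 2 ≤ β) (hβτ : 6 * τ ^ 2 * (n * m + 1) ^ 3 ≤ β)
    (hloc : IsLocalMax (fun y => (Real.log (augForm A u (b o) (b o) y) +
      τ * (‖gradient u y‖ ^ 2 / 2)) + (β * Real.log (ζ y) + χ y)) x₀) :
    lam o ≤ (2 * τ * (n * m + 1) ^ 3 + K₂ + K₁ * τ * (n * m + 1) ^ 2) + β * K₃ / ζ x₀ +
      (lam o)⁻¹ * (β * (K₁ * K₄ / ζ x₀ + K₄ ^ 2 / ζ x₀ ^ 2)) := by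
  obtain ⟨hmK, hnK, hmN⟩ := h.le_card_mul_add_one o
  have hm := h.one_le
  have hT := h.trace_nonneg
  have hlog := h.frameOp_log_augForm_ge hmax hone
  have hsqop := h.frameOp_gradient_sq_ge o
  have hγ : ∀ i, |dir (b i) (fun y => ‖gradient u y‖ ^ 2 / 2) x₀| ≤
      (n * m + 1) * (lam i + (n * m + 1)) := by
    intro i
    have := h.lam_pos i
    exact (h.abs_dir_gradient_sq_le i).trans (by gcongr; linarith)
  set K := n * m + 1 with hK
  set T := ∑ i, (lam i)⁻¹ with hTdef
  have hK1 : 1 ≤ K := by nlinarith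
  have hl := h.lam_pos o
  have hτ0 : 0 ≤ τ := by rw [hτ]; positivity
  have hβ : 0 < β := by linarith
  have hval : augForm A u (b o) (b o) x₀ = lam o := by rw [h.frame, if_pos rfl]
  have hω := h.smooth_augForm (b o) (b o)
  have hω0 : augForm A u (b o) (b o) x₀ ≠ 0 := by rw [hval]; exact hl.ne'
  -- smoothness of the summands of the test function
  have s1 : ContDiffAt ℝ 2 (fun y => Real.log (augForm A u (b o) (b o) y)) x₀ := hω.log hω0
  have s2 : ContDiffAt ℝ 2 (fun y => ‖gradient u y‖ ^ 2 / 2) x₀ :=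
    (ContDiffAt.norm_sq ℝ (contDiffAt_gradient h.smooth (k := 2) (by norm_num))).div_const _
  have s3 : ContDiffAt ℝ 2 (fun y => Real.log (ζ y)) x₀ := hζ.log hζ0.ne'
  have s2' : ContDiffAt ℝ 2 (fun y => τ * (‖gradient u y‖ ^ 2 / 2)) x₀ := contDiffAt_const.mul s2
  have s3' : ContDiffAt ℝ 2 (fun y => β * Real.log (ζ y)) x₀ := contDiffAt_const.mul s3
  have hd : ∀ {f : EuclideanSpace ℝ (Fin n) → ℝ}, ContDiffAt ℝ 2 f x₀ → DifferentiableAt ℝ f x₀ :=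
    fun hf => hf.differentiableAt (by norm_num)
  -- first order condition
  have hfirst : ∀ i, dir (b i) (augForm A u (b o) (b o)) x₀ / lam o +
      τ * dir (b i) (fun y => ‖gradient u y‖ ^ 2 / 2) x₀ +
      β * (dir (b i) ζ x₀ / ζ x₀) + dir (b i) χ x₀ = 0 := by
    intro i
    have h1 := dir_eq_zero_of_isLocalMax hloc (b i)
    rw [dir_add (hd (s1.add s2')) (hd (s3'.add hχ)), dir_add (hd s1) (hd s2'),
      dir_add (hd s3') (hd hχ), dir_const_mul (hd s2), dir_const_mul (hd s3),
      dir_log (hd hω) hω0, dir_log (hd hζ) hζ0.ne', hval] at h1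
    linarith
  -- second order condition
  have hsecond := frameOp_nonpos_of_isLocalMax (A := A) (G := G) (u := u) (b := b)
    ((s1.add s2').add (s3'.add hχ)) hloc h.lam_pos
  rw [frameOp_add (s1.add s2') (s3'.add hχ), frameOp_add s1 s2', frameOp_add s3' hχ,
    frameOp_const_mul s2, frameOp_const_mul s3, frameOp_log hζ hζ0.ne'] at hsecond
  set z := ζ x₀ with hz
  set p : Fin n → ℝ := fun i => dir (b i) (augForm A u (b o) (b o)) x₀ / lam o with hp
  set e : Fin n → ℝ := fun i => β * (dir (b i) ζ x₀ / z) with he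
  set x : Fin n → ℝ := fun i => dir (b i) χ x₀ with hx
  have hterm : ∀ i, -(K₁ ^ 2 + K₁ * τ * K ^ 2 + K + 1) * (lam i)⁻¹ - K₁ * τ * K - lam i / K -
      (if i = o then (lam o)⁻¹ * (β * (K₁ * K₄ / z + K₄ ^ 2 / z ^ 2)) else 0) ≤
      1 / 2 * (if i = o then 0 else (lam i)⁻¹ * p i ^ 2) - K₁ * ((lam i)⁻¹ * |e i|) -
        (lam i)⁻¹ * (e i ^ 2 / β) + K₁ * ((lam i)⁻¹ * |x i|) := by
    intro i
    have hip := inv_pos.2 (h.lam_pos i)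
    by_cases hio : i = o
    · subst hio
      simp only [if_true]
      have h1 : |e i| ≤ β * (K₄ / z) := by
        simp only [he]
        rw [abs_mul, abs_of_pos hβ, abs_div, abs_of_pos hζ0]
        have := hζgrad i
        gcongr
      have h2 : e i ^ 2 / β ≤ β * (K₄ ^ 2 / z ^ 2) := by
        rw [div_le_iff₀ hβ]
        have := sq_le_sq' (abs_le.1 h1).1 (abs_le.1 h1).2
        calc e i ^ 2 ≤ (β * (K₄ / z)) ^ 2 := this
          _ = _ := by ring
      have h3 : K₁ * |e i| + e i ^ 2 / β ≤ β * (K₁ * K₄ / z + K₄ ^ 2 / z ^ 2) := by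
        have := mul_le_mul_of_nonneg_left h1 hK₁
        have h4 : K₁ * (β * (K₄ / z)) = β * (K₁ * K₄ / z) := by ring
        nlinarith
      have h4 := mul_le_mul_of_nonneg_left h3 hip.le
      have h5 : 0 ≤ K₁ * ((lam i)⁻¹ * |x i|) := by positivity
      have h6 : 0 ≤ (K₁ ^ 2 + K₁ * τ * K ^ 2 + K + 1) * (lam i)⁻¹ := by positivity
      have h7 : 0 ≤ K₁ * τ * K := by positivity
      have h8 : 0 ≤ lam i / K := by positivity
      linarith
    · simp only [hio, if_false]
      have h1 := direction_term_ge (hfirst i) (hγ i) (hχgrad i) hK1 hK₁ hτ0 (h.lam_pos i) hβ12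
        hβL hβτ
      rw [sub_zero]
      refine h1.trans (le_of_eq ?_)
      simp only [hp, he, hx]
      ring
  have htot := Finset.sum_le_sum fun i (_ : i ∈ Finset.univ) => hterm i
  simp only [Finset.sum_sub_distrib, Finset.sum_add_distrib, ← Finset.mul_sum, Finset.sum_const,
    Finset.card_univ, Fintype.card_fin, nsmul_eq_mul, Finset.sum_ite_eq', Finset.mem_univ, if_true]
    at htot
  rw [← hTdef] at htot
  have hlamsum : ∑ i, lam i / K ≤ lam o := by
    calc ∑ i, lam i / K ≤ ∑ _i : Fin n, lam o / K := by
          refine Finset.sum_le_sum fun i _ => ?_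
          have := hmax i
          gcongr
      _ = n * (lam o / K) := by simp
      _ ≤ K * (lam o / K) := by gcongr
      _ = lam o := by field_simp
  -- rewrite the contribution of the cutoff in terms of `e`
  have hesum : ∑ i, (lam i)⁻¹ * |e i| = β / z * ∑ i, (lam i)⁻¹ * |dir (b i) ζ x₀| := by
    rw [Finset.mul_sum]
    refine Finset.sum_congr rfl fun i _ => ?_
    simp only [he]
    rw [abs_mul, abs_of_pos hβ, abs_div, abs_of_pos hζ0]
    ring
  have hesq : ∑ i, (lam i)⁻¹ * (e i ^ 2 / β) =
      β * ∑ i, (lam i)⁻¹ * (dir (b i) ζ x₀ / z) ^ 2 := by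
    rw [Finset.mul_sum]
    refine Finset.sum_congr rfl fun i _ => ?_
    simp only [he]
    field_simp
  rw [hesum, hesq] at htot
  have hcut := mul_le_mul_of_nonneg_left hζop (by positivity : 0 ≤ β / z)
  have hcut' : β / z * (-K₃ - a * z * T - K₁ * ∑ i, (lam i)⁻¹ * |dir (b i) ζ x₀|) =
      -(β * K₃ / z) - β * a * T - K₁ * (β / z * ∑ i, (lam i)⁻¹ * |dir (b i) ζ x₀|) := by
    field_simp
  have hcut'' : β * (frameOp A G u x₀ b lam ζ / z) = β / z * frameOp A G u x₀ b lam ζ := by ring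
  rw [hcut'] at hcut
  rw [mul_sub, hcut''] at hsecond
  have hsqop' := mul_le_mul_of_nonneg_left hsqop hτ0
  have hΛT := mul_le_mul_of_nonneg_right hΛ hT
  have hnτ : n * (K₁ * τ * K) ≤ K₁ * τ * K ^ 2 := by
    calc n * (K₁ * τ * K) ≤ K * (K₁ * τ * K) := by gcongr
      _ = _ := by ring
  have hτl : τ * (lam o / 2) = (38 * K ^ 4 + 2) * lam o := by rw [hτ]; ring
  simp only [hp, hx] at htot
  linarith

end SolutionAt

end MaximumPoint

/-! ### The global setting -/

section Global

variable {n : ℕ}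

/-- The hypotheses on the data, the domain, the solution and the degenerate elliptic function `u₀`
that enter the estimate; `m` bounds the data on `U₀` and the points of `U₀` themselves. -/
structure PogorelovSetting (U U₀ : Set (Jet n)) (M : ℝ≥0) (m : ℝ)
    (A : Jet n → Matrix (Fin n) (Fin n) ℝ) (B : Jet n → ℝ)
    (Ω : Set (EuclideanSpace ℝ (Fin n))) (u u₀ : EuclideanSpace ℝ (Fin n) → ℝ) : Prop where
  isOpen_U : IsOpen U
  subset_U : U₀ ⊆ U
  symm : ∀ q ∈ U, (A q).IsSymm
  smooth_A : ∀ i j, ContDiffOn ℝ 2 (fun q => A q i j) U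
  smooth_B : ContDiffOn ℝ 2 B U
  B_pos : ∀ q ∈ U, 0 < B q
  regular : IsRegularMatrix A U
  dataNorm_le : dataNorm A B U₀ ≤ M
  M_le : M ≤ m
  one_le : 1 ≤ m
  norm_le : ∀ q ∈ U₀, ‖q‖ ≤ m
  isOpen_Ω : IsOpen Ω
  bounded_Ω : Bornology.IsBounded Ω
  smooth_u : ContDiffOn ℝ 4 u Ω
  cont_u : ContinuousOn u (closure Ω)
  smooth_u₀ : ContDiffOn ℝ 2 u₀ Ω
  cont_u₀ : ContinuousOn u₀ (closure Ω)
  jet_u : ∀ x ∈ Ω, oneJet u x ∈ U₀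
  jet_u₀ : ∀ x ∈ Ω, oneJet u₀ x ∈ U₀
  seg_z : ∀ x ∈ Ω, ∀ z ∈ Set.Icc (u x) (u₀ x), (x, z, gradient u₀ x) ∈ U₀
  seg_p : ∀ x ∈ Ω, ∀ p ∈ segment ℝ (gradient u x) (gradient u₀ x), (x, u x, p) ∈ U₀
  elliptic : IsEllipticSolution A B Ω u
  psd : ∀ x ∈ Ω, (augHessian A u₀ x).PosSemidef
  boundary : ∀ x ∈ frontier Ω, u x = u₀ x
  lt : ∀ x ∈ Ω, u x < u₀ x

theorem exists_eigenframe {W : Matrix (Fin n) (Fin n) ℝ} (hW : W.PosDef) :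
    ∃ (b : OrthonormalBasis (Fin n) ℝ (EuclideanSpace ℝ (Fin n))) (lam : Fin n → ℝ),
      (∀ i, 0 < lam i) ∧
        ∀ i j, ∑ k, ∑ l, W k l * (b i k * b j l) = if i = j then lam i else 0 := by
  refine ⟨hW.isHermitian.eigenvectorBasis, hW.isHermitian.eigenvalues,
    fun i => hW.eigenvalues_pos i, fun i j => ?_⟩
  set b := hW.isHermitian.eigenvectorBasis with hb
  have h1 := hW.isHermitian.mulVec_eigenvectorBasis j
  rw [← hb] at h1
  have h2 : ∀ k, ∑ l, W k l * (b i k * b j l) =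
      hW.isHermitian.eigenvalues j * (b i k * b j k) := by
    intro k
    have h3 := congrFun h1 k
    simp only [Matrix.mulVec, dotProduct, Pi.smul_apply, smul_eq_mul] at h3
    rw [mul_left_comm, ← h3, Finset.mul_sum]
    exact Finset.sum_congr rfl fun l _ => by ring
  simp only [h2, ← Finset.mul_sum]
  have h4 := orthonormal_iff_ite.1 b.orthonormal i j
  rw [PiLp.inner_apply] at h4
  have h5 : ∑ k, b i k * b j k = if i = j then 1 else 0 := by
    rw [← h4]
    exact Finset.sum_congr rfl fun k _ => by simp [mul_comm]
  rw [h5]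
  split_ifs with hij
  · rw [hij, mul_one]
  · rw [mul_zero]

theorem quadratic_nonneg_of_posSemidef {W : Matrix (Fin n) (Fin n) ℝ} (hW : W.PosSemidef)
    (ξ : EuclideanSpace ℝ (Fin n)) : 0 ≤ ∑ k, ∑ l, W k l * (ξ k * ξ l) := by
  have h := hW.dotProduct_mulVec_nonneg (fun i => ξ i)
  simp only [dotProduct, Matrix.mulVec, Pi.star_apply, star_trivial, Finset.mul_sum] at h
  refine h.trans (le_of_eq (Finset.sum_congr rfl fun k _ => Finset.sum_congr rfl fun l _ => ?_))
  ring

theorem quadratic_pos_of_posDef {W : Matrix (Fin n) (Fin n) ℝ} (hW : W.PosDef)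
    {ξ : EuclideanSpace ℝ (Fin n)} (hξ : ξ ≠ 0) : 0 < ∑ k, ∑ l, W k l * (ξ k * ξ l) := by
  have h := hW.dotProduct_mulVec_pos (x := fun i => ξ i) (fun h0 => hξ (by
    ext i; exact congrFun h0 i))
  simp only [dotProduct, Matrix.mulVec, Pi.star_apply, star_trivial, Finset.mul_sum] at h
  refine h.trans_le (le_of_eq (Finset.sum_congr rfl fun k _ => Finset.sum_congr rfl fun l _ => ?_))
  ring

/-- In an orthonormal frame that diagonalizes `W` the largest eigenvalue bounds the quadratic form
of `W` on unit vectors. -/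
theorem quadratic_le_of_frame {W : Matrix (Fin n) (Fin n) ℝ}
    (b : OrthonormalBasis (Fin n) ℝ (EuclideanSpace ℝ (Fin n))) {lam : Fin n → ℝ} {o : Fin n}
    (hW : ∀ i j, ∑ k, ∑ l, W k l * (b i k * b j l) = if i = j then lam i else 0)
    (hmax : ∀ i, lam i ≤ lam o) {ξ : EuclideanSpace ℝ (Fin n)} (hξ : ‖ξ‖ = 1) :
    ∑ k, ∑ l, W k l * (ξ k * ξ l) ≤ lam o := by
  set c : Fin n → ℝ := fun i => inner ℝ (b i) ξ with hc
  have hcoord : ∀ k, ξ k = ∑ i, c i * b i k := by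
    intro k
    conv_lhs => rw [← b.sum_repr' ξ]
    simp [hc]
  have h1 : ∑ k, ∑ l, W k l * (ξ k * ξ l) =
      ∑ i, ∑ j, c i * c j * ∑ k, ∑ l, W k l * (b i k * b j l) := by
    have h0 : ∀ k l, W k l * (ξ k * ξ l) =
        ∑ i, ∑ j, W k l * (c i * b i k * (c j * b j l)) := by
      intro k l
      rw [hcoord k, hcoord l, Finset.sum_mul_sum, Finset.mul_sum]
      exact Finset.sum_congr rfl fun i _ => Finset.mul_sum _ _ _
    simp only [h0, Finset.mul_sum]
    calc ∑ k, ∑ l, ∑ i, ∑ j, W k l * (c i * b i k * (c j * b j l))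
        = ∑ k, ∑ i, ∑ l, ∑ j, W k l * (c i * b i k * (c j * b j l)) :=
          Finset.sum_congr rfl fun k _ => Finset.sum_comm
      _ = ∑ k, ∑ i, ∑ j, ∑ l, W k l * (c i * b i k * (c j * b j l)) :=
          Finset.sum_congr rfl fun k _ => Finset.sum_congr rfl fun i _ => Finset.sum_comm
      _ = ∑ i, ∑ k, ∑ j, ∑ l, W k l * (c i * b i k * (c j * b j l)) := Finset.sum_comm
      _ = ∑ i, ∑ j, ∑ k, ∑ l, W k l * (c i * b i k * (c j * b j l)) :=
          Finset.sum_congr rfl fun i _ => Finset.sum_comm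
      _ = _ := by
          refine Finset.sum_congr rfl fun i _ => Finset.sum_congr rfl fun j _ =>
            Finset.sum_congr rfl fun k _ => Finset.sum_congr rfl fun l _ => ?_
          ring
  rw [h1]
  simp only [hW, mul_ite, mul_zero, Finset.sum_ite_eq, Finset.mem_univ, if_true]
  have h2 : ∑ i, c i * c i = 1 := by
    have := b.sum_sq_norm_inner_right ξ
    rw [hξ] at this
    simp only [Real.norm_eq_abs, sq_abs] at this
    simp only [← sq, hc, this]; norm_num
  calc ∑ i, c i * c i * lam i ≤ ∑ i, c i * c i * lam o :=
        Finset.sum_le_sum fun i _ => mul_le_mul_of_nonneg_left (hmax i) (mul_self_nonneg _)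
    _ = lam o := by rw [← Finset.sum_mul, h2, one_mul]

namespace PogorelovSetting

variable {U U₀ : Set (Jet n)} {M : ℝ≥0} {m : ℝ}
    {A : Jet n → Matrix (Fin n) (Fin n) ℝ} {B : Jet n → ℝ}
    {Ω : Set (EuclideanSpace ℝ (Fin n))} {u u₀ : EuclideanSpace ℝ (Fin n) → ℝ}
    (S : PogorelovSetting U U₀ M m A B Ω u u₀)

include S

theorem contDiffAt_u {x : EuclideanSpace ℝ (Fin n)} (hx : x ∈ Ω) : ContDiffAt ℝ 4 u x :=
  S.smooth_u.contDiffAt (S.isOpen_Ω.mem_nhds hx)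

theorem contDiffAt_u₀ {x : EuclideanSpace ℝ (Fin n)} (hx : x ∈ Ω) : ContDiffAt ℝ 2 u₀ x :=
  S.smooth_u₀.contDiffAt (S.isOpen_Ω.mem_nhds hx)

theorem contDiffAt_A {q : Jet n} (hq : q ∈ U₀) (i j : Fin n) :
    ContDiffAt ℝ 2 (fun q => A q i j) q :=
  (S.smooth_A i j).contDiffAt (S.isOpen_U.mem_nhds (S.subset_U hq))

theorem norm_gradient_le {x : EuclideanSpace ℝ (Fin n)} (hx : x ∈ Ω) : ‖gradient u x‖ ≤ m :=
  (norm_prod_le_iff.1 (norm_prod_le_iff.1 (S.norm_le _ (S.jet_u x hx))).2).2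

theorem norm_gradient₀_le {x : EuclideanSpace ℝ (Fin n)} (hx : x ∈ Ω) : ‖gradient u₀ x‖ ≤ m :=
  (norm_prod_le_iff.1 (norm_prod_le_iff.1 (S.norm_le _ (S.jet_u₀ x hx))).2).2

theorem sub_le {x : EuclideanSpace ℝ (Fin n)} (hx : x ∈ Ω) : u₀ x - u x ≤ 2 * m := by
  have h1 := (norm_prod_le_iff.1 (norm_prod_le_iff.1 (S.norm_le _ (S.jet_u₀ x hx))).2).1
  have h2 := (norm_prod_le_iff.1 (norm_prod_le_iff.1 (S.norm_le _ (S.jet_u x hx))).2).1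
  have h3 := (abs_le.1 h1).2
  have h4 := (abs_le.1 h2).1
  simp only [oneJet] at h3 h4
  linarith

/-- The local hypotheses hold at every point of the domain, in every orthonormal frame that
diagonalizes the augmented Hessian. -/
theorem solutionAt {x₀ : EuclideanSpace ℝ (Fin n)} (hx : x₀ ∈ Ω)
    {b : OrthonormalBasis (Fin n) ℝ (EuclideanSpace ℝ (Fin n))} {lam : Fin n → ℝ}
    (hpos : ∀ i, 0 < lam i)
    (hframe : ∀ i j, ∑ k, ∑ l, augHessian A u x₀ k l * (b i k * b j l) =
      if i = j then lam i else 0) :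
    SolutionAt A (fun q => Real.log (B q)) u x₀ b lam m := by
  have hq := S.jet_u x₀ hx
  have hnhds : ∀ᶠ x in 𝓝 x₀, x ∈ Ω := S.isOpen_Ω.mem_nhds hx
  have hb : ∀ i j, _ := fun i j => form_bounds S.dataNorm_le hq (S.contDiffAt_A hq)
    (b.orthonormal.1 i) (b.orthonormal.1 j)
  obtain ⟨-, hG, -, hGM⟩ := cNorm_entry_ne_top S.dataNorm_le
  have hGb := bounds_of_cNorm_two hG hq
  refine ⟨S.contDiffAt_u hx, S.contDiffAt_A hq, ?_, ?_, ?_, ?_, hpos, S.one_le,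
    S.norm_gradient_le hx, fun i j => (hb i j).1.trans S.M_le,
    fun i j => (hb i j).2.1.trans S.M_le, fun i j => (hb i j).2.2.trans S.M_le,
    (hGb.2.1.trans hGM).trans S.M_le, (hGb.2.2.trans hGM).trans S.M_le, ?_⟩
  · exact (S.smooth_B.contDiffAt (S.isOpen_U.mem_nhds (S.subset_U hq))).log
      (S.B_pos _ (S.subset_U hq)).ne'
  · filter_upwards [hnhds] with x hx'
    exact S.symm _ (S.subset_U (S.jet_u x hx'))
  · filter_upwards [hnhds] with x hx'
    rw [(S.elliptic x hx').2]
  · intro i j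
    rw [augForm_eq_sum ((S.contDiffAt_u hx).of_le (by norm_num)), hframe]
  · intro i j hij
    refine S.regular.fderiv_fderiv_nonneg (S.subset_U hq) (S.contDiffAt_A hq) ?_
    rw [orthonormal_iff_ite.1 b.orthonormal i j, if_neg hij]

/-- The estimate for `u₀ - u` at a point of the domain, from the lower bound `-a` for the
derivative of `A` in `z` and the regularity of `A`. -/
theorem frameOp_sub_ge {a : ℝ}
    (ha : ∀ q ∈ U₀, ∀ ξ : EuclideanSpace ℝ (Fin n), ‖ξ‖ = 1 →
      -a ≤ fderiv ℝ (form A ξ ξ) q (0, 1, 0))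
    {x₀ : EuclideanSpace ℝ (Fin n)} (hx : x₀ ∈ Ω)
    {b : OrthonormalBasis (Fin n) ℝ (EuclideanSpace ℝ (Fin n))} {lam : Fin n → ℝ}
    (h : SolutionAt A (fun q => Real.log (B q)) u x₀ b lam m) :
    -(n + 2 * m ^ 2) - a * (u₀ x₀ - u x₀) * (∑ i, (lam i)⁻¹) -
        4 * m ^ 2 * ∑ i, (lam i)⁻¹ * |dir (b i) (fun x => u₀ x - u x) x₀| ≤
      frameOp A (fun q => Real.log (B q)) u x₀ b lam (fun x => u₀ x - u x) := by
  have hη := S.lt x₀ hx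
  have hm := S.one_le
  have h20 := S.contDiffAt_u₀ hx
  refine h.frameOp_sub_ge h20 (fun i => ?_) (S.norm_gradient₀_le hx) (fun i => ?_) (fun i => ?_)
  · rw [augForm_eq_sum h20]
    exact quadratic_nonneg_of_posSemidef (S.psd x₀ hx) _
  · have hseg : ∀ t ∈ Set.Icc (0 : ℝ) 1,
        ((x₀, u x₀, gradient u₀ x₀) : Jet n) + t • ((0, u₀ x₀ - u x₀, 0) : Jet n) ∈ U₀ := by
      intro t ht
      have := S.seg_z x₀ hx (u x₀ + t * (u₀ x₀ - u x₀))
        ⟨by nlinarith [ht.1], by nlinarith [ht.2]⟩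
      simpa using this
    have h1 := mean_value_lower_bound (F := form A (b i) (b i)) (μ := a * (u₀ x₀ - u x₀))
      (fun t ht => (contDiffAt_form (S.contDiffAt_A (hseg t ht)) _ _).differentiableAt
        (by norm_num)) (fun t ht => by
        have h2 := ha _ (hseg t ht) (b i) (b.orthonormal.1 i)
        have h3 : ((0, u₀ x₀ - u x₀, 0) : Jet n) = (u₀ x₀ - u x₀) • ((0, 1, 0) : Jet n) := by
          simp
        conv_rhs => rw [h3, map_smul, smul_eq_mul]
        rw [← h3]
        nlinarith)
    simpa [oneJet] using h1
  · set ζ := gradient u₀ x₀ - gradient u x₀ with hζ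
    have hζn : ‖ζ‖ ≤ 2 * m :=
      (norm_sub_le _ _).trans (by linarith [S.norm_gradient_le hx, S.norm_gradient₀_le hx])
    have hseg : ∀ t ∈ Set.Icc (0 : ℝ) 1,
        oneJet u x₀ + t • ((0, 0, ζ) : Jet n) ∈ U₀ := by
      intro t ht
      have := S.seg_p x₀ hx (gradient u x₀ + t • ζ) (by
        rw [segment_eq_image']
        exact ⟨t, ht, rfl⟩)
      simpa [oneJet] using this
    have h1 := taylor_lower_bound (F := form A (b i) (b i)) (q := oneJet u x₀) (d := (0, 0, ζ))
      (μ := 4 * m ^ 2 * |inner ℝ (b i) ζ|)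
      (fun t ht => contDiffAt_form (S.contDiffAt_A (hseg t ht)) _ _) (fun t ht => by
        have hb := (form_bounds S.dataNorm_le (hseg t ht) (S.contDiffAt_A (hseg t ht))
          (b.orthonormal.1 i) (b.orthonormal.1 i)).2.2.trans S.M_le
        have h2 := quadratic_lower_bound hb (b.orthonormal.1 i) (fun η hη =>
          S.regular.fderiv_fderiv_nonneg (S.subset_U (hseg t ht)) (S.contDiffAt_A (hseg t ht)) hη) ζ
        refine le_trans ?_ h2
        have h3 : 3 * m * |inner ℝ (b i) ζ| * ‖ζ‖ ≤ 3 * m * |inner ℝ (b i) ζ| * (2 * m) := by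
          gcongr
        nlinarith [mul_nonneg (sq_nonneg m) (abs_nonneg (inner ℝ (b i) ζ))])
    simpa [oneJet, hζ] using h1

theorem isCompact_superlevel {ε : ℝ} (hε : 0 < ε) :
    IsCompact {x | x ∈ closure Ω ∧ ε ≤ u₀ x - u x} ∧
      {x | x ∈ closure Ω ∧ ε ≤ u₀ x - u x} ⊆ Ω := by
  constructor
  · have h1 : IsCompact (closure Ω) := S.bounded_Ω.isCompact_closure
    have h2 : IsClosed (closure Ω ∩ (fun x => u₀ x - u x) ⁻¹' Set.Ici ε) :=
      (S.cont_u₀.sub S.cont_u).preimage_isClosed_of_isClosed isClosed_closure isClosed_Ici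
    exact h1.of_isClosed_subset h2 Set.inter_subset_left
  · rintro x ⟨hx, hxε⟩
    by_contra hxΩ
    have := S.boundary x (by rw [S.isOpen_Ω.frontier_eq]; exact ⟨hx, hxΩ⟩)
    linarith

theorem continuousOn_augHessian (i j : Fin n) :
    ContinuousOn (fun x => augHessian A u x i j) Ω := by
  intro x hx
  have h1 : ContinuousAt (fun x => hessian u x i j) x :=
    (contDiffAt_dir (contDiffAt_dir (S.contDiffAt_u hx) (k := 3) (by norm_num) _) (k := 2)
      (by norm_num) _).continuousAt
  have h2 : ContinuousAt (fun x => A (oneJet u x) i j) x :=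
    ((S.contDiffAt_A (S.jet_u x hx) i j).continuousAt).comp
      (contDiffAt_oneJet (S.contDiffAt_u hx) (k := 3) (by norm_num)).continuousAt
  exact (h1.sub h2).continuousWithinAt

end PogorelovSetting

end Global

/-! ### The estimate in terms of a barrier -/

section Estimate

variable {n : ℕ}

/-- The inequality at the maximum point, solved for the product of the eigenvalue and the
cutoff. -/
theorem mul_le_of_le_add_div {l z Z c₁ c₂ β P Q : ℝ} (hl : 1 ≤ l) (hz : 0 < z) (hzZ : z ≤ Z)
    (hc₁ : 0 ≤ c₁) (hc₂ : 0 ≤ c₂) (hβ : 0 ≤ β) (hP : 0 ≤ P) (hQ : 0 ≤ Q)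
    (h : l ≤ c₁ + c₂ / z + l⁻¹ * (β * (P / z + Q / z ^ 2))) :
    l * z ≤ c₁ * Z + c₂ + β * (P * Z + Q) + 1 := by
  have hl0 : 0 < l := by linarith
  have hZ : 0 ≤ Z := hz.le.trans hzZ
  have h1 : 0 ≤ c₁ * Z := mul_nonneg hc₁ hZ
  have h2 : 0 ≤ β * (P * Z + Q) := by positivity
  by_cases hs : l * z ≤ 1
  · linarith
  · push Not at hs
    have h3 := mul_le_mul_of_nonneg_right h hz.le
    have h4 : (c₁ + c₂ / z + l⁻¹ * (β * (P / z + Q / z ^ 2))) * z =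
        c₁ * z + c₂ + β * (P * z + Q) / (l * z) := by field_simp
    rw [h4] at h3
    have h5 : β * (P * z + Q) / (l * z) ≤ β * (P * Z + Q) := by
      refine (div_le_self (by positivity) hs.le).trans ?_
      gcongr
    have h6 : c₁ * z ≤ c₁ * Z := by gcongr
    linarith

theorem exists_forall_le_of_isCompact {E : Type*} [NormedAddCommGroup E] [NormedSpace ℝ E]
    [ProperSpace E] {K Ω : Set E} (hK : IsCompact K) (hKΩ : K ⊆ Ω) {T : E → E → ℝ}
    (hT : ContinuousOn (fun p : E × E => T p.1 p.2) (Ω ×ˢ Metric.sphere 0 1)) {x ξ : E}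
    (hx : x ∈ K) (hξ : ‖ξ‖ = 1) :
    ∃ x₀ ∈ K, ∃ ξ₀ : E, ‖ξ₀‖ = 1 ∧ ∀ y ∈ K, ∀ η : E, ‖η‖ = 1 → T y η ≤ T x₀ ξ₀ := by
  obtain ⟨⟨x₀, ξ₀⟩, ⟨hx₀K, hξ₀⟩, hmax⟩ := (hK.prod (isCompact_sphere (0 : E) 1)).exists_isMaxOn
    ⟨(x, ξ), hx, by simpa using hξ⟩ (hT.mono (Set.prod_mono hKΩ le_rfl))
  exact ⟨x₀, hx₀K, ξ₀, by simpa using hξ₀, fun y hy η hη =>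
    hmax (show (y, η) ∈ K ×ˢ Metric.sphere (0 : E) 1 from ⟨hy, by simpa using hη⟩)⟩

/-- The bound for the quadratic form of the augmented Hessian, multiplied by the power `β` of
`u₀ - u`. Here `m` bounds the data, `τ` is the coefficient of `|Du|² / 2` in the test function, and
the barrier has the bounds `X` for its values and `L` for its gradient, and the error `K₂` in its
differential inequality. -/
noncomputable def pogorelovBound (n : ℕ) (m τ β K₂ L X : ℝ) : ℝ :=
  2 ^ β * (((2 * τ * (n * m + 1) ^ 3 + K₂ + 4 * m ^ 2 * τ * (n * m + 1) ^ 2) * (2 * m) +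
    β * (n + 2 * m ^ 2 + K₂) +
    β * (4 * m ^ 2 * (2 * m + L) * (2 * m) + (2 * m + L) ^ 2) + 1) *
    (2 * m) ^ (β - 1) * Real.exp (τ * (m ^ 2 / 2) + X))

namespace PogorelovSetting

variable {U U₀ : Set (Jet n)} {M : ℝ≥0} {m : ℝ}
    {A : Jet n → Matrix (Fin n) (Fin n) ℝ} {B : Jet n → ℝ}
    {Ω : Set (EuclideanSpace ℝ (Fin n))} {u u₀ : EuclideanSpace ℝ (Fin n) → ℝ}
    (S : PogorelovSetting U U₀ M m A B Ω u u₀)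

include S

theorem continuousOn_test {ζ χ : EuclideanSpace ℝ (Fin n) → ℝ} (hζ : ContinuousOn ζ Ω)
    (hχ : ContinuousOn χ Ω) {β τ : ℝ} (hβ : 0 ≤ β) :
    ContinuousOn (fun p : EuclideanSpace ℝ (Fin n) × EuclideanSpace ℝ (Fin n) =>
      (∑ k, ∑ l, augHessian A u p.1 k l * (p.2 k * p.2 l)) * (max (ζ p.1) 0) ^ β *
        Real.exp (τ * (‖gradient u p.1‖ ^ 2 / 2) + χ p.1)) (Ω ×ˢ Metric.sphere 0 1) := by
  have hfst : Set.MapsTo Prod.fst (Ω ×ˢ Metric.sphere (0 : EuclideanSpace ℝ (Fin n)) 1) Ω :=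
    fun p hp => hp.1
  have hg : ContinuousOn (gradient u) Ω := fun y hy =>
    (contDiffAt_gradient (S.contDiffAt_u hy) (k := 3) (by norm_num)).continuousAt.continuousWithinAt
  refine (ContinuousOn.mul (ContinuousOn.mul ?_ ?_) ?_)
  · refine continuousOn_finsetSum _ fun k _ => continuousOn_finsetSum _ fun l _ => ?_
    refine ((S.continuousOn_augHessian k l).comp continuousOn_fst hfst).mul ?_
    exact Continuous.continuousOn (by fun_prop)
  · have hmax : ContinuousOn (fun p : EuclideanSpace ℝ (Fin n) × EuclideanSpace ℝ (Fin n) =>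
        max (ζ p.1) 0) (Ω ×ˢ Metric.sphere 0 1) :=
      (hζ.comp continuousOn_fst hfst).sup continuousOn_const
    exact hmax.rpow_const fun _ _ => Or.inr hβ
  · refine ContinuousOn.rexp (ContinuousOn.add ?_ (hχ.comp continuousOn_fst hfst))
    exact continuousOn_const.mul (((hg.comp continuousOn_fst hfst).norm.pow 2).div_const 2)

set_option maxHeartbeats 1000000 in
/-- The interior estimate in terms of a barrier `χ`. The product of the quadratic form of the
augmented Hessian, a power of the cutoff `u₀ - u - ε (1 + X - χ)` and an exponential is maximized
over the domain and all unit vectors. The cutoff is positive only on a compact subset of the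
domain, so that a maximum exists although the second derivatives of `u` need not be bounded. -/
theorem rpow_mul_quadratic_le {χ : EuclideanSpace ℝ (Fin n) → ℝ} {a τ β Λ K₂ L X : ℝ}
    (ha0 : 0 ≤ a)
    (ha : ∀ q ∈ U₀, ∀ ξ : EuclideanSpace ℝ (Fin n), ‖ξ‖ = 1 →
      -a ≤ fderiv ℝ (form A ξ ξ) q (0, 1, 0))
    (hχs : ContDiffOn ℝ 2 χ Ω) (hχ0 : ∀ x ∈ Ω, 0 ≤ χ x) (hχX : ∀ x ∈ Ω, χ x ≤ X)
    (hχL : ∀ x ∈ Ω, ‖gradient χ x‖ ≤ L) (hK₂ : 0 ≤ K₂)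
    (hχop : ∀ x₀ ∈ Ω, ∀ (b : OrthonormalBasis (Fin n) ℝ (EuclideanSpace ℝ (Fin n)))
      (lam : Fin n → ℝ), SolutionAt A (fun q => Real.log (B q)) u x₀ b lam m →
      Λ * (∑ i, (lam i)⁻¹) + 4 * m ^ 2 * ∑ i, (lam i)⁻¹ * |dir (b i) χ x₀| - K₂ ≤
        frameOp A (fun q => Real.log (B q)) u x₀ b lam χ)
    (hτ : τ = 2 * (38 * (n * m + 1) ^ 4 + 2))
    (hΛ : 38 * (n * m + 1) ^ 4 + 2 * τ * (n * m + 1) ^ 3 + β * a +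
      ((4 * m ^ 2) ^ 2 + 4 * m ^ 2 * τ * (n * m + 1) ^ 2 + (n * m + 1) + 1) ≤ Λ)
    (hΛX : a * (1 + X) ≤ Λ)
    (hβ12 : 12 ≤ β) (hβL : 3 * L ^ 2 ≤ β) (hβτ : 6 * τ ^ 2 * (n * m + 1) ^ 3 ≤ β)
    {x : EuclideanSpace ℝ (Fin n)} (hx : x ∈ Ω) {ξ : EuclideanSpace ℝ (Fin n)} (hξ : ‖ξ‖ = 1) :
    (u₀ x - u x) ^ β * ∑ k, ∑ l, augHessian A u x k l * (ξ k * ξ l) ≤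
      pogorelovBound n m τ β K₂ L X := by
  unfold pogorelovBound
  have hm := S.one_le
  have hβ : 0 < β := by linarith
  have hX : 0 ≤ X := (hχ0 x hx).trans (hχX x hx)
  have hL : 0 ≤ L := (norm_nonneg _).trans (hχL x hx)
  have hτ0 : 0 ≤ τ := by rw [hτ]; positivity
  have hηx : 0 < u₀ x - u x := sub_pos.2 (S.lt x hx)
  set D : ℝ := (2 * τ * (n * m + 1) ^ 3 + K₂ + 4 * m ^ 2 * τ * (n * m + 1) ^ 2) * (2 * m) +
        β * (n + 2 * m ^ 2 + K₂) +
        β * (4 * m ^ 2 * (2 * m + L) * (2 * m) + (2 * m + L) ^ 2) + 1 with hD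
  -- `ε` is so small that the cutoff is comparable to `u₀ - u` at the given point
  obtain ⟨ε, hε, hε1, hεx⟩ : ∃ ε : ℝ, 0 < ε ∧ ε ≤ 1 ∧ ε * (1 + X) ≤ (u₀ x - u x) / 2 := by
    refine ⟨min 1 ((u₀ x - u x) / 2 / (1 + X)), by positivity, min_le_left _ _, ?_⟩
    calc min 1 ((u₀ x - u x) / 2 / (1 + X)) * (1 + X) ≤ (u₀ x - u x) / 2 / (1 + X) * (1 + X) := by
          gcongr; exact min_le_right _ _
      _ = _ := by field_simp
  set ζ : EuclideanSpace ℝ (Fin n) → ℝ := fun y => (u₀ y - u y) - ε * (1 + X - χ y) with hζ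
  have hζle : ∀ y ∈ Ω, ζ y + ε ≤ u₀ y - u y := by
    intro y hy
    have := mul_nonneg hε.le (sub_nonneg.2 (hχX y hy))
    simp only [hζ]; nlinarith
  have hζx : (u₀ x - u x) / 2 ≤ ζ x := by
    have := mul_nonneg hε.le (hχ0 x hx)
    simp only [hζ]; nlinarith
  set Q : EuclideanSpace ℝ (Fin n) → EuclideanSpace ℝ (Fin n) → ℝ :=
    fun y η => ∑ k, ∑ l, augHessian A u y k l * (η k * η l) with hQ
  set T : EuclideanSpace ℝ (Fin n) → EuclideanSpace ℝ (Fin n) → ℝ := fun y η =>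
    Q y η * (max (ζ y) 0) ^ β * Real.exp (τ * (‖gradient u y‖ ^ 2 / 2) + χ y) with hT
  have hQpos : ∀ y ∈ Ω, ∀ η : EuclideanSpace ℝ (Fin n), ‖η‖ = 1 → 0 < Q y η := by
    intro y hy η hη
    refine quadratic_pos_of_posDef (S.elliptic y hy).1 fun h0 => ?_
    rw [h0, norm_zero] at hη
    exact zero_ne_one hη
  -- existence of a maximum
  obtain ⟨hcompact, hsub⟩ := S.isCompact_superlevel hε
  set 𝒦 := {y | y ∈ closure Ω ∧ ε ≤ u₀ y - u y} with h𝒦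
  have hmem : ∀ y ∈ Ω, 0 < ζ y → y ∈ 𝒦 := fun y hy hy0 =>
    ⟨subset_closure hy, by linarith [hζle y hy]⟩
  have hcζ : ContinuousOn ζ Ω := fun y hy =>
    (((S.contDiffAt_u₀ hy).continuousAt.sub (S.contDiffAt_u hy).continuousAt).sub
      (continuousAt_const.mul (continuousAt_const.sub
        (hχs.contDiffAt (S.isOpen_Ω.mem_nhds hy)).continuousAt))).continuousWithinAt
  have hcT : ContinuousOn (fun p : EuclideanSpace ℝ (Fin n) × EuclideanSpace ℝ (Fin n) =>
      T p.1 p.2) (Ω ×ˢ Metric.sphere 0 1) :=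
    S.continuousOn_test hcζ hχs.continuousOn hβ.le
  obtain ⟨x₀, hx₀K, ξ₀, hξ₀', hTle⟩ :=
    exists_forall_le_of_isCompact hcompact hsub hcT (hmem x hx (by linarith)) hξ
  have hx₀ : x₀ ∈ Ω := hsub hx₀K
  have hTx : 0 < T x ξ := by
    have h1 : 0 < max (ζ x) 0 := lt_max_of_lt_left (by linarith)
    exact mul_pos (mul_pos (hQpos x hx ξ hξ) (Real.rpow_pos_of_pos h1 _)) (Real.exp_pos _)
  have hζ₀ : 0 < ζ x₀ := by
    by_contra hneg
    push Not at hneg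
    have h1 : T x₀ ξ₀ = 0 := by
      simp only [hT, max_eq_right hneg, Real.zero_rpow hβ.ne', mul_zero, zero_mul]
    have h2 := hTle x (hmem x hx (by linarith)) ξ hξ
    linarith
  -- the top eigenvector at the maximum point is again maximal
  obtain ⟨b, lam, hlam, hframe⟩ := exists_eigenframe (S.elliptic x₀ hx₀).1
  have hne : Nonempty (Fin n) := by
    by_contra hempty
    rw [not_nonempty_iff] at hempty
    have : ξ = 0 := by ext i; exact hempty.elim i
    rw [this, norm_zero] at hξ
    exact zero_ne_one hξ
  obtain ⟨o, ho⟩ := Finite.exists_max lam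
  have h := S.solutionAt hx₀ hlam hframe
  have hQo : Q x₀ (b o) = lam o := by simp only [hQ, hframe, if_true]
  have hQle : Q x₀ ξ₀ ≤ lam o := quadratic_le_of_frame b hframe ho hξ₀'
  have hTo : T x₀ ξ₀ ≤ T x₀ (b o) := by
    simp only [hT, hQo]
    gcongr
  have h2u : ContDiffAt ℝ 2 u x₀ := (S.contDiffAt_u hx₀).of_le (by norm_num)
  have h2χ : ContDiffAt ℝ 2 χ x₀ := hχs.contDiffAt (S.isOpen_Ω.mem_nhds hx₀)
  have h2η : ContDiffAt ℝ 2 (fun y => u₀ y - u y) x₀ := (S.contDiffAt_u₀ hx₀).sub h2u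
  have h2ζ : ContDiffAt ℝ 2 ζ x₀ :=
    h2η.sub (contDiffAt_const.mul (contDiffAt_const.sub h2χ))
  have hloc : IsLocalMax (fun y => (Real.log (augForm A u (b o) (b o) y) +
      τ * (‖gradient u y‖ ^ 2 / 2)) + (β * Real.log (ζ y) + χ y)) x₀ := by
    have hlogT : ∀ y ∈ Ω, 0 < ζ y → Real.log (T y (b o)) =
        (Real.log (augForm A u (b o) (b o) y) +
          τ * (‖gradient u y‖ ^ 2 / 2)) + (β * Real.log (ζ y) + χ y) := by
      intro y hy hy0
      have h1 := hQpos y hy (b o) (b.orthonormal.1 o)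
      have h2 := Real.rpow_pos_of_pos hy0 β
      simp only [hT, max_eq_left hy0.le]
      rw [Real.log_mul (mul_pos h1 h2).ne' (Real.exp_pos _).ne', Real.log_mul h1.ne' h2.ne',
        Real.log_exp, Real.log_rpow hy0,
        augForm_eq_sum ((S.contDiffAt_u hy).of_le (by norm_num))]
      ring
    filter_upwards [S.isOpen_Ω.mem_nhds hx₀,
      h2ζ.continuousAt.eventually (eventually_gt_nhds hζ₀)] with y hy hy0
    rw [← hlogT y hy hy0, ← hlogT x₀ hx₀ hζ₀]
    refine Real.log_le_log ?_ ((hTle y (hmem y hy hy0) _ (b.orthonormal.1 o)).trans hTo)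
    simp only [hT, max_eq_left hy0.le]
    exact mul_pos (mul_pos (hQpos y hy _ (b.orthonormal.1 o)) (Real.rpow_pos_of_pos hy0 _))
      (Real.exp_pos _)
  -- the estimate at the maximum point
  have hζZ : ζ x₀ ≤ 2 * m := by linarith [hζle x₀ hx₀, S.sub_le hx₀]
  have hprod : lam o * ζ x₀ ≤ D := by
    have hc₁ : 1 ≤ 2 * τ * (n * m + 1) ^ 3 + K₂ + 4 * m ^ 2 * τ * (n * m + 1) ^ 2 := by
      have h1 : 1 ≤ (n * m + 1) ^ 3 := one_le_pow₀ (by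
        have : (0 : ℝ) ≤ n * m := by positivity
        linarith)
      have h2 : 1 ≤ τ := by
        rw [hτ]
        have : (0 : ℝ) ≤ 38 * (n * m + 1) ^ 4 := by positivity
        linarith
      have h3 : 0 ≤ 4 * m ^ 2 * τ * (n * m + 1) ^ 2 := by positivity
      nlinarith
    by_cases hone : 1 ≤ lam o
    · have hχd : ∀ i, |dir (b i) χ x₀| ≤ L := by
        intro i
        rw [← inner_gradient]
        refine (abs_real_inner_le_norm _ _).trans ?_
        rw [b.orthonormal.1 i, mul_one]
        exact hχL x₀ hx₀
      have hζd : ∀ i, |dir (b i) ζ x₀| ≤ 2 * m + L := by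
        intro i
        have h1 : dir (b i) ζ x₀ = (dir (b i) u₀ x₀ - dir (b i) u x₀) + ε * dir (b i) χ x₀ := by
          have hform : ζ = fun y => ((u₀ y - u y) + ε * χ y) - ε * (1 + X) := by
            funext y; simp only [hζ]; ring
          have d1 : DifferentiableAt ℝ (fun y => u₀ y - u y) x₀ :=
            h2η.differentiableAt (by norm_num)
          have d2 : DifferentiableAt ℝ (fun y => ε * χ y) x₀ :=
            (h2χ.differentiableAt (by norm_num)).const_mul ε
          rw [hform, dir_sub (d1.fun_add d2) (differentiableAt_const _), dir_add d1 d2, dir_const,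
            dir_const_mul (h2χ.differentiableAt (by norm_num)),
            dir_sub ((S.contDiffAt_u₀ hx₀).differentiableAt (by norm_num))
              (h2u.differentiableAt (by norm_num)), sub_zero]
        have hg : ∀ {f : EuclideanSpace ℝ (Fin n) → ℝ}, ‖gradient f x₀‖ ≤ m →
            |dir (b i) f x₀| ≤ m := by
          intro f hf
          rw [← inner_gradient]
          refine (abs_real_inner_le_norm _ _).trans ?_
          rwa [b.orthonormal.1 i, mul_one]
        rw [h1]
        refine (abs_add_le _ _).trans ?_
        have h3 := abs_sub (dir (b i) u₀ x₀) (dir (b i) u x₀)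
        have h4 := hg (S.norm_gradient_le hx₀)
        have h5 := hg (S.norm_gradient₀_le hx₀)
        have h6 : |ε * dir (b i) χ x₀| ≤ L := by
          rw [abs_mul, abs_of_pos hε]
          exact (mul_le_of_le_one_left (abs_nonneg _) hε1).trans (hχd i)
        linarith
      have hcut := h.frameOp_cutoff_ge (c := n + 2 * m ^ 2) (K₁ := 4 * m ^ 2) (X := X) h2η h2χ
        (S.frameOp_sub_ge ha hx₀ h) (hχop x₀ hx₀ b lam h) (hχ0 x₀ hx₀) ha0 (by positivity) hK₂
        hΛX hε.le hε1
      have hbound := h.lam_le_of_isLocalMax ho hone h2ζ h2χ hζ₀ hcut (hχop x₀ hx₀ b lam h) hζd hχd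
        (by positivity) hτ hΛ hβ12 hβL hβτ hloc
      exact mul_le_of_le_add_div hone hζ₀ hζZ (zero_le_one.trans hc₁) (by positivity) hβ.le
        (by positivity) (by positivity) hbound
    · push Not at hone
      have h1 : lam o * ζ x₀ ≤ 2 * m := by nlinarith
      have h2 : 0 ≤ β * (n + 2 * m ^ 2 + K₂) := by positivity
      have h3 : 0 ≤ β * (4 * m ^ 2 * (2 * m + L) * (2 * m) + (2 * m + L) ^ 2) := by positivity
      nlinarith
  -- transfer to the given point
  have hTxle : Q x ξ * ((u₀ x - u x) / 2) ^ β ≤ T x ξ := by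
    have h1 : ((u₀ x - u x) / 2) ^ β ≤ (max (ζ x) 0) ^ β :=
      Real.rpow_le_rpow (by positivity) (hζx.trans (le_max_left _ _)) hβ.le
    have h2 : 1 ≤ Real.exp (τ * (‖gradient u x‖ ^ 2 / 2) + χ x) :=
      Real.one_le_exp (add_nonneg (by positivity) (hχ0 x hx))
    have h3 : 0 ≤ Q x ξ * (max (ζ x) 0) ^ β :=
      mul_nonneg (hQpos x hx ξ hξ).le (Real.rpow_nonneg (le_max_right _ _) _)
    calc Q x ξ * ((u₀ x - u x) / 2) ^ β ≤ Q x ξ * (max (ζ x) 0) ^ β :=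
          mul_le_mul_of_nonneg_left h1 (hQpos x hx ξ hξ).le
      _ ≤ T x ξ := le_mul_of_one_le_right h3 h2
  have hTx₀ : T x₀ (b o) ≤ D * (2 * m) ^ (β - 1) * Real.exp (τ * (m ^ 2 / 2) + X) := by
    have h1 : (max (ζ x₀) 0) ^ β = ζ x₀ * ζ x₀ ^ (β - 1) := by
      rw [max_eq_left hζ₀.le, ← Real.rpow_one_add' hζ₀.le (by linarith)]
      congr 1; ring
    have h2 : ζ x₀ ^ (β - 1) ≤ (2 * m) ^ (β - 1) :=
      Real.rpow_le_rpow hζ₀.le hζZ (by linarith)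
    have h3 : Real.exp (τ * (‖gradient u x₀‖ ^ 2 / 2) + χ x₀) ≤
        Real.exp (τ * (m ^ 2 / 2) + X) := by
      have := S.norm_gradient_le hx₀
      have := hχX x₀ hx₀
      gcongr
    have h0 : 0 ≤ lam o * ζ x₀ := mul_nonneg (hlam o).le hζ₀.le
    have hD0 : 0 ≤ D := h0.trans hprod
    simp only [hT, hQo, h1, ← mul_assoc]
    gcongr
  have hfin := (hTxle.trans (hTle x (hmem x hx (by linarith)) ξ hξ)).trans (hTo.trans hTx₀)
  have hpow : (u₀ x - u x) ^ β = 2 ^ β * ((u₀ x - u x) / 2) ^ β := by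
    rw [← Real.mul_rpow (by norm_num) (by positivity)]
    congr 1; ring
  rw [hpow, mul_assoc]
  refine mul_le_mul_of_nonneg_left ?_ (Real.rpow_nonneg (by norm_num) _)
  rw [mul_comm]
  exact hfin

/-- A bound for the quadratic form of the augmented Hessian on unit vectors is a bound for the
Hessian. -/
theorem hessianNorm_le {x : EuclideanSpace ℝ (Fin n)} (hx : x ∈ Ω) {c : ℝ} (hc0 : 0 ≤ c)
    (hc : ∀ ξ : EuclideanSpace ℝ (Fin n), ‖ξ‖ = 1 →
      ∑ k, ∑ l, augHessian A u x k l * (ξ k * ξ l) ≤ c) :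
    hessianNorm u x ≤ n * (c + m) := by
  have hm := S.one_le
  have hW := (S.elliptic x hx).1.posSemidef
  have hdiag : ∀ i, augHessian A u x i i ≤ c := by
    intro i
    have := hc (EuclideanSpace.single i 1) (by simp)
    simpa using this
  have hdiag0 : ∀ i, 0 ≤ augHessian A u x i i := fun i => hW.diag_nonneg
  have hentry : ∀ i j, |augHessian A u x i j| ≤ c := by
    intro i j
    have h1 := (hW.submatrix ![i, j]).det_nonneg
    rw [Matrix.det_fin_two] at h1
    have h2 : augHessian A u x j i = augHessian A u x i j := hW.isHermitian.apply i j
    simp [h2] at h1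
    refine abs_le_of_sq_le_sq ?_ hc0
    have h3 : augHessian A u x i i * augHessian A u x j j ≤ c * c :=
      mul_le_mul (hdiag i) (hdiag j) (hdiag0 j) hc0
    nlinarith
  have hAe : ∀ i j, |A (oneJet u x) i j| ≤ m := by
    intro i j
    have h1 := (form_bounds S.dataNorm_le (S.jet_u x hx) (S.contDiffAt_A (S.jet_u x hx))
      (ξ := EuclideanSpace.single i 1) (ζ := EuclideanSpace.single j 1) (by simp) (by simp)).1
    have h2 : form A (EuclideanSpace.single i 1) (EuclideanSpace.single j 1) (oneJet u x) =
        A (oneJet u x) i j := by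
      simp [form]
    rw [h2] at h1
    exact h1.trans S.M_le
  have hh : ∀ i j, hessian u x i j ^ 2 ≤ (c + m) ^ 2 := by
    intro i j
    have h1 : hessian u x i j = augHessian A u x i j + A (oneJet u x) i j := by
      simp [augHessian]
    rw [h1, ← sq_abs]
    have h2 := (abs_add_le (augHessian A u x i j) (A (oneJet u x) i j)).trans
      (add_le_add (hentry i j) (hAe i j))
    gcongr
  rw [hessianNorm]
  refine Real.sqrt_le_iff.2 ⟨by positivity, ?_⟩
  calc ∑ i, ∑ j, hessian u x i j ^ 2 ≤ ∑ _i : Fin n, ∑ _j : Fin n, (c + m) ^ 2 :=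
        Finset.sum_le_sum fun i _ => Finset.sum_le_sum fun j _ => hh i j
    _ = _ := by simp; ring

/-- The estimate for the full Hessian from the estimate for the quadratic form. -/
theorem rpow_mul_hessianNorm_le {x : EuclideanSpace ℝ (Fin n)} (hx : x ∈ Ω) {β C : ℝ}
    (hβ : 0 ≤ β) (hC : 0 ≤ C)
    (hc : ∀ ξ : EuclideanSpace ℝ (Fin n), ‖ξ‖ = 1 →
      (u₀ x - u x) ^ β * ∑ k, ∑ l, augHessian A u x k l * (ξ k * ξ l) ≤ C) :
    (u₀ x - u x) ^ β * hessianNorm u x ≤ n * (C + (2 * m) ^ β * m) := by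
  have hη : 0 < u₀ x - u x := sub_pos.2 (S.lt x hx)
  have hm := S.one_le
  have ht : 0 < (u₀ x - u x) ^ β := Real.rpow_pos_of_pos hη β
  have h1 := S.hessianNorm_le hx (c := C / (u₀ x - u x) ^ β) (by positivity) (fun ξ hξ => by
    rw [le_div_iff₀ ht, mul_comm]
    exact hc ξ hξ)
  have h2 : (u₀ x - u x) ^ β ≤ (2 * m) ^ β := Real.rpow_le_rpow hη.le (S.sub_le hx) hβ
  calc (u₀ x - u x) ^ β * hessianNorm u x
      ≤ (u₀ x - u x) ^ β * (n * (C / (u₀ x - u x) ^ β + m)) := by gcongr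
    _ = n * (C + (u₀ x - u x) ^ β * m) := by field_simp
    _ ≤ _ := by gcongr

end PogorelovSetting

end Estimate

/-! ### The choice of the barrier and of the constants -/

section Barriers

variable {n : ℕ}

namespace PogorelovSetting

variable {U U₀ : Set (Jet n)} {M : ℝ≥0} {m : ℝ}
    {A : Jet n → Matrix (Fin n) (Fin n) ℝ} {B : Jet n → ℝ}
    {Ω : Set (EuclideanSpace ℝ (Fin n))} {u u₀ : EuclideanSpace ℝ (Fin n) → ℝ}
    (S : PogorelovSetting U U₀ M m A B Ω u u₀)

include S

/-- The estimate with the barrier `exp (κ φ)`. -/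
theorem rpow_mul_quadratic_le_of_barrier {φ : EuclideanSpace ℝ (Fin n) → ℝ}
    {C Φ a τ β Λ κ : ℝ} (ha0 : 0 ≤ a)
    (ha : ∀ q ∈ U₀, ∀ ξ : EuclideanSpace ℝ (Fin n), ‖ξ‖ = 1 →
      -a ≤ fderiv ℝ (form A ξ ξ) q (0, 1, 0))
    (hφs : ContDiffOn ℝ 2 φ Ω) (hφ0 : ∀ x ∈ Ω, 0 ≤ φ x) (hφΦ : ∀ x ∈ Ω, φ x ≤ Φ)
    (hφg : ∀ x ∈ Ω, ‖gradient φ x‖ ≤ Φ) (hC : 0 ≤ C) (hΦ : 0 ≤ Φ)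
    (hop : ∀ x ∈ Ω, (augHessian A u x)⁻¹.trace - C ≤ linearizedOp A u φ x)
    (hΛ0 : 0 ≤ Λ) (hκ : (4 * m ^ 2) ^ 2 + Λ ≤ κ)
    (hτ : τ = 2 * (38 * (n * m + 1) ^ 4 + 2))
    (hΛ : 38 * (n * m + 1) ^ 4 + 2 * τ * (n * m + 1) ^ 3 + β * a +
      ((4 * m ^ 2) ^ 2 + 4 * m ^ 2 * τ * (n * m + 1) ^ 2 + (n * m + 1) + 1) ≤ Λ)
    (hΛX : a * (1 + Real.exp (κ * Φ)) ≤ Λ)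
    (hβ12 : 12 ≤ β) (hβL : 3 * (κ * Real.exp (κ * Φ) * Φ) ^ 2 ≤ β)
    (hβτ : 6 * τ ^ 2 * (n * m + 1) ^ 3 ≤ β)
    {x : EuclideanSpace ℝ (Fin n)} (hx : x ∈ Ω) {ξ : EuclideanSpace ℝ (Fin n)} (hξ : ‖ξ‖ = 1) :
    (u₀ x - u x) ^ β * ∑ k, ∑ l, augHessian A u x k l * (ξ k * ξ l) ≤
      pogorelovBound n m τ β (κ * Real.exp (κ * Φ) * (C + m * Φ)) (κ * Real.exp (κ * Φ) * Φ)
        (Real.exp (κ * Φ)) := by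
  have hm := S.one_le
  have hκ0 : 0 ≤ κ := le_trans (by positivity) hκ
  have hexp : ∀ y ∈ Ω, Real.exp (κ * φ y) ≤ Real.exp (κ * Φ) := by
    intro y hy
    have := hφΦ y hy
    gcongr
  have hφ2 : ∀ y ∈ Ω, ContDiffAt ℝ 2 φ y := fun y hy =>
    hφs.contDiffAt (S.isOpen_Ω.mem_nhds hy)
  refine S.rpow_mul_quadratic_le (χ := fun y => Real.exp (κ * φ y)) ha0 ha
    (contDiffOn_const.mul hφs).exp (fun y _ => (Real.exp_pos _).le) hexp (fun y hy => ?_)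
    (by positivity) (fun x₀ hx₀ b lam h => ?_) hτ hΛ hΛX hβ12 hβL hβτ hx hξ
  · have hd : DifferentiableAt ℝ φ y := (hφ2 y hy).differentiableAt (by norm_num)
    have hg : gradient (fun y => Real.exp (κ * φ y)) y =
        (Real.exp (κ * φ y) * κ) • gradient φ y := by
      refine gradient_eq_of_dir fun w => ?_
      rw [dir_exp (hd.const_mul κ), dir_const_mul hd, real_inner_smul_left, inner_gradient,
        mul_assoc]
    rw [hg, norm_smul, Real.norm_of_nonneg (mul_nonneg (Real.exp_pos _).le hκ0)]
    have h1 := hexp y hy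
    have h2 := hφg y hy
    rw [mul_comm (Real.exp (κ * φ y)) κ]
    gcongr
  · exact h.frameOp_exp_barrier_ge (hφ2 x₀ hx₀) (hφ0 x₀ hx₀) (hφΦ x₀ hx₀) (hφg x₀ hx₀) hC
      (hop x₀ hx₀) hΛ0 hκ

/-- The estimate on a domain of small diameter, where a multiple of the squared distance to a
point serves as barrier, and no barrier needs to be given. -/
theorem rpow_mul_quadratic_le_of_dist_le {τ β Λ d : ℝ}
    (hd : ∀ x ∈ Ω, ∀ y ∈ Ω, dist x y ≤ d) (hdm : 2 * (m + 4 * m ^ 2) * d ≤ 1)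
    (hΛd : 2 * Λ * d ≤ 1) (hd1 : d ≤ 1) (hΛ0 : 0 ≤ Λ)
    (hτ : τ = 2 * (38 * (n * m + 1) ^ 4 + 2))
    (hΛ : 38 * (n * m + 1) ^ 4 + 2 * τ * (n * m + 1) ^ 3 + β * m +
      ((4 * m ^ 2) ^ 2 + 4 * m ^ 2 * τ * (n * m + 1) ^ 2 + (n * m + 1) + 1) ≤ Λ)
    (hΛX : m * (1 + 1) ≤ Λ)
    (hβ12 : 12 ≤ β) (hβτ : 6 * τ ^ 2 * (n * m + 1) ^ 3 ≤ β)
    {x : EuclideanSpace ℝ (Fin n)} (hx : x ∈ Ω) {ξ : EuclideanSpace ℝ (Fin n)} (hξ : ‖ξ‖ = 1) :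
    (u₀ x - u x) ^ β * ∑ k, ∑ l, augHessian A u x k l * (ξ k * ξ l) ≤
      pogorelovBound n m τ β m 1 1 := by
  have hm := S.one_le
  have hd0 : 0 ≤ d := dist_nonneg.trans (hd x hx x hx)
  have hdx : ∀ y ∈ Ω, ‖y - x‖ ≤ d := fun y hy => by
    rw [← dist_eq_norm]; exact hd y hy x hx
  have hA : ∀ q ∈ U₀, ∀ ξ : EuclideanSpace ℝ (Fin n), ‖ξ‖ = 1 →
      -m ≤ fderiv ℝ (form A ξ ξ) q (0, 1, 0) := by
    intro q hq ξ hξ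
    have h1 := (form_bounds S.dataNorm_le hq (S.contDiffAt_A hq) hξ hξ).2.1.trans S.M_le
    have h2 := (fderiv ℝ (form A ξ ξ) q).le_opNorm (0, 1, 0)
    have h3 : ‖((0, 1, 0) : Jet n)‖ = 1 := by simp [Prod.norm_def]
    rw [h3, mul_one] at h2
    exact (abs_le.1 (h2.trans h1)).1
  refine S.rpow_mul_quadratic_le (χ := fun y => 2 * Λ * (‖y - x‖ ^ 2 / 2)) (by positivity) hA
    (contDiff_const.mul (contDiff_norm_sub_sq x 2)).contDiffOn (fun y _ => by positivity)
    (fun y hy => ?_) (fun y hy => ?_) (by positivity) (fun x₀ hx₀ b lam h => ?_) hτ hΛ hΛX hβ12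
    (by linarith) hβτ hx hξ
  · have h1 := hdx y hy
    have h2 : ‖y - x‖ ^ 2 ≤ d ^ 2 := by gcongr
    have h3 : 2 * Λ * (‖y - x‖ ^ 2 / 2) ≤ 2 * Λ * (d ^ 2 / 2) := by gcongr
    have h4 : (2 * Λ * d) * d ≤ 1 := by nlinarith
    have h5 := mul_nonneg hΛ0 (sq_nonneg d)
    nlinarith
  · have hg : gradient (fun y => 2 * Λ * (‖y - x‖ ^ 2 / 2)) y = (2 * Λ) • (y - x) := by
      refine gradient_eq_of_dir fun w => ?_
      rw [dir_const_mul ((contDiff_norm_sub_sq x 1).differentiable (by norm_num) y),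
        dir_norm_sub_sq, real_inner_smul_left]
    rw [hg, norm_smul, Real.norm_of_nonneg (by positivity)]
    refine le_trans ?_ hΛd
    have := hdx y hy
    gcongr
  · exact h.frameOp_quadratic_barrier_ge (hdx x₀ hx₀) hdm hΛd le_rfl (by positivity)
      (by positivity)

/-- The lower bound for the derivative of `A` in `z`, for the quadratic forms of unit vectors. -/
theorem neg_le_fderiv_form_of_posDef {δ : ℝ} {q : Jet n} (hq : q ∈ U₀)
    (h : (matrixDz A q + δ • (1 : Matrix (Fin n) (Fin n) ℝ)).PosDef)
    {ξ : EuclideanSpace ℝ (Fin n)} (hξ : ‖ξ‖ = 1) :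
    -δ ≤ fderiv ℝ (form A ξ ξ) q (0, 1, 0) := by
  have hξ0 : ξ ≠ 0 := by
    rintro rfl
    rw [norm_zero] at hξ
    exact zero_ne_one hξ
  have h1 := quadratic_pos_of_posDef h hξ0
  have h2 : ∑ k, ξ k * ξ k = 1 := by
    have h3 := hξ
    rw [EuclideanSpace.norm_eq, Real.sqrt_eq_one] at h3
    simpa [← sq] using h3
  simp only [Matrix.add_apply, Matrix.smul_apply, Matrix.one_apply, smul_eq_mul, mul_ite, mul_one,
    mul_zero, add_mul, ite_mul, zero_mul, Finset.sum_add_distrib, Finset.sum_ite_eq,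
    Finset.mem_univ, if_true, ← Finset.mul_sum, h2] at h1
  have h4 : fderiv ℝ (form A ξ ξ) q (0, 1, 0) =
      ∑ k, ∑ l, matrixDz A q k l * (ξ k * ξ l) := by
    rw [fderiv_form fun i j => (S.contDiffAt_A hq i j).differentiableAt (by norm_num)]
    simp only [FunLike.coe_sum, Finset.sum_apply, smul_apply, smul_eq_mul]
    refine Finset.sum_congr rfl fun k _ => Finset.sum_congr rfl fun l _ => ?_
    rw [mul_comm]
    rfl
  linarith

end PogorelovSetting

/-- Pointwise bounds for a function and its gradient from its `C¹` norm. -/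
theorem bounds_of_cNorm_one {φ : EuclideanSpace ℝ (Fin n) → ℝ}
    {Ω : Set (EuclideanSpace ℝ (Fin n))} {Φ : ℝ≥0} (hφ : cNorm 1 φ Ω ≤ Φ)
    {x : EuclideanSpace ℝ (Fin n)} (hx : x ∈ Ω) : φ x ≤ Φ ∧ ‖gradient φ x‖ ≤ Φ := by
  have htop : cNorm 1 φ Ω ≠ ⊤ := ne_top_of_le_ne_top ENNReal.coe_ne_top hφ
  have hle : (cNorm 1 φ Ω).toReal ≤ Φ := by
    simpa using ENNReal.toReal_mono ENNReal.coe_ne_top hφ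
  constructor
  · have := norm_iteratedFDeriv_le_of_cNorm htop (j := 0) (by norm_num) hx
    rw [norm_iteratedFDeriv_zero] at this
    exact (le_abs_self _).trans (this.trans hle)
  · have := norm_iteratedFDeriv_le_of_cNorm htop (j := 1) le_rfl hx
    rw [← norm_iteratedFDeriv_fderiv (n := 0), norm_iteratedFDeriv_zero] at this
    rw [gradient, LinearIsometryEquiv.norm_map]
    exact this.trans hle

end Barriers

end MATE

theorem theorem2p1 (n : ℕ) (U U₀ : Set (Jet n))
    (hU_open : IsOpen U) (hU_conn : IsConnected U)
    (hU_convex : ∀ (x : EuclideanSpace ℝ (Fin n)) (z : ℝ),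
      Convex ℝ {p : EuclideanSpace ℝ (Fin n) | (x, z, p) ∈ U})
    (hU₀_compact : IsCompact (closure U₀)) (hU₀_sub : closure U₀ ⊆ U)
    (M : ℝ≥0) (C' : ℝ) (hC' : 0 ≤ C') (Φ : ℝ≥0) :
    ∃ β δ₁ δ₂ C : ℝ, 0 < β ∧ 0 < δ₁ ∧ 0 < δ₂ ∧ 0 < C ∧
      ∀ (A : Jet n → Matrix (Fin n) (Fin n) ℝ) (B : Jet n → ℝ)
        (Ω : Set (EuclideanSpace ℝ (Fin n))) (u u₀ φ : EuclideanSpace ℝ (Fin n) → ℝ),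
        -- the data
        (∀ q ∈ U, (A q).IsSymm) →
        (∀ i j, ContDiffOn ℝ 2 (fun q => A q i j) U) →
        ContDiffOn ℝ 2 B U →
        (∀ q ∈ U, 0 < B q) →
        IsRegularMatrix A U →
        dataNorm A B U₀ ≤ M →
        -- the domain
        IsOpen Ω → IsConnected Ω → Bornology.IsBounded Ω →
        -- the solution and the supersolution
        ContDiffOn ℝ 4 u Ω → IsLipschitzUpToBoundary Ω u →
        ContDiffOn ℝ 2 u₀ Ω → IsLipschitzUpToBoundary Ω u₀ →
        (∀ x ∈ Ω, oneJet u x ∈ U₀) → (∀ x ∈ Ω, oneJet u₀ x ∈ U₀) →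
        -- the intermediate jets `(x, z, Du₀)`, `u ≤ z ≤ u₀`, and `(x, u, p)`, `p ∈ [Du, Du₀]`
        (∀ x ∈ Ω, ∀ z ∈ Set.Icc (u x) (u₀ x), (x, z, gradient u₀ x) ∈ U₀) →
        (∀ x ∈ Ω, ∀ p ∈ segment ℝ (gradient u x) (gradient u₀ x), (x, u x, p) ∈ U₀) →
        IsEllipticSolution A B Ω u →
        IsDegenerateEllipticSupersolution A B Ω u₀ →
        (∀ x ∈ frontier Ω, u x = u₀ x) →
        (∀ x ∈ Ω, u x < u₀ x) →
        -- the barrier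
        IsC2UpToBoundary Ω φ →
        (∀ x ∈ Ω, 0 ≤ φ x) →
        cNorm 1 φ Ω ≤ Φ →
        (∀ x ∈ Ω, (augHessian A u x)⁻¹.trace - C' ≤ linearizedOp A u φ x) →
        -- one of the two smallness conditions
        ((∀ q ∈ U₀, (matrixDz A q + δ₁ • (1 : Matrix (Fin n) (Fin n) ℝ)).PosDef) ∨
          Metric.diam Ω < δ₂) →
        ∀ x ∈ Ω, (u₀ x - u x) ^ β * hessianNorm u x ≤ C := by
  obtain ⟨R, hR⟩ := hU₀_compact.isBounded.exists_norm_le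
  -- `m` bounds all the data
  obtain ⟨m, hm1, hMm, hRm⟩ : ∃ m : ℝ, 1 ≤ m ∧ M ≤ m ∧ R ≤ m := by
    refine ⟨1 + M + |R|, ?_, ?_, ?_⟩ <;>
      linarith [M.coe_nonneg, abs_nonneg R, le_abs_self R]
  -- the coefficient `τ` of `|Du|² / 2` and the size `c + 1` of the barrier
  -- `exp (κ φ)`, both independent of `β`
  obtain ⟨τ, hτ⟩ : ∃ τ : ℝ, τ = 2 * (38 * (n * m + 1) ^ 4 + 2) := ⟨_, rfl⟩
  have hτ0 : 0 ≤ τ := by rw [hτ]; positivity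
  obtain ⟨c, hc⟩ : ∃ c : ℝ, c = 38 * (n * m + 1) ^ 4 + 2 * τ * (n * m + 1) ^ 3 +
      ((4 * m ^ 2) ^ 2 + 4 * m ^ 2 * τ * (n * m + 1) ^ 2 + (n * m + 1) + 1) := ⟨_, rfl⟩
  have hc0 : 0 ≤ c := by rw [hc]; positivity
  obtain ⟨κ, hκ⟩ : ∃ κ : ℝ, κ = (4 * m ^ 2) ^ 2 + (c + 1) := ⟨_, rfl⟩
  have hκ0 : 0 ≤ κ := by rw [hκ]; positivity
  -- `β` dominates the gradient of the barrier; it has to be fixed before `δ₁`, since `β δ₁` enters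
  obtain ⟨β, hβ12, hβL, hβτ⟩ : ∃ β : ℝ, 12 ≤ β ∧
      3 * (κ * Real.exp (κ * Φ) * Φ) ^ 2 ≤ β ∧ 6 * τ ^ 2 * (n * m + 1) ^ 3 ≤ β := by
    have h1 : 0 ≤ 3 * (κ * Real.exp (κ * Φ) * Φ) ^ 2 := by positivity
    have h2 : 0 ≤ 6 * τ ^ 2 * (n * m + 1) ^ 3 := by positivity
    exact ⟨12 + 3 * (κ * Real.exp (κ * Φ) * Φ) ^ 2 + 6 * τ ^ 2 * (n * m + 1) ^ 3, by linarith,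
      by linarith, by linarith⟩
  have hβ : 0 < β := by linarith
  obtain ⟨δ₁, hδ₁, hδβ, hδX⟩ : ∃ δ₁ : ℝ, 0 < δ₁ ∧ β * δ₁ ≤ 1 ∧
      δ₁ * (1 + Real.exp (κ * Φ)) ≤ 1 := by
    have he := Real.exp_pos (κ * Φ)
    refine ⟨min (1 / β) (1 / (1 + Real.exp (κ * Φ))), by positivity, ?_, ?_⟩
    · rw [mul_comm, ← le_div_iff₀ hβ]; exact min_le_left _ _
    · rw [← le_div_iff₀ (by positivity)]; exact min_le_right _ _
  -- the size of the barrier on a domain of small diameter depends on `β`, but its gradient does not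
  obtain ⟨Λ, hΛ⟩ : ∃ Λ : ℝ, Λ = c + β * m + m * (1 + 1) := ⟨_, rfl⟩
  have hΛ0 : 0 ≤ Λ := by rw [hΛ]; positivity
  obtain ⟨δ₂, hδ₂, hδm, hδΛ, hδ1⟩ : ∃ δ₂ : ℝ, 0 < δ₂ ∧ 2 * (m + 4 * m ^ 2) * δ₂ ≤ 1 ∧
      2 * Λ * δ₂ ≤ 1 ∧ δ₂ ≤ 1 := by
    have h1 : 0 ≤ 2 * (m + 4 * m ^ 2) := by positivity
    have h2 : 0 < 2 * (m + 4 * m ^ 2) + 2 * Λ + 1 := by positivity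
    refine ⟨1 / (2 * (m + 4 * m ^ 2) + 2 * Λ + 1), by positivity, ?_, ?_, ?_⟩
    · rw [mul_one_div, div_le_one h2]; linarith
    · rw [mul_one_div, div_le_one h2]; linarith
    · rw [div_le_one h2]; linarith
  set P₁ := pogorelovBound n m τ β (κ * Real.exp (κ * Φ) * (C' + m * Φ))
    (κ * Real.exp (κ * Φ) * Φ) (Real.exp (κ * Φ)) with hP₁
  set P₂ := pogorelovBound n m τ β m 1 1 with hP₂
  refine ⟨β, δ₁, δ₂, n * (|P₁| + |P₂| + (2 * m) ^ β * m) + 1, hβ, hδ₁, hδ₂, by positivity, ?_⟩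
  intro A B Ω u u₀ φ hsymm hA hB hBpos hreg hM hΩ _ hΩb hu hulip hu₀ hu₀lip hju hju₀ hsegz hsegp
    hell hsuper hbd hlt hφ2 hφ0 hφΦ hφop hcase x hx
  obtain ⟨Ku, hKu⟩ := hulip
  obtain ⟨Ku₀, hKu₀⟩ := hu₀lip
  have S : PogorelovSetting U U₀ M m A B Ω u u₀ :=
    { isOpen_U := hU_open
      subset_U := subset_closure.trans hU₀_sub
      symm := hsymm
      smooth_A := hA
      smooth_B := hB
      B_pos := hBpos
      regular := hreg
      dataNorm_le := hM
      M_le := hMm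
      one_le := hm1
      norm_le := fun q hq => (hR q (subset_closure hq)).trans hRm
      isOpen_Ω := hΩ
      bounded_Ω := hΩb
      smooth_u := hu
      cont_u := hKu.continuousOn
      smooth_u₀ := hu₀
      cont_u₀ := hKu₀.continuousOn
      jet_u := hju
      jet_u₀ := hju₀
      seg_z := hsegz
      seg_p := hsegp
      elliptic := hell
      psd := fun y hy => (hsuper y hy).1
      boundary := hbd
      lt := hlt }
  have hbound : ∀ ξ : EuclideanSpace ℝ (Fin n), ‖ξ‖ = 1 →
      (u₀ x - u x) ^ β * ∑ k, ∑ l, augHessian A u x k l * (ξ k * ξ l) ≤ |P₁| + |P₂| := by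
    intro ξ hξ
    rcases hcase with hDz | hdiam
    · refine le_trans ?_ ((le_abs_self P₁).trans (le_add_of_nonneg_right (abs_nonneg P₂)))
      refine S.rpow_mul_quadratic_le_of_barrier (Λ := c + 1) hδ₁.le
        (fun q hq ξ hξ => S.neg_le_fderiv_form_of_posDef hq (hDz q hq) hξ) hφ2.1 hφ0
        (fun y hy => (bounds_of_cNorm_one hφΦ hy).1) (fun y hy => (bounds_of_cNorm_one hφΦ hy).2)
        hC' Φ.coe_nonneg hφop (by linarith) hκ.ge hτ (by linarith) (by linarith) hβ12 hβL hβτ hx hξ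
    · refine le_trans ?_ ((le_abs_self P₂).trans (le_add_of_nonneg_left (abs_nonneg P₁)))
      have h1 : 0 ≤ β * m := by positivity
      refine S.rpow_mul_quadratic_le_of_dist_le (Λ := Λ)
        (fun y hy z hz => (Metric.dist_le_diam_of_mem hΩb hy hz).trans hdiam.le) hδm hδΛ hδ1 hΛ0
        hτ (by linarith) (by linarith) hβ12 hβτ hx hξ
  have := S.rpow_mul_hessianNorm_le hx hβ.le (by positivity) hbound
  linarith
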